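/- Let $\lambda,\mu\ge 0$ be real numbers, not both zero. All functions are complex valued, $\hat f(\xi,\eta)=\int_{\mathbb R^2} e^{-2\pi i(x\xi+y\eta)}f(x,y)\,dx\,dy$ is the Fourier transform on $L^2=L^2(\mathbb R^2)$, and $D_x^{s}$, $\partial_x^{-k}$, $\partial_y$ denote the Fourier multipliers with symbols $|2\pi\xi|^{s}$, $(2\pi i\xi)^{-k}$, $2\pi i\eta$. Let $X^{1/2}$ be the space of all $f\in L^2$ for which $$\|f\|_{X^{1/2}}^2=\|f\|_{L^2}^2+\|D_x^{1/2}f\|_{L^2}^2+\lambda\|D_x^{-1/2}\partial_yf\|_{L^2}^2+\mu\|\partial_x^{-1}\partial_yf\|_{L^2}^2$$ is finite, and let $X^0$ be the space of all $f\in L^2$ for which $$\|f\|_{X^0}^2=\|f\|_{L^2}^2+\|\partial_xf\|_{L^2}^2+\lambda\|\partial_x^{-1}\partial_y^2f\|_{L^2}^2+\mu\|\partial_x^{-2}\partial_y^2f\|_{L^2}^2$$ is finite (a term whose coefficient is $0$ imposes no condition). For an open set $\Omega\subset\mathbb R^2$ and $X\in\{X^{1/2},X^0\}$ let $X(\Omega)=\{f\in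 L^2(\Omega): f=g|_\Omega \text{ for some } g\in X\}$, with the norm $\|f\|_{X(\Omega)}=\inf\{\|g\|_X: g\in X,\ g|_\Omega=f\}$. For a compatible couple $(A_0,A_1)$ of normed spaces and $0<\theta<1$, let $[A_0,A_1]_{[\theta]}$ denote the complex interpolation space, that is, the set of all $F(\theta)$, with norm $\|v\|_{[\theta]}=\inf_{F(\theta)=v}\max\bigl(\sup_t\|F(it)\|_{A_0},\sup_t\|F(1+it)\|_{A_1}\bigr)$, where $F$ runs over the bounded continuous functions from $\{0\le\operatorname{Re}z\le1\}$ to $A_0+A_1$ that are analytic in $\{0<\operatorname{Re}z<1\}$ and for which $t\mapsto F(it)$ and $t\mapsto F(1+it)$ are continuous from $\mathbb R$ to $A_0$ and to $A_1$, respectively, and tend to $0$ there as $|t|\to\infty$. **Statement.** Let $\Omega=(a,b)\times(c,d)$ with real $a<b$ and $c<d$. Then $$X^{1/2}(\Omega)=[L^2(\Omega),X^0(\Omega)]_{[1/2]}$$ as sets, and the two norms are equivalent: there are constants $C_1,C_2>0$ (which may depend on $a,b,c,d,\lambda,\mu$) with $C_1\|f\|_{X^{1/2}(\Omega)}\le\|f\|_{[1/2]}\le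 C_2\|f\|_{X^{1/2}(\Omega)}$ for all $f\in X^{1/2}(\Omega)$. -/

import Mathlib

open MeasureTheory Complex
open scoped FourierTransform ENNReal ZeroAtInfty

noncomputable section

/-! ### Anisotropic spaces on the plane, defined by Fourier multipliers -/

/-- The plane `ℝ²` with the Euclidean norm; `p 0` is the variable `x` and `p 1` the variable `y`
(`ξ` and `η` on the Fourier side). -/
abbrev Plane : Type := EuclideanSpace ℝ (Fin 2)

/-- Complex `L²(ℝ²)`. -/
abbrev PlaneL2 : Type := Lp ℂ 2 (volume : Measure Plane)

/-- Complex `L²(Ω)`. -/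
abbrev RegionL2 (Ω : Set Plane) : Type := Lp ℂ 2 ((volume : Measure Plane).restrict Ω)

/-- The subspace of those `f ∈ L²(ℝ²)` for which `m k · 𝓕 f ∈ L²(ℝ²)` for every `k`. -/
def multSubmodule (m : Fin 3 → Plane → ℂ) : Submodule ℂ PlaneL2 where
  carrier := {f | ∀ k, MemLp (fun p => m k p * (𝓕 f : PlaneL2) p) 2 volume}
  zero_mem' := by
    intro k
    have h : (fun p => m k p * (𝓕 (0 : PlaneL2) : PlaneL2) p) =ᵐ[volume] 0 := by
      have h0 : (𝓕 (0 : PlaneL2) : PlaneL2) = 0 := (Lp.fourierTransformₗᵢ Plane ℂ).map_zero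
      rw [h0]
      filter_upwards [Lp.coeFn_zero ℂ 2 (volume : Measure Plane)] with p hp
      simp
    exact (memLp_congr_ae h).2 MemLp.zero
  add_mem' := by
    intro f g hf hg k
    have h : (fun p => m k p * (𝓕 (f + g) : PlaneL2) p) =ᵐ[volume]
        (fun p => m k p * (𝓕 f : PlaneL2) p) + fun p => m k p * (𝓕 g : PlaneL2) p := by
      have h0 : (𝓕 (f + g) : PlaneL2) = 𝓕 f + 𝓕 g := (Lp.fourierTransformₗᵢ Plane ℂ).map_add f g
      rw [h0]
      filter_upwards [Lp.coeFn_add (𝓕 f : PlaneL2) (𝓕 g)] with p hp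
      rw [Pi.add_apply] at hp ⊢
      rw [hp, mul_add]
    exact (memLp_congr_ae h).2 ((hf k).add (hg k))
  smul_mem' := by
    intro c f hf k
    have h : (fun p => m k p * (𝓕 (c • f) : PlaneL2) p) =ᵐ[volume]
        c • fun p => m k p * (𝓕 f : PlaneL2) p := by
      have h0 : (𝓕 (c • f) : PlaneL2) = c • 𝓕 f := (Lp.fourierTransformₗᵢ Plane ℂ).map_smul c f
      rw [h0]
      filter_upwards [Lp.coeFn_smul c (𝓕 f : PlaneL2)] with p hp
      simp [hp, mul_left_comm]
    exact (memLp_congr_ae h).2 ((hf k).const_smul c)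

/-- `multSubmodule m` as a type of its own, to be normed by
`‖f‖² = ‖f‖²_{L²} + ∑ k, ‖m k · 𝓕 f‖²_{L²}`. -/
def MultSpace (m : Fin 3 → Plane → ℂ) : Type := multSubmodule m

namespace MultSpace

variable (m : Fin 3 → Plane → ℂ)

instance : AddCommGroup (MultSpace m) := inferInstanceAs (AddCommGroup (multSubmodule m))

instance : Module ℂ (MultSpace m) := inferInstanceAs (Module ℂ (multSubmodule m))

/-- The underlying element of `L²(ℝ²)`. -/
def toL2 : MultSpace m →ₗ[ℂ] PlaneL2 := (multSubmodule m).subtype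

/-- The element `m k · 𝓕 f` of `L²(ℝ²)`. -/
def part (k : Fin 3) : MultSpace m →ₗ[ℂ] PlaneL2 where
  toFun f := (f.2 k).toLp
  map_add' f g := by
    rw [← MemLp.toLp_add]
    refine MemLp.toLp_congr _ _ ?_
    have h0 : (𝓕 ((f + g : MultSpace m).1) : PlaneL2) = 𝓕 f.1 + 𝓕 g.1 :=
      (Lp.fourierTransformₗᵢ Plane ℂ).map_add f.1 g.1
    rw [h0]
    filter_upwards [Lp.coeFn_add (𝓕 f.1 : PlaneL2) (𝓕 g.1)] with p hp
    rw [Pi.add_apply] at hp ⊢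
    rw [hp, mul_add]
  map_smul' c f := by
    rw [RingHom.id_apply, ← MemLp.toLp_const_smul]
    refine MemLp.toLp_congr _ _ ?_
    have h0 : (𝓕 ((c • f : MultSpace m).1) : PlaneL2) = c • 𝓕 f.1 :=
      (Lp.fourierTransformₗᵢ Plane ℂ).map_smul c f.1
    rw [h0]
    filter_upwards [Lp.coeFn_smul c (𝓕 f.1 : PlaneL2)] with p hp
    simp [hp, mul_left_comm]

/-- `f` together with all the `m k · 𝓕 f`, in the Hilbert sum of four copies of `L²(ℝ²)`. -/
def graph : MultSpace m →ₗ[ℂ] WithLp 2 (PlaneL2 × PiLp 2 fun _ : Fin 3 => PlaneL2) where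
  toFun f := WithLp.toLp 2 (toL2 m f, WithLp.toLp 2 fun k => part m k f)
  map_add' f g := by
    simp only [map_add]
    rfl
  map_smul' c f := by
    simp only [map_smul]
    rfl

theorem graph_injective : Function.Injective (graph m) := by
  intro f g h
  have h1 : toL2 m f = toL2 m g := congrArg (fun z => z.fst) h
  exact Subtype.ext h1

instance : NormedAddCommGroup (MultSpace m) :=
  NormedAddCommGroup.induced _ _ (graph m) (graph_injective m)

instance : NormedSpace ℂ (MultSpace m) := NormedSpace.induced ℂ _ _ (graph m)

theorem norm_sq_eq (f : MultSpace m) :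
    ‖f‖ ^ 2 = ‖toL2 m f‖ ^ 2 + ∑ k, ‖part m k f‖ ^ 2 := by
  have h : ‖f‖ = ‖graph m f‖ := rfl
  rw [h, WithLp.prod_norm_sq_eq_of_L2, PiLp.norm_sq_eq_of_L2]
  rfl

/-- The inclusion of `MultSpace m` in `L²(ℝ²)`. -/
def incl : MultSpace m →L[ℂ] PlaneL2 :=
  (toL2 m).mkContinuous 1 fun f => by
    rw [one_mul]
    refine le_of_sq_le_sq ?_ (norm_nonneg f)
    rw [norm_sq_eq]
    exact le_add_of_nonneg_right (Finset.sum_nonneg fun k _ => sq_nonneg _)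

end MultSpace

/-- The symbols of `D_x^{1/2}`, `√λ D_x^{-1/2} ∂_y` and `√μ ∂_x^{-1} ∂_y`. -/
def halfSymbol (lam mu : ℝ) : Fin 3 → Plane → ℂ :=
  ![fun p => ((|2 * Real.pi * p 0| ^ (1 / 2 : ℝ) : ℝ) : ℂ),
    fun p => (Real.sqrt lam : ℂ) * ((|2 * Real.pi * p 0| ^ (-(1 / 2) : ℝ) : ℝ) : ℂ) *
      (2 * Real.pi * I * (p 1 : ℂ)),
    fun p => (Real.sqrt mu : ℂ) * (2 * Real.pi * I * (p 0 : ℂ))⁻¹ * (2 * Real.pi * I * (p 1 : ℂ))]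

/-- The symbols of `∂_x`, `√λ ∂_x^{-1} ∂_y²` and `√μ ∂_x^{-2} ∂_y²`. -/
def zeroSymbol (lam mu : ℝ) : Fin 3 → Plane → ℂ :=
  ![fun p => 2 * Real.pi * I * (p 0 : ℂ),
    fun p => (Real.sqrt lam : ℂ) * (2 * Real.pi * I * (p 0 : ℂ))⁻¹ *
      (2 * Real.pi * I * (p 1 : ℂ)) ^ 2,
    fun p => (Real.sqrt mu : ℂ) * ((2 * Real.pi * I * (p 0 : ℂ)) ^ 2)⁻¹ *
      (2 * Real.pi * I * (p 1 : ℂ)) ^ 2]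

/-! ### Restriction spaces -/

/-- Restriction of functions from `ℝ²` to `Ω`. -/
def restrictL2 (Ω : Set Plane) : PlaneL2 →L[ℂ] RegionL2 Ω :=
  LpToLpRestrictCLM Plane ℂ ℂ volume 2 Ω

section RangeSpace

variable {X W : Type*} [NormedAddCommGroup X] [NormedSpace ℂ X]
  [NormedAddCommGroup W] [NormedSpace ℂ W]

/-- The range of `r : X → W`, to be normed by `‖f‖ = inf {‖g‖ : g ∈ X, r g = f}`. -/
def RangeSpace (r : X →L[ℂ] W) : Type _ := LinearMap.range (r : X →ₗ[ℂ] W)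

namespace RangeSpace

variable (r : X →L[ℂ] W)

instance : AddCommGroup (RangeSpace r) :=
  inferInstanceAs (AddCommGroup (LinearMap.range (r : X →ₗ[ℂ] W)))

instance : Module ℂ (RangeSpace r) :=
  inferInstanceAs (Module ℂ (LinearMap.range (r : X →ₗ[ℂ] W)))

/-- The underlying element of `W`. -/
def val : RangeSpace r →ₗ[ℂ] W := (LinearMap.range (r : X →ₗ[ℂ] W)).subtype

instance : Norm (RangeSpace r) := ⟨fun f => sInf {t | ∃ g : X, r g = val r f ∧ ‖g‖ = t}⟩

variable {r}

theorem exists_preimage (f : RangeSpace r) : ∃ g : X, r g = val r f := f.2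

theorem norm_nonneg' (f : RangeSpace r) : 0 ≤ ‖f‖ := by
  refine Real.sInf_nonneg ?_
  rintro t ⟨g, -, rfl⟩
  exact norm_nonneg g

theorem norm_le_of_eq {f : RangeSpace r} {g : X} (h : r g = val r f) : ‖f‖ ≤ ‖g‖ :=
  csInf_le ⟨0, by rintro t ⟨g, -, rfl⟩; exact norm_nonneg g⟩ ⟨g, h, rfl⟩

theorem exists_lt {f : RangeSpace r} {t : ℝ} (h : ‖f‖ < t) :
    ∃ g : X, r g = val r f ∧ ‖g‖ < t := by
  obtain ⟨g₀, hg₀⟩ := exists_preimage f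
  obtain ⟨_, ⟨g, hg, rfl⟩, hlt⟩ := exists_lt_of_csInf_lt
    (s := {t | ∃ g : X, r g = val r f ∧ ‖g‖ = t}) ⟨‖g₀‖, g₀, hg₀, rfl⟩ h
  exact ⟨g, hg, hlt⟩

theorem norm_val_le (f : RangeSpace r) : ‖val r f‖ ≤ ‖r‖ * ‖f‖ := by
  refine le_of_forall_pos_le_add fun ε hε => ?_
  have hr : 0 < ‖r‖ + 1 := by positivity
  obtain ⟨g, hg, hlt⟩ := exists_lt (lt_add_of_pos_right ‖f‖ (div_pos hε hr))
  rw [← hg]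
  calc ‖r g‖ ≤ ‖r‖ * ‖g‖ := r.le_opNorm g
    _ ≤ ‖r‖ * (‖f‖ + ε / (‖r‖ + 1)) := by gcongr
    _ = ‖r‖ * ‖f‖ + ‖r‖ / (‖r‖ + 1) * ε := by ring
    _ ≤ ‖r‖ * ‖f‖ + 1 * ε := by
        gcongr
        rw [div_le_one hr]
        linarith
    _ = ‖r‖ * ‖f‖ + ε := by ring

theorem norm_smul_le' (c : ℂ) (f : RangeSpace r) : ‖c • f‖ ≤ ‖c‖ * ‖f‖ := by
  refine le_of_forall_pos_le_add fun ε hε => ?_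
  have hc : 0 < ‖c‖ + 1 := by positivity
  obtain ⟨g, hg, hlt⟩ := exists_lt (lt_add_of_pos_right ‖f‖ (div_pos hε hc))
  have h : r (c • g) = val r (c • f) := by rw [map_smul, map_smul, hg]
  calc ‖c • f‖ ≤ ‖c • g‖ := norm_le_of_eq h
    _ = ‖c‖ * ‖g‖ := norm_smul c g
    _ ≤ ‖c‖ * (‖f‖ + ε / (‖c‖ + 1)) := by gcongr
    _ = ‖c‖ * ‖f‖ + ‖c‖ / (‖c‖ + 1) * ε := by ring
    _ ≤ ‖c‖ * ‖f‖ + 1 * ε := by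
        gcongr
        rw [div_le_one hc]
        linarith
    _ = ‖c‖ * ‖f‖ + ε := by ring

theorem core (r : X →L[ℂ] W) : NormedSpace.Core ℂ (RangeSpace r) where
  norm_nonneg := norm_nonneg'
  norm_smul c f := by
    refine le_antisymm (norm_smul_le' c f) ?_
    by_cases hc : c = 0
    · simpa [hc] using norm_nonneg' (r := r) (0 : RangeSpace r)
    · have h := norm_smul_le' c⁻¹ (c • f)
      rw [smul_smul, inv_mul_cancel₀ hc, one_smul, norm_inv] at h
      rwa [← le_inv_mul_iff₀ (norm_pos_iff.2 hc)]
  norm_triangle f g := by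
    refine le_of_forall_pos_le_add fun ε hε => ?_
    obtain ⟨u, hu, hul⟩ := exists_lt (lt_add_of_pos_right ‖f‖ (half_pos hε))
    obtain ⟨v, hv, hvl⟩ := exists_lt (lt_add_of_pos_right ‖g‖ (half_pos hε))
    have h : r (u + v) = val r (f + g) := by rw [map_add, map_add, hu, hv]
    linarith [norm_le_of_eq h, norm_add_le u v]
  norm_eq_zero_iff f := by
    constructor
    · intro h
      have h1 := norm_val_le f
      rw [h, mul_zero] at h1
      have h2 : val r f = 0 := norm_le_zero_iff.1 h1
      exact Subtype.ext h2
    · rintro rfl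
      refine le_antisymm ?_ (norm_nonneg' _)
      simpa using norm_le_of_eq (r := r) (f := 0) (g := 0) (by simp)

instance : NormedAddCommGroup (RangeSpace r) := NormedAddCommGroup.ofCore (core r)

instance : NormedSpace ℂ (RangeSpace r) := NormedSpace.ofCore (core r)

variable (r)

/-- The inclusion of the range space in `W`. -/
def incl : RangeSpace r →L[ℂ] W := (val r).mkContinuous ‖r‖ norm_val_le

end RangeSpace

end RangeSpace

/-- `X^{1/2}(Ω)`: the restrictions to `Ω` of the functions in `X^{1/2}(ℝ²)`, with the norm
`inf {‖g‖ : g ∈ X^{1/2}(ℝ²), g = f on Ω}`. -/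
abbrev XHalf (lam mu : ℝ) (Ω : Set Plane) : Type :=
  RangeSpace ((restrictL2 Ω).comp (MultSpace.incl (halfSymbol lam mu)))

/-- `X⁰(Ω)`: the restrictions to `Ω` of the functions in `X⁰(ℝ²)`, with the norm
`inf {‖g‖ : g ∈ X⁰(ℝ²), g = f on Ω}`. -/
abbrev XZero (lam mu : ℝ) (Ω : Set Plane) : Type :=
  RangeSpace ((restrictL2 Ω).comp (MultSpace.incl (zeroSymbol lam mu)))

/-- The inclusion `X^{1/2}(Ω) → L²(Ω)`. -/
def XHalf.incl (lam mu : ℝ) (Ω : Set Plane) : XHalf lam mu Ω →L[ℂ] RegionL2 Ω :=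
  RangeSpace.incl _

/-- The inclusion `X⁰(Ω) → L²(Ω)`. -/
def XZero.incl (lam mu : ℝ) (Ω : Set Plane) : XZero lam mu Ω →L[ℂ] RegionL2 Ω :=
  RangeSpace.incl _

/-- The open rectangle `(a, b) × (c, d)`. -/
def openRect (a b c d : ℝ) : Set Plane := {p | p 0 ∈ Set.Ioo a b ∧ p 1 ∈ Set.Ioo c d}

/-! ### Complex interpolation -/

section Interpolation

variable {A₀ A₁ V : Type*} [NormedAddCommGroup A₀] [NormedSpace ℂ A₀]
  [NormedAddCommGroup A₁] [NormedSpace ℂ A₁] [NormedAddCommGroup V] [NormedSpace ℂ V]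

/-- The sum `A₀ + A₁` of a couple embedded in `V` by `i₀` and `i₁`: the quotient of `A₀ × A₁` by
the pairs `(a₀, a₁)` with `i₀ a₀ + i₁ a₁ = 0`. Its quotient norm,
`inf {max ‖a₀‖ ‖a₁‖ : v = i₀ a₀ + i₁ a₁}`, is equivalent to the usual norm of the sum. -/
abbrev SumSpace (i₀ : A₀ →L[ℂ] V) (i₁ : A₁ →L[ℂ] V) : Type _ :=
  (A₀ × A₁) ⧸ LinearMap.ker (i₀.coprod i₁ : A₀ × A₁ →ₗ[ℂ] V)

/-- The injection of the sum `A₀ + A₁` in the ambient space. -/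
def SumSpace.toAmbient (i₀ : A₀ →L[ℂ] V) (i₁ : A₁ →L[ℂ] V) : SumSpace i₀ i₁ →ₗ[ℂ] V :=
  (LinearMap.ker (i₀.coprod i₁ : A₀ × A₁ →ₗ[ℂ] V)).liftQ
    (i₀.coprod i₁ : A₀ × A₁ →ₗ[ℂ] V) le_rfl

/-- The functions that enter in the complex method: bounded and continuous on the closed strip
`0 ≤ Re z ≤ 1` with values in `A₀ + A₁`, analytic in the open strip, with `t ↦ F (i t)` and
`t ↦ F (1 + i t)` continuous from `ℝ` to `A₀` and to `A₁` and vanishing at infinity there. -/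
structure InterpFun (i₀ : A₀ →L[ℂ] V) (i₁ : A₁ →L[ℂ] V) where
  toFun : ℂ → SumSpace i₀ i₁
  bounded : ∃ M : ℝ, ∀ z : ℂ, z.re ∈ Set.Icc (0 : ℝ) 1 → ‖toFun z‖ ≤ M
  continuousOn : ContinuousOn toFun {z : ℂ | z.re ∈ Set.Icc (0 : ℝ) 1}
  analytic : DifferentiableOn ℂ toFun {z : ℂ | z.re ∈ Set.Ioo (0 : ℝ) 1}
  left : C₀(ℝ, A₀)
  right : C₀(ℝ, A₁)
  left_eq : ∀ t : ℝ, toFun (t * I) = Submodule.Quotient.mk (left t, 0)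
  right_eq : ∀ t : ℝ, toFun (1 + t * I) = Submodule.Quotient.mk (0, right t)

/-- `max (sup_t ‖F (i t)‖_{A₀}) (sup_t ‖F (1 + i t)‖_{A₁})`. -/
def InterpFun.size {i₀ : A₀ →L[ℂ] V} {i₁ : A₁ →L[ℂ] V} (F : InterpFun i₀ i₁) : ℝ :=
  max ‖F.left‖ ‖F.right‖

/-- The complex interpolation space `[A₀, A₁]_{[θ]}`, as a subset of the ambient space. -/
def interpSpace (i₀ : A₀ →L[ℂ] V) (i₁ : A₁ →L[ℂ] V) (θ : ℝ) : Set V :=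
  {v | ∃ F : InterpFun i₀ i₁, SumSpace.toAmbient i₀ i₁ (F.toFun θ) = v}

/-- The norm of `[A₀, A₁]_{[θ]}`. -/
def interpNorm (i₀ : A₀ →L[ℂ] V) (i₁ : A₁ →L[ℂ] V) (θ : ℝ) (v : V) : ℝ :=
  sInf {t | ∃ F : InterpFun i₀ i₁, SumSpace.toAmbient i₀ i₁ (F.toFun θ) = v ∧ F.size = t}

end Interpolation

end

/-!
On the Fourier side, `X⁰(ℝ²)` is the `L²` space with weight `W = 1 + ∑ |m k|²`, where the `m k`
are the symbols of `X⁰`. In modulus, the symbols of `X^{1/2}` are, up to constant factors, square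
roots of the `m k`, so that `X^{1/2}(ℝ²)` is the `L²` space with the weight `W^{1/2}`, up to equivalence of
norms (`exists_symbolWeight_half_equiv`). For the whole plane the theorem is thus the
interpolation of weighted `L²` spaces by the three lines theorem, with `W = exp (2 growth)`.

For the rectangle `Ω`, one inclusion needs nothing more: given `g ∈ X^{1/2}(ℝ²)`, the family
`exp ((z - 1/2)²) 𝓕⁻¹ (exp ((1/2 - z) growth) 𝓕 g)` is restricted to `Ω` (`exists_interpFun`). For
the other one, `F z` has to be extended from `Ω` to the plane before the three lines theorem can be
applied (`exists_xHalf_eq_interpFun`). This takes one linear extension operator that is bounded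
both on `L²` and on `X⁰` (`exists_extension`), and here the negative powers of `∂_x` are the
difficulty.

The operator is defined first for `f = ∂_x² u` with `u` a Schwartz function. Then the four terms
of the norm of `f` in `X⁰` are those of `∂_x² u`, `∂_x³ u`, `∂_x ∂_y² u` and `∂_y² u`
(`fourierEnergy_zeroSymbol_eq`), and only local operators are left. From `u(·, y)` its affine part
on `(a, b)` is removed, which does not change `∂_x² u` in `Ω`. By Poincaré's inequality the
remainder is controlled in `L²` by each one of `u`, `∂_x u` and `∂_x² u`, and its first derivative
by each one of `∂_x u` and `∂_x² u` (`exists_sqInt_remJet_le`); this supplies the lower order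
terms that the norm of `f` lacks. The coefficients of the affine part are integrals in `x`, so
that its removal commutes with `∂_y`. The remainder is then extended by higher order reflections
and a cutoff in each variable (`rectExt`), with the bounds of `exists_sqInt₂_rectExt_le`. Finally,
the `∂_x² u` are dense in `L²` and in `X⁰` (`exists_schwartz_fourierEnergy_sub_le`), because
multiplication by the symbol of `∂_x⁴` turns the weight `W` into a continuous function, and the
norm of `X⁰` is lower semicontinuous for convergence in `L²`.
-/

open scoped SchwartzMap LineDeriv NNReal Topology

/-! ### The Fourier transform of classical derivatives -/

/-- The unit vector of the `i`-th coordinate axis. -/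
noncomputable abbrev Plane.axis (i : Fin 2) : Plane := EuclideanSpace.single i (1 : ℝ)

/-- The Fourier transform is symmetric for the bilinear pairing of `L²` with Schwartz functions. -/
theorem integral_fourier_smul_eq (F : PlaneL2) (g : 𝓢(Plane, ℂ)) :
    ∫ p, g p • (𝓕 F : PlaneL2) p = ∫ p, (𝓕 g : 𝓢(Plane, ℂ)) p • F p := by
  have h := congrArg (fun T => T g) (Lp.fourier_toTemperedDistribution_eq F)
  simp only [TemperedDistribution.fourier_apply, Lp.toTemperedDistribution_apply] at h
  exact h.symm

theorem integral_fourier_toLp_mul_eq {f : Plane → ℂ} (hf : MemLp f 2 volume)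
    (g : 𝓢(Plane, ℂ)) :
    ∫ p, g p * (𝓕 hf.toLp : PlaneL2) p = ∫ p, f p * (𝓕 g : 𝓢(Plane, ℂ)) p := by
  have h := integral_fourier_smul_eq hf.toLp g
  simp only [smul_eq_mul] at h
  rw [h]
  refine integral_congr_ae ?_
  filter_upwards [hf.coeFn_toLp] with p hp
  rw [hp, mul_comm]

/-- Integration by parts; square integrability of `f` and `f'` makes all the products integrable. -/
theorem integral_mul_lineDerivOp_eq {f f' : Plane → ℂ} (hf : MemLp f 2 volume)
    (hf' : MemLp f' 2 volume) (i : Fin 2)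
    (h : ∀ p, HasLineDerivAt ℝ f (f' p) p (Plane.axis i)) (G : 𝓢(Plane, ℂ)) :
    ∫ p, f p * (∂_{Plane.axis i} G : 𝓢(Plane, ℂ)) p = - ∫ p, f' p * G p := by
  refine integral_bilinear_hasLineDerivAt_right_eq_neg_left_of_integrable
    (B := ContinuousLinearMap.mul ℝ ℂ) (v := Plane.axis i) ?_ ?_ ?_ (fun p _ => h p) ?_
  · exact hf'.integrable_mul (G.memLp 2 volume)
  · exact hf.integrable_mul ((∂_{Plane.axis i} G : 𝓢(Plane, ℂ)).memLp 2 volume)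
  · exact hf.integrable_mul (G.memLp 2 volume)
  · intro p _
    rw [SchwartzMap.lineDerivOp_apply]
    exact (G.differentiableAt.lineDifferentiableAt).hasLineDerivAt

/-- Multiplication by `2πi p_i` is, on the Schwartz space, minus the derivative of the transform. -/
theorem exists_schwartz_mul_coord (i : Fin 2) (G : 𝓢(Plane, ℂ)) :
    ∃ H : 𝓢(Plane, ℂ), (∀ p, H p = 2 * Real.pi * I * (p i : ℂ) * G p) ∧
      ∂_{Plane.axis i} (𝓕 G) = - 𝓕 H := by
  have htemp : Function.HasTemperateGrowth (fun x : Plane => inner ℝ x (Plane.axis i)) := by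
    fun_prop
  refine ⟨(2 * Real.pi * I : ℂ) • SchwartzMap.smulLeftCLM ℂ
    (fun x : Plane => inner ℝ x (Plane.axis i)) G, fun p => ?_, ?_⟩
  · rw [smul_apply, SchwartzMap.smulLeftCLM_apply_apply htemp,
      EuclideanSpace.inner_single_right, smul_eq_mul, real_smul]
    simp
    ring
  · rw [SchwartzMap.lineDerivOp_fourier_eq, neg_smul]
    exact FourierTransform.fourier_neg _

/-- The Fourier transform turns a derivative along a coordinate axis into multiplication by
`2πi p_i`, as soon as the function and its pointwise derivative are square integrable. -/
theorem fourier_toLp_of_hasLineDerivAt {f f' : Plane → ℂ} (hf : MemLp f 2 volume)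
    (hf' : MemLp f' 2 volume) (i : Fin 2)
    (h : ∀ p, HasLineDerivAt ℝ f (f' p) p (Plane.axis i)) :
    (𝓕 hf'.toLp : PlaneL2) =ᵐ[volume]
      fun p => 2 * Real.pi * I * (p i : ℂ) * (𝓕 hf.toLp : PlaneL2) p := by
  have hcont : Continuous fun p : Plane => (2 * Real.pi * I * (p i : ℂ) : ℂ) := by fun_prop
  have hloc (F : PlaneL2) : LocallyIntegrable F volume :=
    (Lp.memLp F).locallyIntegrable (by norm_num)
  refine ae_eq_of_integral_contDiff_smul_eq (hloc _) ?_ ?_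
  · have := (hloc (𝓕 hf.toLp)).continuous_smul hcont
    exact this
  intro g hg hgc
  have hgc' : HasCompactSupport fun p => (g p : ℂ) :=
    hgc.comp_left (g := ((↑) : ℝ → ℂ)) ofReal_zero
  obtain ⟨G, hG⟩ : ∃ G : 𝓢(Plane, ℂ), ∀ p, G p = g p :=
    ⟨hgc'.toSchwartzMap (Complex.ofRealCLM.contDiff.comp hg), fun p => rfl⟩
  obtain ⟨H, hH, hder⟩ := exists_schwartz_mul_coord i G
  calc ∫ p, g p • (𝓕 hf'.toLp : PlaneL2) p
      = ∫ p, G p * (𝓕 hf'.toLp : PlaneL2) p := by simp only [hG, real_smul]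
    _ = - ∫ p, f p * (∂_{Plane.axis i} (𝓕 G) : 𝓢(Plane, ℂ)) p := by
        rw [integral_fourier_toLp_mul_eq, integral_mul_lineDerivOp_eq hf hf' i h, neg_neg]
    _ = ∫ p, f p * (𝓕 H : 𝓢(Plane, ℂ)) p := by
        rw [hder, ← integral_neg]
        refine integral_congr_ae (.of_forall fun p => ?_)
        simp
    _ = ∫ p, H p * (𝓕 hf.toLp : PlaneL2) p := (integral_fourier_toLp_mul_eq hf H).symm
    _ = _ := by
        refine integral_congr_ae (.of_forall fun p => ?_)
        simp only [hH, hG, real_smul]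
        ring

/-! ### Higher order reflections on the line -/

/-- The dilation factors of the reflections across an end point of an interval. -/
noncomputable def reflNode : Fin 4 → ℝ := ![-1, -1 / 2, -1 / 3, -1 / 4]

/-- The weights of the reflections, the solution of `∑ j, reflCoeff j * reflNode j ^ k = 1` for
`k ≤ 3`: reflected functions match in value and in the derivatives up to order three. -/
noncomputable def reflCoeff : Fin 4 → ℝ := ![-10, 160, -405, 256]

theorem sum_reflCoeff_mul_pow {k : ℕ} (hk : k ≤ 3) :
    ∑ j, reflCoeff j * reflNode j ^ k = 1 := by
  interval_cases k <;> simp [Fin.sum_univ_four, reflCoeff, reflNode] <;> norm_num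

theorem reflNode_mem (j : Fin 4) : reflNode j ∈ Set.Ico (-1 : ℝ) 0 := by
  fin_cases j <;> simp [reflNode] <;> norm_num

/-- The weighted sum of reflections of `w` across `e`, with weights `reflCoeff j * reflNode j ^ k`;
for `k = n` it is the `n`-th derivative of the sum with `k = 0`, when `w` is an `n`-th derivative.
-/
noncomputable def reflSum (k : ℕ) (e : ℝ) (w : ℝ → ℂ) (x : ℝ) : ℂ :=
  ∑ j, ((reflCoeff j * reflNode j ^ k : ℝ) : ℂ) * w (e + reflNode j * (x - e))

theorem reflSum_self {k : ℕ} (hk : k ≤ 3) (e : ℝ) (w : ℝ → ℂ) : reflSum k e w e = w e := by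
  simp only [reflSum, sub_self, mul_zero, add_zero, ← Finset.sum_mul]
  rw [← ofReal_sum, sum_reflCoeff_mul_pow hk, ofReal_one, one_mul]

theorem hasDerivAt_reflSum (k : ℕ) (e : ℝ) {w w' : ℝ → ℂ} (h : ∀ x, HasDerivAt w (w' x) x)
    (x : ℝ) : HasDerivAt (reflSum k e w) (reflSum (k + 1) e w' x) x := by
  unfold reflSum
  refine HasDerivAt.fun_sum fun j _ => ?_
  have h1 : HasDerivAt (fun x : ℝ => e + reflNode j * (x - e)) (reflNode j) x := by
    simpa using (((hasDerivAt_id x).sub_const e).const_mul (reflNode j)).const_add e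
  have h2 := ((h (e + reflNode j * (x - e))).scomp x h1).const_mul
    ((reflCoeff j * reflNode j ^ k : ℝ) : ℂ)
  refine h2.congr_deriv ?_
  simp only [real_smul, pow_succ, ofReal_mul, ofReal_pow]
  ring

/-- Two functions that match in value and derivative at `e` can be glued there. -/
theorem hasDerivAt_ite_lt {E : Type*} [NormedAddCommGroup E] [NormedSpace ℝ E] {e : ℝ}
    {f g f' g' : ℝ → E} (hf : ∀ x ≤ e, HasDerivAt f (f' x) x)
    (hg : ∀ x, e ≤ x → HasDerivAt g (g' x) x) (h0 : f e = g e) (h1 : f' e = g' e) (x : ℝ) :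
    HasDerivAt (fun x => if x < e then f x else g x) (if x < e then f' x else g' x) x := by
  rcases lt_trichotomy x e with hx | rfl | hx
  · rw [if_pos hx]
    refine (hf x hx.le).congr_of_eventuallyEq ?_
    filter_upwards [Iio_mem_nhds hx] with y hy
    exact if_pos hy
  · rw [if_neg (lt_irrefl x)]
    have hl : HasDerivWithinAt (fun y => if y < x then f y else g y) (g' x) (Set.Iic x) x := by
      rw [← h1]
      refine (hf x le_rfl).hasDerivWithinAt.congr (fun y hy => ?_) ?_
      · rcases (show y ≤ x from hy).lt_or_eq with h | rfl
        · exact if_pos h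
        · rw [if_neg (lt_irrefl _), h0]
      · rw [if_neg (lt_irrefl _), h0]
    have hr : HasDerivWithinAt (fun y => if y < x then f y else g y) (g' x) (Set.Ici x) x := by
      refine (hg x le_rfl).hasDerivWithinAt.congr (fun y hy => ?_) ?_
      · exact if_neg (not_lt.2 hy)
      · exact if_neg (lt_irrefl _)
    have := hl.union hr
    rwa [Set.Iic_union_Ici, hasDerivWithinAt_univ] at this
  · rw [if_neg hx.not_gt]
    refine (hg x hx.le).congr_of_eventuallyEq ?_
    filter_upwards [Ioi_mem_nhds hx] with y hy
    exact if_neg (not_lt.2 (le_of_lt hy))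

/-- `w` on `(a, b)`, continued by its reflections across `a` and `b`. -/
noncomputable def reflExt (a b : ℝ) (k : ℕ) (w : ℝ → ℂ) (x : ℝ) : ℂ :=
  if x < a then reflSum k a w x else if x < b then w x else reflSum k b w x

theorem hasDerivAt_reflExt {a b : ℝ} (hab : a < b) {k : ℕ} (hk : k + 1 ≤ 3) {w w' : ℝ → ℂ}
    (h : ∀ x, HasDerivAt w (w' x) x) (x : ℝ) :
    HasDerivAt (reflExt a b k w) (reflExt a b (k + 1) w' x) x := by
  have hin (x : ℝ) : HasDerivAt (fun x => if x < b then w x else reflSum k b w x)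
      (if x < b then w' x else reflSum (k + 1) b w' x) x :=
    hasDerivAt_ite_lt (fun x _ => h x) (fun x _ => hasDerivAt_reflSum k b h x)
      (reflSum_self (by omega) _ _).symm (reflSum_self hk _ _).symm x
  have hout := hasDerivAt_ite_lt (e := a) (fun x _ => hasDerivAt_reflSum k a h x)
    (g' := fun x => if x < b then w' x else reflSum (k + 1) b w' x) (fun x _ => hin x) ?_ ?_ x
  · exact hout
  · simp only [if_pos hab, reflSum_self (show k ≤ 3 by omega)]
  · simp only [if_pos hab, reflSum_self hk]

/-- The `n`-th derivative of `χ * reflExt a b 0 w`, as an expression in the derivatives `χ s` of the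
cutoff function `χ 0` and the derivatives `w l` of `w 0`; the indices `s` and `k` are the orders
that the recursion starts from. -/
noncomputable def extJet (a b : ℝ) (χ : ℕ → ℝ → ℂ) :
    ℕ → ℕ → ℕ → (ℕ → ℝ → ℂ) → ℝ → ℂ
  | 0, s, k, w => fun x => χ s x * reflExt a b k (w 0) x
  | n + 1, s, k, w => fun x =>
      extJet a b χ n (s + 1) k w x + extJet a b χ n s (k + 1) (fun l => w (l + 1)) x

theorem hasDerivAt_extJet {a b : ℝ} (hab : a < b) {χ : ℕ → ℝ → ℂ}
    (hχ : ∀ s x, HasDerivAt (χ s) (χ (s + 1) x) x) (n s k : ℕ) (hk : n + k + 1 ≤ 3)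
    {w : ℕ → ℝ → ℂ} (h : ∀ l x, HasDerivAt (w l) (w (l + 1) x) x) (x : ℝ) :
    HasDerivAt (extJet a b χ n s k w) (extJet a b χ (n + 1) s k w x) x := by
  induction n generalizing s k w with
  | zero => exact (hχ s x).mul (hasDerivAt_reflExt hab (by omega) (h 0) x)
  | succ n ih =>
    exact (ih (s + 1) k (by omega) h).add (ih s (k + 1) (by omega) fun l => h (l + 1))

/-- The extension is linear in the jet, so that it commutes with derivatives in a parameter. -/
theorem hasDerivAt_extJet_param (a b : ℝ) (χ : ℕ → ℝ → ℂ) (n s k : ℕ)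
    {w w' : ℕ → ℝ → ℝ → ℂ} {t : ℝ}
    (h : ∀ l x, HasDerivAt (fun t => w l t x) (w' l t x) t) (x : ℝ) :
    HasDerivAt (fun t => extJet a b χ n s k (fun l => w l t) x)
      (extJet a b χ n s k (fun l => w' l t) x) t := by
  induction n generalizing s k w w' with
  | zero =>
    refine HasDerivAt.const_mul (χ s x) ?_
    have hs (e : ℝ) : HasDerivAt (fun t => reflSum k e (w 0 t) x) (reflSum k e (w' 0 t) x) t :=
      HasDerivAt.fun_sum fun j _ => (h 0 _).const_mul _
    unfold reflExt
    split_ifs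
    · exact hs a
    · exact h 0 x
    · exact hs b
  | succ n ih => exact (ih (s + 1) k h).add (ih s (k + 1) fun l => h (l + 1))

theorem extJet_add (a b : ℝ) (χ : ℕ → ℝ → ℂ) (n s k : ℕ) (w w' : ℕ → ℝ → ℂ) :
    extJet a b χ n s k (w + w') = extJet a b χ n s k w + extJet a b χ n s k w' := by
  induction n generalizing s k w w' with
  | zero =>
    funext x
    simp only [extJet, reflExt, reflSum, Pi.add_apply]
    split_ifs <;> simp only [mul_add, Finset.sum_add_distrib]
  | succ n ih =>
    funext x
    have h := ih s (k + 1) (fun l => w (l + 1)) (fun l => w' (l + 1))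
    simp only [extJet, Pi.add_apply]
    rw [ih (s + 1) k w w', show (fun l => w (l + 1) + w' (l + 1)) =
      (fun l => w (l + 1)) + fun l => w' (l + 1) from rfl, h]
    simp only [Pi.add_apply]
    ring

theorem extJet_smul (a b : ℝ) (χ : ℕ → ℝ → ℂ) (n s k : ℕ) (c : ℂ) (w : ℕ → ℝ → ℂ) :
    extJet a b χ n s k (c • w) = c • extJet a b χ n s k w := by
  induction n generalizing s k w with
  | zero =>
    funext x
    simp only [extJet, reflExt, reflSum, Pi.smul_apply, smul_eq_mul]
    split_ifs <;> simp only [Finset.mul_sum, mul_left_comm _ c]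
  | succ n ih =>
    funext x
    have h := ih s (k + 1) (fun l => w (l + 1))
    simp only [extJet, Pi.smul_apply, smul_add]
    rw [ih (s + 1) k w, show (fun l => c • w (l + 1)) = c • (fun l => w (l + 1)) from rfl, h]
    rfl

/-- On `(a, b)`, where the cutoff is one, the extension has the derivatives of the given function.
-/
theorem extJet_eq_of_mem {a b : ℝ} {χ : ℕ → ℝ → ℂ} {x : ℝ} (hx : x ∈ Set.Ioo a b)
    (h0 : χ 0 x = 1) (h1 : ∀ s, χ (s + 1) x = 0) (n k : ℕ) (w : ℕ → ℝ → ℂ) :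
    extJet a b χ n 0 k w x = w n x := by
  have h2 (n s k : ℕ) (w : ℕ → ℝ → ℂ) : extJet a b χ n (s + 1) k w x = 0 := by
    induction n generalizing s k w with
    | zero => simp [extJet, h1]
    | succ n ih => simp [extJet, ih]
  induction n generalizing k w with
  | zero => simp [extJet, h0, reflExt, hx.1.not_gt, hx.2]
  | succ n ih => simp [extJet, h2, ih]

theorem measurable_extJet {α : Type*} [MeasurableSpace α] (a b : ℝ) {χ : ℕ → ℝ → ℂ}
    (hχ : ∀ s, Measurable (χ s)) (n s k : ℕ) {w : ℕ → α → ℝ → ℂ}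
    (h : ∀ l, Measurable fun q : α × ℝ => w l q.1 q.2) :
    Measurable fun q : α × ℝ => extJet a b χ n s k (fun l => w l q.1) q.2 := by
  induction n generalizing s k w with
  | zero =>
    have hs (e : ℝ) : Measurable fun q : α × ℝ => reflSum k e (w 0 q.1) q.2 := by
      refine Finset.measurable_fun_sum _ fun j _ => Measurable.const_mul ?_ _
      have hm : Measurable fun q : α × ℝ => e + reflNode j * (q.2 - e) := by fun_prop
      exact (h 0).comp (measurable_fst.prodMk hm)
    refine ((hχ s).comp measurable_snd).mul ?_
    exact Measurable.ite (measurableSet_lt measurable_snd measurable_const) (hs a)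
      (Measurable.ite (measurableSet_lt measurable_snd measurable_const) (h 0) (hs b))
  | succ n ih => exact (ih (s + 1) k h).add (ih s (k + 1) fun l => h (l + 1))

/-! ### Square integral estimates on the line -/

/-- The square integral of `f` over `A`. -/
noncomputable def sqInt (A : Set ℝ) (f : ℝ → ℂ) : ℝ≥0∞ := ∫⁻ x in A, ‖f x‖ₑ ^ 2

theorem ENNReal.add_sq_le_two_mul (a b : ℝ≥0∞) : (a + b) ^ 2 ≤ 2 * (a ^ 2 + b ^ 2) := by
  rcases eq_or_ne a ∞ with rfl | ha
  · simp
  rcases eq_or_ne b ∞ with rfl | hb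
  · simp
  lift a to ℝ≥0 using ha
  lift b to ℝ≥0 using hb
  have h : (a + b) ^ 2 ≤ 2 * (a ^ 2 + b ^ 2) := add_sq_le
  exact_mod_cast h

theorem sqInt_add_le (A : Set ℝ) {f g : ℝ → ℂ} (hf : Measurable f) :
    sqInt A (fun x => f x + g x) ≤ 2 * (sqInt A f + sqInt A g) := by
  unfold sqInt
  rw [← lintegral_add_left (by fun_prop), ← lintegral_const_mul' _ _ (by norm_num)]
  refine lintegral_mono fun x => ?_
  refine le_trans ?_ (ENNReal.add_sq_le_two_mul _ _)
  gcongr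
  exact enorm_add_le _ _

theorem lintegral_comp_reflection {F : ℝ → ℝ≥0∞} (hF : Measurable F) {t : ℝ} (ht : t ≠ 0)
    (e : ℝ) : ∫⁻ x, F (e + t * (x - e)) = ENNReal.ofReal |t⁻¹| * ∫⁻ x, F x := by
  have h1 : ∫⁻ x, F (e + t * (x - e)) = ∫⁻ x, F (e + t * x) :=
    lintegral_sub_right_eq_self (fun x => F (e + t * x)) e
  have h2 : ∫⁻ x, F (e + t * x) = ∫⁻ y, F (e + y) ∂(Measure.map (t * ·) volume) :=
    (lintegral_map (f := fun y => F (e + y)) (by fun_prop) (by fun_prop)).symm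
  rw [h1, h2, Real.map_volume_mul_left ht, lintegral_smul_measure, smul_eq_mul,
    lintegral_add_left_eq_self]

theorem enorm_reflSum_sq_le {k : ℕ} (e : ℝ) (w : ℝ → ℂ) (x : ℝ) :
    ‖reflSum k e w x‖ₑ ^ 2 ≤ 4 * 405 ^ 2 * ∑ j, ‖w (e + reflNode j * (x - e))‖ₑ ^ 2 := by
  have h1 : ‖reflSum k e w x‖ₑ ≤ ∑ j, 405 * ‖w (e + reflNode j * (x - e))‖ₑ := by
    refine (enorm_sum_le _ _).trans (Finset.sum_le_sum fun j _ => ?_)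
    rw [enorm_mul]
    gcongr
    have h2 : ‖((reflCoeff j * reflNode j ^ k : ℝ) : ℂ)‖ ≤ 405 := by
      rw [norm_real, norm_mul, norm_pow, Real.norm_eq_abs, Real.norm_eq_abs]
      have h3 : |reflNode j| ^ k ≤ 1 := by
        refine pow_le_one₀ (abs_nonneg _) ?_
        have := reflNode_mem j
        rw [abs_le]
        exact ⟨this.1, by linarith [this.2]⟩
      have h4 : |reflCoeff j| ≤ 405 := by
        fin_cases j <;> simp [reflCoeff] <;> norm_num [abs_le]
      calc _ ≤ 405 * (1 : ℝ) := by gcongr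
        _ = 405 := mul_one _
    rw [← ofReal_norm]
    refine (ENNReal.ofReal_le_ofReal h2).trans_eq ?_
    norm_num
  calc _ ≤ (∑ j, 405 * ‖w (e + reflNode j * (x - e))‖ₑ) ^ 2 := by gcongr
    _ ≤ _ := by
      rw [← Finset.mul_sum, mul_pow, mul_comm (4 : ℝ≥0∞), mul_assoc]
      gcongr
      simp only [Fin.sum_univ_four]
      generalize ‖w (e + reflNode 0 * (x - e))‖ₑ = A
      generalize ‖w (e + reflNode 1 * (x - e))‖ₑ = B
      generalize ‖w (e + reflNode 2 * (x - e))‖ₑ = C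
      generalize ‖w (e + reflNode 3 * (x - e))‖ₑ = D
      calc (A + B + C + D) ^ 2 = ((A + B) + (C + D)) ^ 2 := by ring
        _ ≤ 2 * ((A + B) ^ 2 + (C + D) ^ 2) := ENNReal.add_sq_le_two_mul _ _
        _ ≤ 2 * (2 * (A ^ 2 + B ^ 2) + 2 * (C ^ 2 + D ^ 2)) := by
          gcongr <;> exact ENNReal.add_sq_le_two_mul _ _
        _ = _ := by ring

/-- The reflections are bounded in `L²` on the interval that they fill from values in `(a, b)`: the
dilation factors have modulus at most one, so that within distance `b - a` of an end point all
reflected arguments lie in `(a, b)`. -/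
theorem exists_sqInt_reflExt_le (a b : ℝ) :
    ∃ C : ℝ≥0, ∀ (k : ℕ) (w : ℝ → ℂ), Measurable w →
      sqInt (Set.Ioo (a - (b - a)) (b + (b - a))) (reflExt a b k w) ≤
        C * sqInt (Set.Ioo a b) w := by
  refine ⟨1 + 4 * 405 ^ 2 * ∑ _j : Fin 4, (4 + 4), fun k w hw => ?_⟩
  set F : ℝ → ℝ≥0∞ := (Set.Ioo a b).indicator fun x => ‖w x‖ₑ ^ 2 with hFdef
  have hF : Measurable F := (by fun_prop : Measurable fun x => ‖w x‖ₑ ^ 2).indicator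
    measurableSet_Ioo
  have hmem {x : ℝ} (hx : x ∈ Set.Ioo a b) : ‖w x‖ₑ ^ 2 = F x := by
    rw [hFdef, Set.indicator_of_mem hx]
  have hpt : ∀ x ∈ Set.Ioo (a - (b - a)) (b + (b - a)), x ≠ a → x ≠ b →
      ‖reflExt a b k w x‖ₑ ^ 2 ≤ F x + 4 * 405 ^ 2 *
        ∑ j, (F (a + reflNode j * (x - a)) + F (b + reflNode j * (x - b))) := by
    intro x hx hxa hxb
    unfold reflExt
    split_ifs with h1 h2
    · refine (enorm_reflSum_sq_le a w x).trans (le_add_left ?_)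
      gcongr with j
      rw [hmem]
      · exact le_self_add
      · have := reflNode_mem j
        constructor
        · nlinarith [this.2]
        · nlinarith [this.1, hx.1]
    · rw [hmem ⟨lt_of_le_of_ne (not_lt.1 h1) hxa.symm, h2⟩]
      exact le_self_add
    · refine (enorm_reflSum_sq_le b w x).trans (le_add_left ?_)
      have h3 : b < x := lt_of_le_of_ne (not_lt.1 h2) hxb.symm
      gcongr with j
      rw [hmem]
      · exact le_add_self
      · have := reflNode_mem j
        constructor
        · nlinarith [this.1, hx.2]
        · nlinarith [this.2]
  have hcomp (j : Fin 4) (e : ℝ) : ∫⁻ x, F (e + reflNode j * (x - e)) ≤ 4 * ∫⁻ x, F x := by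
    rw [lintegral_comp_reflection hF (reflNode_mem j).2.ne]
    gcongr
    refine (ENNReal.ofReal_le_ofReal (q := 4) ?_).trans_eq (by norm_num)
    fin_cases j <;> simp [reflNode] <;> norm_num
  have hFint : ∫⁻ x, F x = sqInt (Set.Ioo a b) w := lintegral_indicator measurableSet_Ioo _
  calc sqInt (Set.Ioo (a - (b - a)) (b + (b - a))) (reflExt a b k w)
      ≤ ∫⁻ x in Set.Ioo (a - (b - a)) (b + (b - a)), (F x + 4 * 405 ^ 2 *
        ∑ j, (F (a + reflNode j * (x - a)) + F (b + reflNode j * (x - b)))) := by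
        refine lintegral_mono_ae ?_
        have hne (e : ℝ) : ∀ᵐ x ∂(volume.restrict (Set.Ioo (a - (b - a)) (b + (b - a)))),
            x ≠ e := ae_restrict_of_ae (by simp [ae_iff, measure_singleton])
        filter_upwards [hne a, hne b, ae_restrict_mem measurableSet_Ioo] with x h1 h2 h3
        exact hpt x h3 h1 h2
    _ ≤ ∫⁻ x, (F x + 4 * 405 ^ 2 *
        ∑ j, (F (a + reflNode j * (x - a)) + F (b + reflNode j * (x - b)))) :=
        setLIntegral_le_lintegral _ _
    _ = (∫⁻ x, F x) + 4 * 405 ^ 2 * ∑ j, ((∫⁻ x, F (a + reflNode j * (x - a))) +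
          ∫⁻ x, F (b + reflNode j * (x - b))) := by
        rw [lintegral_add_left hF, lintegral_const_mul' _ _ (by norm_num),
          lintegral_finsetSum _ (by fun_prop)]
        congr 2
        refine Finset.sum_congr rfl fun j _ => ?_
        rw [lintegral_add_left (by fun_prop)]
    _ ≤ (∫⁻ x, F x) + 4 * 405 ^ 2 * ∑ _j : Fin 4, (4 * (∫⁻ x, F x) + 4 * ∫⁻ x, F x) := by
        gcongr <;> exact hcomp _ _
    _ = _ := by
        rw [hFint]
        simp only [Fin.sum_univ_four]
        push_cast
        ring

/-- A family of cutoff functions adapted to `(a, b)`, listed with all derivatives: `χ 0` is one on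
`(a, b)`, and it vanishes outside the interval that the reflections of `(a, b)` reach. -/
structure IsCutoff (a b : ℝ) (χ : ℕ → ℝ → ℂ) : Prop where
  deriv : ∀ s x, HasDerivAt (χ s) (χ (s + 1) x) x
  one : ∀ x ∈ Set.Ioo a b, χ 0 x = 1
  zero : ∀ s, ∀ x ∈ Set.Ioo a b, χ (s + 1) x = 0
  vanish : ∀ s, ∀ x ∉ Set.Ioo (a - (b - a)) (b + (b - a)), χ s x = 0
  bounded : ∀ s, ∃ B : ℝ≥0, ∀ x, ‖χ s x‖ₑ ≤ B

theorem IsCutoff.continuous {a b : ℝ} {χ : ℕ → ℝ → ℂ} (hχ : IsCutoff a b χ) (s : ℕ) :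
    Continuous (χ s) := continuous_iff_continuousAt.2 fun x => (hχ.deriv s x).continuousAt

theorem tsupport_iteratedDeriv_subset (f : ℝ → ℂ) (n : ℕ) :
    tsupport (iteratedDeriv n f) ⊆ tsupport f := by
  induction n with
  | zero => simp
  | succ n ih =>
    rw [iteratedDeriv_succ]
    exact (closure_minimal support_deriv_subset (isClosed_tsupport _)).trans ih

theorem exists_isCutoff {a b : ℝ} (hab : a < b) : ∃ χ, IsCutoff a b χ := by
  let f : ContDiffBump ((a + b) / 2) :=
    ⟨(b - a) / 2, b - a, by linarith, by linarith⟩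
  have hf : ContDiff ℝ (⊤ : ℕ∞) fun x => (f x : ℂ) := Complex.ofRealCLM.contDiff.comp f.contDiff
  have hsupp : tsupport (fun x => (f x : ℂ)) ⊆ Metric.closedBall ((a + b) / 2) (b - a) := by
    rw [← f.tsupport_eq]
    exact closure_mono fun x hx h => hx (by simp [h])
  have hcomp : HasCompactSupport fun x => (f x : ℂ) :=
    (isCompact_closedBall _ _).of_isClosed_subset (isClosed_tsupport _) hsupp
  have hone : ∀ x ∈ Set.Ioo a b, (fun x => (f x : ℂ)) =ᶠ[𝓝 x] fun _ => 1 := by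
    intro x hx
    filter_upwards [isOpen_Ioo.mem_nhds hx] with y hy
    rw [f.one_of_mem_closedBall, ofReal_one]
    rw [Metric.mem_closedBall, Real.dist_eq, abs_le]
    constructor <;> simp only [f] <;> linarith [hy.1, hy.2]
  refine ⟨fun s => iteratedDeriv s fun x => (f x : ℂ), ⟨fun s x => ?_, fun x hx => ?_,
    fun s x hx => ?_, fun s x hx => ?_, fun s => ?_⟩⟩
  · rw [iteratedDeriv_succ]
    exact ((hf.differentiable_iteratedDeriv s (mod_cast ENat.natCast_lt_top s)) x).hasDerivAt
  · simpa using (hone x hx).eq_of_nhds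
  · simp only [(hone x hx).iteratedDeriv_eq]
    simp [iteratedDeriv_const]
  · refine image_eq_zero_of_notMem_tsupport fun h => hx ?_
    have h1 := hsupp (tsupport_iteratedDeriv_subset _ s h)
    rw [Metric.mem_closedBall, Real.dist_eq, abs_le] at h1
    constructor <;> linarith [h1.1, h1.2]
  · obtain ⟨B, hB⟩ := HasCompactSupport.exists_bound_of_continuous
      (hcomp.of_isClosed_subset (isClosed_tsupport _) (tsupport_iteratedDeriv_subset _ s))
      (hf.continuous_iteratedDeriv s (mod_cast le_top))
    refine ⟨B.toNNReal, fun x => ?_⟩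
    rw [← ofReal_norm]
    exact ENNReal.ofReal_le_ofReal (hB x)

/-- The derivative of order `n` of the extension is bounded in `L²` by the derivatives of order at
most `n` on `(a, b)`. -/
theorem exists_sqInt_extJet_le {a b : ℝ} {χ : ℕ → ℝ → ℂ} (hχ : IsCutoff a b χ)
    (n s k : ℕ) : ∃ C : ℝ≥0, ∀ w : ℕ → ℝ → ℂ, (∀ l, Measurable (w l)) →
      sqInt Set.univ (extJet a b χ n s k w) ≤
        C * ∑ l ∈ Finset.range (n + 1), sqInt (Set.Ioo a b) (w l) := by
  induction n generalizing s k with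
  | zero =>
    obtain ⟨C, hC⟩ := exists_sqInt_reflExt_le a b
    obtain ⟨B, hB⟩ := hχ.bounded s
    refine ⟨B ^ 2 * C, fun w hw => ?_⟩
    simp only [zero_add, Finset.sum_range_one]
    calc sqInt Set.univ (extJet a b χ 0 s k w)
        ≤ ∫⁻ x, (Set.Ioo (a - (b - a)) (b + (b - a))).indicator
            (fun x => (B : ℝ≥0∞) ^ 2 * ‖reflExt a b k (w 0) x‖ₑ ^ 2) x := by
          rw [sqInt, Measure.restrict_univ]
          refine lintegral_mono fun x => ?_
          by_cases hx : x ∈ Set.Ioo (a - (b - a)) (b + (b - a))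
          · rw [Set.indicator_of_mem hx]
            simp only [extJet, enorm_mul, mul_pow]
            gcongr
            exact hB x
          · simp [extJet, hχ.vanish s x hx]
      _ = (B : ℝ≥0∞) ^ 2 * sqInt (Set.Ioo (a - (b - a)) (b + (b - a))) (reflExt a b k (w 0)) := by
          rw [lintegral_indicator measurableSet_Ioo, lintegral_const_mul' _ _ (by simp)]
          rfl
      _ ≤ _ := by
          push_cast
          rw [mul_assoc]
          gcongr
          exact hC k _ (hw 0)
  | succ n ih =>
    obtain ⟨C₁, h₁⟩ := ih (s + 1) k
    obtain ⟨C₂, h₂⟩ := ih s (k + 1)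
    refine ⟨2 * (C₁ + C₂), fun w hw => ?_⟩
    have hm : Measurable (extJet a b χ n (s + 1) k w) :=
      (measurable_extJet (α := Unit) a b (fun s => (hχ.continuous s).measurable) n (s + 1) k
        (w := fun l _ => w l) (fun l => (hw l).comp measurable_snd)).comp
        (measurable_const (a := ()).prodMk measurable_id)
    calc sqInt Set.univ (extJet a b χ (n + 1) s k w)
        ≤ 2 * (sqInt Set.univ (extJet a b χ n (s + 1) k w) +
          sqInt Set.univ (extJet a b χ n s (k + 1) fun l => w (l + 1))) := sqInt_add_le _ hm
      _ ≤ 2 * (C₁ * (∑ l ∈ Finset.range (n + 1 + 1), sqInt (Set.Ioo a b) (w l)) +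
          C₂ * ∑ l ∈ Finset.range (n + 1 + 1), sqInt (Set.Ioo a b) (w l)) := by
          gcongr
          · refine (h₁ w hw).trans ?_
            have h3 : ∑ l ∈ Finset.range (n + 1), sqInt (Set.Ioo a b) (w l) ≤
                ∑ l ∈ Finset.range (n + 1 + 1), sqInt (Set.Ioo a b) (w l) :=
              Finset.sum_le_sum_of_subset (Finset.range_mono (Nat.le_succ _))
            gcongr
          · refine (h₂ _ fun l => hw (l + 1)).trans ?_
            have h3 : ∑ l ∈ Finset.range (n + 1), sqInt (Set.Ioo a b) (w (l + 1)) ≤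
                ∑ l ∈ Finset.range (n + 1 + 1), sqInt (Set.Ioo a b) (w l) := by
              rw [Finset.sum_range_succ' _ (n + 1)]
              exact le_self_add
            gcongr
      _ = _ := by
          push_cast
          ring

/-! ### Removing the affine part -/

/-- The mean value of `u` over `(a, b)`. -/
noncomputable def meanPart (a b : ℝ) (u : ℝ → ℂ) : ℂ :=
  ∫ s in a..b, (((b - a)⁻¹ : ℝ) : ℂ) * u s

/-- The slope of the affine function closest to `u` in `L²(a, b)`. -/
noncomputable def slopePart (a b : ℝ) (u : ℝ → ℂ) : ℂ :=
  ∫ s in a..b, ((12 / (b - a) ^ 3 * (s - (a + b) / 2) : ℝ) : ℂ) * u s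

/-- The jet of `u 0` minus its affine part on `(a, b)`, where `u l` is the `l`-th derivative
of `u 0`. -/
noncomputable def remJet (a b : ℝ) (u : ℕ → ℝ → ℂ) : ℕ → ℝ → ℂ
  | 0 => fun x => u 0 x - (meanPart a b (u 0) + slopePart a b (u 0) * ((x - (a + b) / 2 : ℝ) : ℂ))
  | 1 => fun x => u 1 x - slopePart a b (u 0)
  | l + 2 => u (l + 2)

theorem hasDerivAt_remJet (a b : ℝ) {u : ℕ → ℝ → ℂ}
    (hu : ∀ l x, HasDerivAt (u l) (u (l + 1) x) x) (l : ℕ) (x : ℝ) :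
    HasDerivAt (remJet a b u l) (remJet a b u (l + 1) x) x := by
  match l with
  | 0 =>
    have h1 : HasDerivAt (fun x : ℝ => ((x - (a + b) / 2 : ℝ) : ℂ)) 1 x := by
      simpa using ((hasDerivAt_id x).sub_const ((a + b) / 2)).ofReal_comp
    have h2 := (hu 0 x).sub ((h1.const_mul (slopePart a b (u 0))).const_add (meanPart a b (u 0)))
    rw [mul_one] at h2
    exact h2
  | 1 => exact (hu 1 x).sub_const _
  | l + 2 => exact hu (l + 2) x

theorem norm_sub_le_integral_norm_deriv {a b : ℝ} {f f' : ℝ → ℂ}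
    (hf : ∀ x, HasDerivAt f (f' x) x) (hf' : Continuous f') {x s : ℝ}
    (hx : x ∈ Set.Icc a b) (hs : s ∈ Set.Icc a b) :
    ‖f x - f s‖ ≤ ∫ t in a..b, ‖f' t‖ := by
  wlog hsx : s ≤ x generalizing s x
  · rw [norm_sub_rev]
    exact this hs hx (le_of_not_ge hsx)
  rw [← intervalIntegral.integral_eq_sub_of_hasDerivAt (fun y _ => hf y)
    (hf'.intervalIntegrable _ _)]
  refine (intervalIntegral.norm_integral_le_integral_norm hsx).trans ?_
  exact intervalIntegral.integral_mono_interval hs.1 hsx hx.2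
    (.of_forall fun t => norm_nonneg _) (hf'.norm.intervalIntegrable _ _)

/-- A function differs from any of its weighted means by at most the integral of its derivative. -/
theorem norm_sub_weightedMean_le {a b : ℝ} (hab : a < b) {κ : ℝ → ℝ} (hκ : Continuous κ)
    (hκ0 : ∀ s ∈ Set.Icc a b, 0 ≤ κ s) (hκ1 : ∫ s in a..b, κ s = 1) {f f' : ℝ → ℂ}
    (hf : ∀ x, HasDerivAt f (f' x) x) (hf' : Continuous f') {x : ℝ} (hx : x ∈ Set.Icc a b) :
    ‖f x - ∫ s in a..b, (κ s : ℂ) * f s‖ ≤ ∫ t in a..b, ‖f' t‖ := by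
  have hfc : Continuous f := continuous_iff_continuousAt.2 fun x => (hf x).continuousAt
  have hκc : Continuous fun s => (κ s : ℂ) := continuous_ofReal.comp hκ
  have h1 : f x - ∫ s in a..b, (κ s : ℂ) * f s = ∫ s in a..b, (κ s : ℂ) * (f x - f s) := by
    have h2 : IntervalIntegrable (fun s => (κ s : ℂ) * f x) volume a b :=
      (hκc.mul continuous_const).intervalIntegrable _ _
    have h3 : IntervalIntegrable (fun s => (κ s : ℂ) * f s) volume a b :=
      (hκc.mul hfc).intervalIntegrable _ _
    simp only [mul_sub]
    rw [intervalIntegral.integral_sub h2 h3, intervalIntegral.integral_mul_const,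
      intervalIntegral.integral_ofReal, hκ1, ofReal_one, one_mul]
  rw [h1]
  calc _ ≤ ∫ s in a..b, κ s * ∫ t in a..b, ‖f' t‖ := by
        refine intervalIntegral.norm_integral_le_of_norm_le hab.le (.of_forall fun s hs => ?_)
          ((hκ.mul continuous_const).intervalIntegrable _ _)
        have hs' := Set.Ioc_subset_Icc_self hs
        rw [norm_mul, norm_real, Real.norm_of_nonneg (hκ0 s hs')]
        exact mul_le_mul_of_nonneg_left (norm_sub_le_integral_norm_deriv hf hf' hx hs')
          (hκ0 s hs')
    _ = _ := by rw [intervalIntegral.integral_mul_const, hκ1, one_mul]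

/-- The slope of the affine part is the mean of the derivative for the weight
`6 (s - a) (b - s) / (b - a)³`. -/
theorem slopePart_eq {a b : ℝ} {u u' : ℝ → ℂ}
    (hu : ∀ x, HasDerivAt u (u' x) x) (hu' : Continuous u') :
    slopePart a b u = ∫ s in a..b, ((6 / (b - a) ^ 3 * ((s - a) * (b - s)) : ℝ) : ℂ) * u' s := by
  have hk (s : ℝ) : HasDerivAt (fun s : ℝ => ((6 / (b - a) ^ 3 * ((s - a) * (b - s)) : ℝ) : ℂ))
      ((-(12 / (b - a) ^ 3 * (s - (a + b) / 2)) : ℝ) : ℂ) s := by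
    have h1 : HasDerivAt (fun s : ℝ => 6 / (b - a) ^ 3 * ((s - a) * (b - s)))
        (-(12 / (b - a) ^ 3 * (s - (a + b) / 2))) s := by
      have h2 := (((hasDerivAt_id s).sub_const a).mul ((hasDerivAt_id s).const_sub b)).const_mul
        (6 / (b - a) ^ 3)
      refine h2.congr_deriv ?_
      simp only [id]
      ring
    exact h1.ofReal_comp
  have hc : Continuous fun s : ℝ => ((-(12 / (b - a) ^ 3 * (s - (a + b) / 2)) : ℝ) : ℂ) := by
    fun_prop
  have h := intervalIntegral.integral_mul_deriv_eq_deriv_mul (a := a) (b := b)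
    (fun s _ => hk s) (fun s _ => hu s) (hc.intervalIntegrable _ _) (hu'.intervalIntegrable _ _)
  rw [h]
  simp [slopePart]

theorem integral_slopeWeight {a b : ℝ} (hab : a < b) :
    ∫ s in a..b, 6 / (b - a) ^ 3 * ((s - a) * (b - s)) = 1 := by
  have hF (s : ℝ) : HasDerivAt (fun s : ℝ => (3 * (b - a) * (s - a) ^ 2 - 2 * (s - a) ^ 3)
      / (b - a) ^ 3) (6 / (b - a) ^ 3 * ((s - a) * (b - s))) s := by
    have h1 := (hasDerivAt_id s).sub_const a
    have h2 := (((h1.pow 2).const_mul (3 * (b - a))).sub ((h1.pow 3).const_mul 2)).div_const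
      ((b - a) ^ 3)
    refine h2.congr_deriv ?_
    simp only [id]
    ring
  have hc : Continuous fun s : ℝ => 6 / (b - a) ^ 3 * ((s - a) * (b - s)) := by fun_prop
  rw [intervalIntegral.integral_eq_sub_of_hasDerivAt (fun s _ => hF s) (hc.intervalIntegrable _ _)]
  have : (b - a) ≠ 0 := by linarith
  field_simp
  ring

theorem ofReal_integral_norm_sq_le {a b : ℝ} (hab : a < b) {f : ℝ → ℂ} (hf : Continuous f) :
    ENNReal.ofReal (∫ t in a..b, ‖f t‖) ^ 2 ≤ ENNReal.ofReal (b - a) * sqInt (Set.Ioo a b) f := by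
  have h1 : ENNReal.ofReal (∫ t in a..b, ‖f t‖) = ∫⁻ t in Set.Ioo a b, 1 * ‖f t‖ₑ := by
    rw [intervalIntegral.integral_of_le hab.le, integral_Ioc_eq_integral_Ioo,
      ofReal_integral_eq_lintegral_ofReal]
    · simp only [ofReal_norm, one_mul]
    · exact (hf.norm.integrableOn_Icc).mono_set Set.Ioo_subset_Icc_self
    · exact .of_forall fun t => norm_nonneg _
  have h2 := ENNReal.lintegral_mul_le_Lp_mul_Lq (volume.restrict (Set.Ioo a b))
    Real.HolderConjugate.two_two (f := fun _ => 1) (g := fun t => ‖f t‖ₑ) aemeasurable_const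
    hf.enorm.measurable.aemeasurable
  have h3 (x : ℝ≥0∞) : (x ^ (1 / (2 : ℝ))) ^ 2 = x := by
    rw [← ENNReal.rpow_natCast, ← ENNReal.rpow_mul]
    norm_num
  rw [h1]
  calc _ ≤ _ := pow_le_pow_left' h2 2
    _ = _ := by
      rw [mul_pow, h3, h3]
      simp [sqInt]

theorem sqInt_le_of_pointwise {a b : ℝ} (hab : a < b) (α β : ℝ≥0) {f g h : ℝ → ℂ}
    (hf : Continuous f) (hh : Measurable h)
    (hle : ∀ x ∈ Set.Ioo a b, ‖g x‖ ≤ α * ‖h x‖ + β * ∫ t in a..b, ‖f t‖) :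
    sqInt (Set.Ioo a b) g ≤ 2 * (α ^ 2 * sqInt (Set.Ioo a b) h +
      β ^ 2 * ENNReal.ofReal (b - a) ^ 2 * sqInt (Set.Ioo a b) f) := by
  set R := ∫ t in a..b, ‖f t‖
  have hR : 0 ≤ R := intervalIntegral.integral_nonneg hab.le fun t _ => norm_nonneg _
  calc sqInt (Set.Ioo a b) g
      ≤ ∫⁻ x in Set.Ioo a b, 2 * (α ^ 2 * ‖h x‖ₑ ^ 2 + β ^ 2 * ENNReal.ofReal R ^ 2) := by
        refine setLIntegral_mono' measurableSet_Ioo fun x hx => ?_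
        have h1 : ‖g x‖ₑ ≤ α * ‖h x‖ₑ + β * ENNReal.ofReal R := by
          have h2 := ENNReal.ofReal_le_ofReal (hle x hx)
          rwa [ENNReal.ofReal_add (by positivity) (by positivity), ENNReal.ofReal_mul α.coe_nonneg,
            ENNReal.ofReal_mul β.coe_nonneg, ofReal_norm, ofReal_norm, ENNReal.ofReal_coe_nnreal,
            ENNReal.ofReal_coe_nnreal] at h2
        calc _ ≤ (α * ‖h x‖ₑ + β * ENNReal.ofReal R) ^ 2 := by gcongr
          _ ≤ _ := ENNReal.add_sq_le_two_mul _ _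
          _ = _ := by rw [mul_pow, mul_pow]
    _ = 2 * (α ^ 2 * sqInt (Set.Ioo a b) h +
          β ^ 2 * ENNReal.ofReal R ^ 2 * ENNReal.ofReal (b - a)) := by
        rw [lintegral_const_mul' _ _ (by norm_num), lintegral_add_left (by fun_prop),
          lintegral_const_mul' _ _ (by simp)]
        simp [sqInt]
    _ ≤ 2 * (α ^ 2 * sqInt (Set.Ioo a b) h +
          β ^ 2 * (ENNReal.ofReal (b - a) * sqInt (Set.Ioo a b) f) * ENNReal.ofReal (b - a)) := by
        gcongr
        exact ofReal_integral_norm_sq_le hab hf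
    _ = _ := by ring

theorem norm_integral_weight_mul_le {a b : ℝ} (hab : a < b) {κ : ℝ → ℝ} {B : ℝ}
    (hB : ∀ s ∈ Set.Icc a b, |κ s| ≤ B) {f : ℝ → ℂ} (hf : Continuous f) :
    ‖∫ s in a..b, (κ s : ℂ) * f s‖ ≤ B * ∫ s in a..b, ‖f s‖ := by
  rw [← intervalIntegral.integral_const_mul]
  refine intervalIntegral.norm_integral_le_of_norm_le hab.le (.of_forall fun s hs => ?_)
    ((continuous_const.mul hf.norm).intervalIntegrable _ _)
  rw [norm_mul, norm_real]
  exact mul_le_mul_of_nonneg_right (hB s (Set.Ioc_subset_Icc_self hs)) (norm_nonneg _)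

theorem norm_meanPart_le {a b : ℝ} (hab : a < b) {u : ℝ → ℂ} (hu : Continuous u) :
    ‖meanPart a b u‖ ≤ (b - a)⁻¹ * ∫ s in a..b, ‖u s‖ :=
  norm_integral_weight_mul_le hab (κ := fun _ => (b - a)⁻¹)
    (fun s _ => (abs_of_nonneg (inv_nonneg.2 (by linarith))).le) hu

theorem norm_slopePart_le {a b : ℝ} (hab : a < b) {u : ℝ → ℂ} (hu : Continuous u) :
    ‖slopePart a b u‖ ≤ 12 / (b - a) ^ 2 * ∫ s in a..b, ‖u s‖ := by
  refine norm_integral_weight_mul_le hab (fun s hs => ?_) hu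
  have h0 : 0 < b - a := by linarith
  rw [abs_mul, abs_of_pos (by positivity), show 12 / (b - a) ^ 2 = 12 / (b - a) ^ 3 * (b - a) by
    field_simp]
  gcongr
  rw [abs_le]
  constructor <;> linarith [hs.1, hs.2]

theorem norm_slopePart_le_deriv {a b : ℝ} (hab : a < b) {u u' : ℝ → ℂ}
    (hu : ∀ x, HasDerivAt u (u' x) x) (hu' : Continuous u') :
    ‖slopePart a b u‖ ≤ 6 / (b - a) * ∫ s in a..b, ‖u' s‖ := by
  rw [slopePart_eq hu hu']
  refine norm_integral_weight_mul_le hab (fun s hs => ?_) hu'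
  have h0 : 0 < b - a := by linarith
  have h1 : 0 ≤ s - a := by linarith [hs.1]
  have h2 : 0 ≤ b - s := by linarith [hs.2]
  rw [abs_of_nonneg (by positivity), show 6 / (b - a) = 6 / (b - a) ^ 3 * ((b - a) * (b - a)) by
    field_simp]
  gcongr
  · exact hs.2
  · exact hs.1

theorem norm_remJet_one_le {a b : ℝ} (hab : a < b) {u : ℕ → ℝ → ℂ}
    (hu : ∀ l x, HasDerivAt (u l) (u (l + 1) x) x) {x : ℝ} (hx : x ∈ Set.Icc a b) :
    ‖remJet a b u 1 x‖ ≤ ∫ t in a..b, ‖u 2 t‖ := by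
  have hc (l : ℕ) : Continuous (u l) :=
    continuous_iff_continuousAt.2 fun x => (hu l x).continuousAt
  have h0 : 0 < b - a := by linarith
  change ‖u 1 x - slopePart a b (u 0)‖ ≤ _
  rw [slopePart_eq (hu 0) (hc 1)]
  refine norm_sub_weightedMean_le hab (by fun_prop) (fun s hs => ?_) (integral_slopeWeight hab)
    (hu 1) (hc 2) hx
  have h1 : 0 ≤ s - a := by linarith [hs.1]
  have h2 : 0 ≤ b - s := by linarith [hs.2]
  positivity

theorem meanPart_remJet_zero {a b : ℝ} (hab : a < b) {u : ℕ → ℝ → ℂ} (hu : Continuous (u 0)) :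
    meanPart a b (remJet a b u 0) = 0 := by
  have h0 : ((b - a : ℝ) : ℂ) ≠ 0 := ofReal_ne_zero.2 (by linarith)
  have hid : ∫ s in a..b, ((s - (a + b) / 2 : ℝ) : ℂ) = 0 := by
    rw [intervalIntegral.integral_ofReal, ofReal_eq_zero,
      intervalIntegral.integral_sub intervalIntegral.intervalIntegrable_id
        intervalIntegrable_const, integral_id, intervalIntegral.integral_const, smul_eq_mul]
    ring
  have h1 : IntervalIntegrable (fun s : ℝ => meanPart a b (u 0)) volume a b :=
    intervalIntegrable_const
  have h2 : IntervalIntegrable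
      (fun s : ℝ => slopePart a b (u 0) * ((s - (a + b) / 2 : ℝ) : ℂ)) volume a b :=
    (by fun_prop : Continuous fun s : ℝ => slopePart a b (u 0) * ((s - (a + b) / 2 : ℝ) : ℂ)
      ).intervalIntegrable _ _
  simp only [remJet]
  unfold meanPart
  rw [intervalIntegral.integral_const_mul, intervalIntegral.integral_sub
    (hu.intervalIntegrable _ _) (by exact h1.add h2)]
  erw [intervalIntegral.integral_add h1 h2]
  rw [intervalIntegral.integral_const_mul (slopePart a b (u 0)), hid,
    intervalIntegral.integral_const]
  unfold meanPart
  rw [intervalIntegral.integral_const_mul, real_smul]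
  push_cast at h0 ⊢
  field_simp
  ring

theorem norm_remJet_zero_le {a b : ℝ} (hab : a < b) {u : ℕ → ℝ → ℂ}
    (hu : ∀ l x, HasDerivAt (u l) (u (l + 1) x) x) {x : ℝ} (hx : x ∈ Set.Icc a b) :
    ‖remJet a b u 0 x‖ ≤ ∫ t in a..b, ‖remJet a b u 1 t‖ := by
  have hr := hasDerivAt_remJet a b hu
  have hc (l : ℕ) : Continuous (remJet a b u l) :=
    continuous_iff_continuousAt.2 fun x => (hr l x).continuousAt
  have h0 : 0 < b - a := by linarith
  have h := norm_sub_weightedMean_le hab (κ := fun _ => (b - a)⁻¹) continuous_const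
    (fun _ _ => by positivity) ?_ (hr 0) (hc 1) hx
  · have h1 := meanPart_remJet_zero hab
      (continuous_iff_continuousAt.2 fun x => (hu 0 x).continuousAt)
    unfold meanPart at h1
    rwa [h1, sub_zero] at h
  · rw [intervalIntegral.integral_const, smul_eq_mul, mul_inv_cancel₀ h0.ne']

/-- The estimates for a function minus its affine part: it is controlled by the function itself, by
the first and by the second derivative; its derivative is controlled by the first and by the second
derivative. -/
theorem exists_sqInt_remJet_le {a b : ℝ} (hab : a < b) :
    ∃ C : ℝ≥0, ∀ u : ℕ → ℝ → ℂ, (∀ l x, HasDerivAt (u l) (u (l + 1) x) x) →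
      sqInt (Set.Ioo a b) (remJet a b u 0) ≤ C * sqInt (Set.Ioo a b) (u 0) ∧
      (∀ l ∈ ({0, 1} : Set ℕ), sqInt (Set.Ioo a b) (remJet a b u l) ≤
        C * sqInt (Set.Ioo a b) (u 1)) ∧
      (∀ l ∈ ({0, 1} : Set ℕ), sqInt (Set.Ioo a b) (remJet a b u l) ≤
        C * sqInt (Set.Ioo a b) (u 2)) ∧
      sqInt (Set.Ioo a b) (u 1) ≤
        C * (sqInt (Set.Ioo a b) (u 0) + sqInt (Set.Ioo a b) (u 2)) := by
  have h0 : 0 < b - a := by linarith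
  set ℓ : ℝ≥0 := (b - a).toNNReal with hℓ
  have hℓ' : (ℓ : ℝ) = b - a := Real.coe_toNNReal _ h0.le
  have hℓe : ENNReal.ofReal (b - a) = ℓ := rfl
  set c₀ : ℝ≥0 := 2 * ℓ ^ 2 with hc₀
  set c₁ : ℝ≥0 := 2 * (1 + (6 / ℓ) ^ 2 * ℓ ^ 2) with hc₁
  set c₂ : ℝ≥0 := 2 * (1 + (7 / ℓ) ^ 2 * ℓ ^ 2) with hc₂
  set c₃ : ℝ≥0 := 2 * (12 / ℓ ^ 2) ^ 2 * ℓ ^ 2 with hc₃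
  refine ⟨c₂ + (c₁ + c₀ * c₁) + (c₀ + c₀ * c₀) + (2 * c₀ + c₃), fun u hu => ?_⟩
  set C : ℝ≥0 := c₂ + (c₁ + c₀ * c₁) + (c₀ + c₀ * c₀) + (2 * c₀ + c₃) with hC
  have hmono {c : ℝ≥0} (hc : c ≤ C) (X : ℝ≥0∞) : (c : ℝ≥0∞) * X ≤ C * X := by gcongr
  have hr := hasDerivAt_remJet a b hu
  have hcu (l : ℕ) : Continuous (u l) :=
    continuous_iff_continuousAt.2 fun x => (hu l x).continuousAt
  have hcr (l : ℕ) : Continuous (remJet a b u l) :=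
    continuous_iff_continuousAt.2 fun x => (hr l x).continuousAt
  have hR (f : ℝ → ℂ) : 0 ≤ ∫ t in a..b, ‖f t‖ :=
    intervalIntegral.integral_nonneg hab.le fun t _ => norm_nonneg _
  set A := Set.Ioo a b
  have h01 : sqInt A (remJet a b u 0) ≤ c₀ * sqInt A (remJet a b u 1) := by
    refine (sqInt_le_of_pointwise hab 0 1 (hcr 1) (hcr 1).measurable fun x hx => ?_).trans_eq ?_
    · simpa using norm_remJet_zero_le hab hu (Set.Ioo_subset_Icc_self hx)
    · rw [hℓe]
      push_cast [hc₀]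
      ring
  have h12 : sqInt A (remJet a b u 1) ≤ c₀ * sqInt A (u 2) := by
    refine (sqInt_le_of_pointwise hab 0 1 (hcu 2) (hcr 1).measurable fun x hx => ?_).trans_eq ?_
    · simpa using norm_remJet_one_le hab hu (Set.Ioo_subset_Icc_self hx)
    · rw [hℓe]
      push_cast [hc₀]
      ring
  have h11 : sqInt A (remJet a b u 1) ≤ c₁ * sqInt A (u 1) := by
    refine (sqInt_le_of_pointwise hab 1 (6 / ℓ) (hcu 1) (hcu 1).measurable
      fun x hx => ?_).trans_eq ?_
    · push_cast
      rw [hℓ', one_mul]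
      exact (norm_sub_le _ _).trans
        (add_le_add_right (norm_slopePart_le_deriv hab (hu 0) (hcu 1)) _)
    · rw [hℓe, hc₁, ENNReal.coe_mul, ENNReal.coe_add, ENNReal.coe_mul, ENNReal.coe_pow,
        ENNReal.coe_pow]
      push_cast
      ring
  have h00 : sqInt A (remJet a b u 0) ≤ c₂ * sqInt A (u 0) := by
    refine (sqInt_le_of_pointwise hab 1 (7 / ℓ) (hcu 0) (hcu 0).measurable
      fun x hx => ?_).trans_eq ?_
    · push_cast
      rw [hℓ', one_mul]
      refine (norm_sub_le _ _).trans (add_le_add_right ?_ _)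
      have hx1 : ‖((x - (a + b) / 2 : ℝ) : ℂ)‖ ≤ (b - a) / 2 := by
        rw [norm_real, Real.norm_eq_abs, abs_le]
        constructor <;> linarith [hx.1, hx.2]
      calc _ ≤ ‖meanPart a b (u 0)‖ + ‖slopePart a b (u 0)‖ * ‖((x - (a + b) / 2 : ℝ) : ℂ)‖ := by
            rw [← norm_mul]
            exact norm_add_le _ _
        _ ≤ (b - a)⁻¹ * (∫ t in a..b, ‖u 0 t‖) +
            (12 / (b - a) ^ 2 * ∫ t in a..b, ‖u 0 t‖) * ((b - a) / 2) := by
            have := hR (u 0)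
            gcongr
            · exact norm_meanPart_le hab (hcu 0)
            · exact norm_slopePart_le hab (hcu 0)
        _ = _ := by
            field_simp
            ring
    · rw [hℓe, hc₂, ENNReal.coe_mul, ENNReal.coe_add, ENNReal.coe_mul, ENNReal.coe_pow,
        ENNReal.coe_pow]
      push_cast
      ring
  have h102 : sqInt A (u 1) ≤ 2 * sqInt A (remJet a b u 1) + c₃ * sqInt A (u 0) := by
    refine (sqInt_le_of_pointwise hab 1 (12 / ℓ ^ 2) (hcu 0) (hcr 1).measurable
      fun x hx => ?_).trans_eq ?_
    · push_cast
      rw [hℓ', one_mul]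
      have h1 : u 1 x = remJet a b u 1 x + slopePart a b (u 0) := by simp [remJet]
      calc _ ≤ ‖remJet a b u 1 x‖ + ‖slopePart a b (u 0)‖ := by
            conv_lhs => rw [h1]
            exact norm_add_le _ _
        _ ≤ _ := add_le_add_right (norm_slopePart_le hab (hcu 0)) _
    · rw [hℓe, hc₃, ENNReal.coe_mul, ENNReal.coe_mul, ENNReal.coe_pow,
        ENNReal.coe_pow]
      push_cast
      ring
  have h01' (c : ℝ≥0) (X : ℝ≥0∞) (h : sqInt A (remJet a b u 1) ≤ c * X) :
      sqInt A (remJet a b u 0) ≤ (c₀ * c : ℝ≥0) * X := by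
    refine h01.trans ?_
    push_cast
    rw [mul_assoc]
    gcongr
  refine ⟨h00.trans (hmono ?_ _), ?_, ?_, ?_⟩
  · simp only [hC, add_assoc]
    exact le_self_add
  · rintro l (rfl | rfl)
    · refine (h01' _ _ h11).trans (hmono ?_ _)
      calc c₀ * c₁ ≤ c₀ * c₁ + (c₂ + c₁ + (c₀ + c₀ * c₀) + (2 * c₀ + c₃)) := le_self_add
        _ = C := by rw [hC]; ring
    · refine h11.trans (hmono ?_ _)
      calc c₁ ≤ c₁ + (c₂ + c₀ * c₁ + (c₀ + c₀ * c₀) + (2 * c₀ + c₃)) := le_self_add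
        _ = C := by rw [hC]; ring
  · rintro l (rfl | rfl)
    · refine (h01' _ _ h12).trans (hmono ?_ _)
      calc c₀ * c₀ ≤ c₀ * c₀ + (c₂ + c₁ + c₀ * c₁ + c₀ + (2 * c₀ + c₃)) := le_self_add
        _ = C := by rw [hC]; ring
    · refine h12.trans (hmono ?_ _)
      calc c₀ ≤ c₀ + (c₂ + c₁ + c₀ * c₁ + c₀ * c₀ + (2 * c₀ + c₃)) := le_self_add
        _ = C := by rw [hC]; ring
  · have hle : (2 * c₀ + c₃ : ℝ≥0) ≤ C := by
      rw [hC]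
      exact le_add_self
    refine le_trans ?_ (hmono hle _)
    calc _ ≤ 2 * (c₀ * sqInt A (u 2)) + c₃ * sqInt A (u 0) := by
          refine h102.trans ?_
          gcongr
      _ ≤ 2 * c₀ * sqInt A (u 2) + c₃ * sqInt A (u 0) +
          (2 * c₀ * sqInt A (u 0) + c₃ * sqInt A (u 2)) := by
          rw [← mul_assoc]
          exact le_self_add
      _ = _ := by
          push_cast
          ring

/-! ### Extension from a rectangle -/

/-- The square integral of `u` over `A × B`. -/
noncomputable def sqInt₂ (A B : Set ℝ) (u : ℝ → ℝ → ℂ) : ℝ≥0∞ :=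
  ∫⁻ y in B, sqInt A fun x => u x y

theorem measurable_sqInt {A : Set ℝ} {u : ℝ → ℝ → ℂ}
    (hu : Measurable fun q : ℝ × ℝ => u q.1 q.2) : Measurable fun y => sqInt A fun x => u x y := by
  have h : Measurable fun q : ℝ × ℝ => ‖u q.1 q.2‖ₑ ^ 2 := by fun_prop
  exact h.lintegral_prod_left'

theorem sqInt₂_swap {A B : Set ℝ} {u : ℝ → ℝ → ℂ}
    (hu : Measurable fun q : ℝ × ℝ => u q.1 q.2) :
    sqInt₂ A B u = sqInt₂ B A fun y x => u x y := by
  have h : Measurable fun q : ℝ × ℝ => ‖u q.1 q.2‖ₑ ^ 2 := by fun_prop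
  exact lintegral_lintegral_swap (f := fun y x => ‖u x y‖ₑ ^ 2)
    (h.comp measurable_swap).aemeasurable

theorem sqInt₂_le_of_slices {A A' B : Set ℝ} {f : ℝ → ℝ → ℂ} {ι : Type*} (s : Finset ι)
    {g : ι → ℝ → ℝ → ℂ} {C : ℝ≥0} (hg : ∀ k, Measurable fun q : ℝ × ℝ => g k q.1 q.2)
    (h : ∀ y, sqInt A' (fun x => f x y) ≤ C * ∑ k ∈ s, sqInt A (fun x => g k x y)) :
    sqInt₂ A' B f ≤ C * ∑ k ∈ s, sqInt₂ A B (g k) := by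
  calc _ ≤ ∫⁻ y in B, C * ∑ k ∈ s, sqInt A (fun x => g k x y) := lintegral_mono fun y => h y
    _ = _ := by
      rw [lintegral_const_mul' _ _ (by simp), lintegral_finsetSum _ fun k _ => measurable_sqInt (hg k)]
      rfl

/-- A function of two variables together with its partial derivatives: `u i j` is the derivative of
order `i` in the first and of order `j` in the second variable of `u 0 0`. Derivatives in the second
variable are asked for up to order `N` only. -/
structure IsJet (N : ℕ∞) (u : ℕ → ℕ → ℝ → ℝ → ℂ) : Prop where
  dx : ∀ i j x y, HasDerivAt (fun x => u i j x y) (u (i + 1) j x y) x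
  dy : ∀ i (j : ℕ), j < N → ∀ x y, HasDerivAt (fun y => u i j x y) (u i (j + 1) x y) y
  meas : ∀ i j, Measurable fun q : ℝ × ℝ => u i j q.1 q.2

theorem hasDerivAt_integral_weight_mul {a b : ℝ} {κ : ℝ → ℂ} (hκ : Continuous κ)
    {f f' : ℝ → ℝ → ℂ} (hfc : ∀ y, Continuous fun s => f s y) (hfc' : ∀ y, Continuous fun s => f' s y)
    (h : ∀ s y, HasDerivAt (fun y => f s y) (f' s y) y) {B : ℝ} (hB : ∀ s y, ‖f' s y‖ ≤ B) (y : ℝ) :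
    HasDerivAt (fun y => ∫ s in a..b, κ s * f s y) (∫ s in a..b, κ s * f' s y) y := by
  refine (intervalIntegral.hasDerivAt_integral_of_dominated_loc_of_deriv_le
    (bound := fun s => ‖κ s‖ * B) (F := fun y s => κ s * f s y) (F' := fun y s => κ s * f' s y)
    Filter.univ_mem (.of_forall fun y => ?_) ?_ ?_ ?_ ?_ ?_).2
  · exact (hκ.mul (hfc y)).aestronglyMeasurable
  · exact (hκ.mul (hfc y)).intervalIntegrable _ _
  · exact (hκ.mul (hfc' y)).aestronglyMeasurable
  · refine .of_forall fun s _ y _ => ?_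
    rw [norm_mul]
    exact mul_le_mul_of_nonneg_left (hB s y) (norm_nonneg _)
  · exact (hκ.norm.mul continuous_const).intervalIntegrable _ _
  · exact .of_forall fun s _ y _ => (h s y).const_mul _

theorem isJet_remJet (a b : ℝ) {u : ℕ → ℕ → ℝ → ℝ → ℂ} (hu : IsJet ⊤ u)
    (hB : ∀ j, ∃ B : ℝ, ∀ x y, ‖u 0 j x y‖ ≤ B) :
    IsJet ⊤ fun i j x y => remJet a b (fun l x => u l j x y) i x := by
  have hc (i j : ℕ) (y : ℝ) : Continuous fun x => u i j x y :=
    continuous_iff_continuousAt.2 fun x => (hu.dx i j x y).continuousAt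
  have hmean (j : ℕ) (y : ℝ) : HasDerivAt (fun y => meanPart a b fun x => u 0 j x y)
      (meanPart a b fun x => u 0 (j + 1) x y) y := by
    obtain ⟨B, hB⟩ := hB (j + 1)
    exact hasDerivAt_integral_weight_mul continuous_const (hc 0 j) (hc 0 (j + 1))
      (fun s y => hu.dy 0 j (WithTop.coe_lt_top _) s y) hB y
  have hslope (j : ℕ) (y : ℝ) : HasDerivAt (fun y => slopePart a b fun x => u 0 j x y)
      (slopePart a b fun x => u 0 (j + 1) x y) y := by
    obtain ⟨B, hB⟩ := hB (j + 1)
    exact hasDerivAt_integral_weight_mul (by fun_prop) (hc 0 j) (hc 0 (j + 1))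
      (fun s y => hu.dy 0 j (WithTop.coe_lt_top _) s y) hB y
  have hm1 (j : ℕ) : Measurable fun y => meanPart a b fun x => u 0 j x y :=
    (continuous_iff_continuousAt.2 fun y => (hmean j y).continuousAt).measurable
  have hm2 (j : ℕ) : Measurable fun y => slopePart a b fun x => u 0 j x y :=
    (continuous_iff_continuousAt.2 fun y => (hslope j y).continuousAt).measurable
  refine ⟨fun i j x y => hasDerivAt_remJet a b (fun l x => hu.dx l j x y) i x,
    fun i j hj x y => ?_, fun i j => ?_⟩
  · match i with
    | 0 => exact (hu.dy 0 j hj x y).sub ((hmean j y).add ((hslope j y).mul_const _))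
    | 1 => exact (hu.dy 1 j hj x y).sub (hslope j y)
    | i + 2 => exact hu.dy (i + 2) j hj x y
  · match i with
    | 0 =>
      have h3 : Measurable fun q : ℝ × ℝ => ((q.1 - (a + b) / 2 : ℝ) : ℂ) := by fun_prop
      exact (hu.meas 0 j).sub (((hm1 j).comp measurable_snd).add
        (((hm2 j).comp measurable_snd).mul h3))
    | 1 => exact (hu.meas 1 j).sub ((hm2 j).comp measurable_snd)
    | i + 2 => exact hu.meas (i + 2) j

theorem isJet_extJet_snd {c d : ℝ} (hcd : c < d) {χ : ℕ → ℝ → ℂ} (hχ : IsCutoff c d χ)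
    {w : ℕ → ℕ → ℝ → ℝ → ℂ} (hw : IsJet ⊤ w) :
    IsJet 3 fun i j x y => extJet c d χ j 0 0 (fun l y => w i l x y) y where
  dx i j x y := hasDerivAt_extJet_param c d χ j 0 0 (fun l y => hw.dx i l x y) y
  dy i j hj x y := hasDerivAt_extJet hcd hχ.deriv j 0 0 (by
      have : j < 3 := by exact_mod_cast hj
      omega)
    (fun l y => hw.dy i l (WithTop.coe_lt_top _) x y) y
  meas i j := measurable_extJet c d (fun s => (hχ.continuous s).measurable) j 0 0
    (w := fun l x y => w i l x y) (fun l => hw.meas i l)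

/-- The jet of the extension of `u 0 0` from `(a, b) × (c, d)` to the plane: the affine part in the
first variable is removed, and the rest is reflected and cut off in the second and then in the first
variable. -/
noncomputable def rectExt (a b c d : ℝ) (χ ψ : ℕ → ℝ → ℂ) (u : ℕ → ℕ → ℝ → ℝ → ℂ) (i j : ℕ)
    (x y : ℝ) : ℂ :=
  extJet a b χ i 0 0 (fun l x =>
    extJet c d ψ j 0 0 (fun m y => remJet a b (fun l x => u l m x y) l x) y) x

section

variable {a b c d : ℝ} {χ ψ : ℕ → ℝ → ℂ} {u : ℕ → ℕ → ℝ → ℝ → ℂ}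

theorem hasDerivAt_rectExt_fst (hab : a < b) (hcd : c < d) (hχ : IsCutoff a b χ)
    (hψ : IsCutoff c d ψ) (hu : IsJet ⊤ u) (hB : ∀ j, ∃ B : ℝ, ∀ x y, ‖u 0 j x y‖ ≤ B) {i : ℕ}
    (hi : i ≤ 2) (j : ℕ) (x y : ℝ) :
    HasDerivAt (fun x => rectExt a b c d χ ψ u i j x y)
      (rectExt a b c d χ ψ u (i + 1) j x y) x :=
  hasDerivAt_extJet hab hχ.deriv i 0 0 (by omega)
    (fun l x => (isJet_extJet_snd hcd hψ (isJet_remJet a b hu hB)).dx l j x y) x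

theorem hasDerivAt_rectExt_snd (hcd : c < d)
    (hψ : IsCutoff c d ψ) (hu : IsJet ⊤ u) (hB : ∀ j, ∃ B : ℝ, ∀ x y, ‖u 0 j x y‖ ≤ B) (i : ℕ)
    {j : ℕ} (hj : j ≤ 2) (x y : ℝ) :
    HasDerivAt (fun y => rectExt a b c d χ ψ u i j x y)
      (rectExt a b c d χ ψ u i (j + 1) x y) y :=
  hasDerivAt_extJet_param a b χ i 0 0
    (w := fun l y x => extJet c d ψ j 0 0 (fun m y => remJet a b (fun l x => u l m x y) l x) y)
    (w' := fun l y x =>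
      extJet c d ψ (j + 1) 0 0 (fun m y => remJet a b (fun l x => u l m x y) l x) y)
    (fun l x => (isJet_extJet_snd hcd hψ (isJet_remJet a b hu hB)).dy l j
      (by exact_mod_cast (by omega : j < 3)) x y) x

theorem measurable_rectExt (hcd : c < d) (hχ : IsCutoff a b χ)
    (hψ : IsCutoff c d ψ) (hu : IsJet ⊤ u) (hB : ∀ j, ∃ B : ℝ, ∀ x y, ‖u 0 j x y‖ ≤ B) (i j : ℕ) :
    Measurable fun q : ℝ × ℝ => rectExt a b c d χ ψ u i j q.1 q.2 := by
  have h := measurable_extJet a b (fun s => (hχ.continuous s).measurable) i 0 0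
    (w := fun l y x => extJet c d ψ j 0 0 (fun m y => remJet a b (fun l x => u l m x y) l x) y)
    (fun l => ((isJet_extJet_snd hcd hψ (isJet_remJet a b hu hB)).meas l j).comp measurable_swap)
  exact h.comp measurable_swap

theorem rectExt_eq_of_mem (hχ : IsCutoff a b χ) (hψ : IsCutoff c d ψ) {x y : ℝ}
    (hx : x ∈ Set.Ioo a b) (hy : y ∈ Set.Ioo c d) (i j : ℕ) :
    rectExt a b c d χ ψ u (i + 2) j x y = u (i + 2) j x y := by
  unfold rectExt
  rw [extJet_eq_of_mem hx (hχ.one x hx) (fun s => hχ.zero s x hx),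
    extJet_eq_of_mem hy (hψ.one y hy) (fun s => hψ.zero s y hy)]
  rfl

theorem exists_sqInt₂_rectExt_le_rem (hcd : c < d) (hχ : IsCutoff a b χ)
    (hψ : IsCutoff c d ψ) (i j : ℕ) : ∃ C : ℝ≥0, ∀ u : ℕ → ℕ → ℝ → ℝ → ℂ, IsJet ⊤ u →
      (∀ j, ∃ B : ℝ, ∀ x y, ‖u 0 j x y‖ ≤ B) →
      sqInt₂ Set.univ Set.univ (rectExt a b c d χ ψ u i j) ≤
        C * ∑ l ∈ Finset.range (i + 1), ∑ m ∈ Finset.range (j + 1),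
          sqInt₂ (Set.Ioo a b) (Set.Ioo c d)
            (fun x y => remJet a b (fun l x => u l m x y) l x) := by
  obtain ⟨C₁, h₁⟩ := exists_sqInt_extJet_le hχ i 0 0
  obtain ⟨C₂, h₂⟩ := exists_sqInt_extJet_le hψ j 0 0
  refine ⟨C₁ * C₂, fun u hu hB => ?_⟩
  set w : ℕ → ℕ → ℝ → ℝ → ℂ := fun l m x y => remJet a b (fun l x => u l m x y) l x with hwdef
  have hw : IsJet ⊤ w := isJet_remJet a b hu hB
  have hV := isJet_extJet_snd hcd hψ hw
  set V : ℕ → ℕ → ℝ → ℝ → ℂ := fun i j x y => extJet c d ψ j 0 0 (fun l y => w i l x y) y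
  have hslice (i j : ℕ) (y : ℝ) : Measurable fun x => V i j x y :=
    (hV.meas i j).comp (measurable_id.prodMk measurable_const)
  have hslice' (i j : ℕ) (x : ℝ) : Measurable fun y => w i j x y :=
    (hw.meas i j).comp (measurable_const.prodMk measurable_id)
  calc sqInt₂ Set.univ Set.univ (rectExt a b c d χ ψ u i j)
      ≤ ∫⁻ y in Set.univ, C₁ * ∑ l ∈ Finset.range (i + 1),
          sqInt (Set.Ioo a b) (fun x => V l j x y) :=
        lintegral_mono fun y => h₁ (fun l x => V l j x y) fun l => hslice l j y
    _ = C₁ * ∑ l ∈ Finset.range (i + 1), sqInt₂ (Set.Ioo a b) Set.univ (V l j) := by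
        rw [lintegral_const_mul' _ _ (by simp),
          lintegral_finsetSum _ fun l _ => measurable_sqInt (hV.meas l j)]
        rfl
    _ ≤ C₁ * ∑ l ∈ Finset.range (i + 1), C₂ * ∑ m ∈ Finset.range (j + 1),
          sqInt₂ (Set.Ioo a b) (Set.Ioo c d) (w l m) := by
        gcongr with l _
        rw [sqInt₂_swap (hV.meas l j)]
        refine (sqInt₂_le_of_slices (Finset.range (j + 1)) (g := fun m y x => w l m x y)
          (fun m => (hw.meas l m).comp measurable_swap)
          fun x => h₂ (fun m y => w l m x y) fun m => hslice' l m x).trans_eq ?_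
        simp only [← sqInt₂_swap (hw.meas l _)]
    _ = _ := by
        rw [← Finset.mul_sum, ENNReal.coe_mul, mul_assoc]

/-- The estimates for a jet minus its affine part in the first variable. -/
theorem exists_sqInt₂_remJet_le (hab : a < b) (B : Set ℝ) : ∃ C : ℝ≥0,
    ∀ u : ℕ → ℕ → ℝ → ℝ → ℂ, IsJet ⊤ u → ∀ m,
      (∀ l, sqInt₂ (Set.Ioo a b) B (fun x y => remJet a b (fun l x => u l m x y) l x) ≤
        C * sqInt₂ (Set.Ioo a b) B (u l m)) ∧
      (∀ l ∈ ({0, 1} : Set ℕ),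
        sqInt₂ (Set.Ioo a b) B (fun x y => remJet a b (fun l x => u l m x y) l x) ≤
        C * sqInt₂ (Set.Ioo a b) B (u 1 m)) ∧
      (∀ l ∈ ({0, 1} : Set ℕ),
        sqInt₂ (Set.Ioo a b) B (fun x y => remJet a b (fun l x => u l m x y) l x) ≤
        C * sqInt₂ (Set.Ioo a b) B (u 2 m)) := by
  obtain ⟨C, hC⟩ := exists_sqInt_remJet_le hab
  have hle (X : ℝ≥0∞) : C * X ≤ (C + 1 : ℝ≥0) * X := by
    gcongr
    exact le_self_add
  refine ⟨C + 1, fun u hu m => ?_⟩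
  have h (y : ℝ) := hC (fun l x => u l m x y) fun l x => hu.dx l m x y
  have hint {f g : ℝ → ℝ → ℂ} (hfg : ∀ y, sqInt (Set.Ioo a b) (fun x => f x y) ≤
      (C + 1 : ℝ≥0) * sqInt (Set.Ioo a b) fun x => g x y) :
      sqInt₂ (Set.Ioo a b) B f ≤ (C + 1 : ℝ≥0) * sqInt₂ (Set.Ioo a b) B g := by
    unfold sqInt₂
    rw [← lintegral_const_mul' _ _ (by simp)]
    exact lintegral_mono hfg
  refine ⟨fun l => ?_, fun l hl => hint fun y => ((h y).2.1 l hl).trans (hle _),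
    fun l hl => hint fun y => ((h y).2.2.1 l hl).trans (hle _)⟩
  match l with
  | 0 => exact hint fun y => (h y).1.trans (hle _)
  | 1 => exact hint fun y => ((h y).2.1 1 (by simp)).trans (hle _)
  | l + 2 =>
    refine hint fun y => ?_
    calc sqInt (Set.Ioo a b) (u (l + 2) m · y) ≤ 1 * sqInt (Set.Ioo a b) (u (l + 2) m · y) := by
          rw [one_mul]
      _ ≤ _ := by
          gcongr
          push_cast
          exact le_add_self

theorem exists_sqInt₂_deriv_snd_le (hcd : c < d) {A : Set ℝ} : ∃ C : ℝ≥0,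
    ∀ u : ℕ → ℕ → ℝ → ℝ → ℂ, IsJet ⊤ u → ∀ l,
      sqInt₂ A (Set.Ioo c d) (u l 1) ≤
        C * (sqInt₂ A (Set.Ioo c d) (u l 0) + sqInt₂ A (Set.Ioo c d) (u l 2)) := by
  obtain ⟨C, hC⟩ := exists_sqInt_remJet_le hcd
  refine ⟨C, fun u hu l => ?_⟩
  rw [sqInt₂_swap (hu.meas l 0), sqInt₂_swap (hu.meas l 1), sqInt₂_swap (hu.meas l 2)]
  have hm : Measurable fun x => sqInt (Set.Ioo c d) fun y => u l 0 x y :=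
    measurable_sqInt ((hu.meas l 0).comp measurable_swap)
  unfold sqInt₂
  rw [← lintegral_add_left hm, ← lintegral_const_mul' _ _ (by simp)]
  exact lintegral_mono fun x => (hC (fun m y => u l m x y)
    fun m y => hu.dy l m (WithTop.coe_lt_top _) x y).2.2.2

theorem exists_sqInt₂_rectExt_le_self (hab : a < b) (hcd : c < d) (hχ : IsCutoff a b χ)
    (hψ : IsCutoff c d ψ) (i j : ℕ) : ∃ C : ℝ≥0, ∀ u : ℕ → ℕ → ℝ → ℝ → ℂ, IsJet ⊤ u →
      (∀ j, ∃ B : ℝ, ∀ x y, ‖u 0 j x y‖ ≤ B) →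
      sqInt₂ Set.univ Set.univ (rectExt a b c d χ ψ u i j) ≤
        C * ∑ l ∈ Finset.range (i + 1), ∑ m ∈ Finset.range (j + 1),
          sqInt₂ (Set.Ioo a b) (Set.Ioo c d) (u l m) := by
  obtain ⟨C₁, h₁⟩ := exists_sqInt₂_rectExt_le_rem hcd hχ hψ i j
  obtain ⟨C₂, h₂⟩ := exists_sqInt₂_remJet_le hab (Set.Ioo c d)
  refine ⟨C₁ * C₂, fun u hu hB => (h₁ u hu hB).trans ?_⟩
  rw [ENNReal.coe_mul, mul_assoc]
  gcongr
  rw [Finset.mul_sum]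
  gcongr with l _
  rw [Finset.mul_sum]
  exact Finset.sum_le_sum fun m _ => (h₂ u hu m).1 l

/-- The bounds of the extension by the derivatives of `u 0 0` that enter in the anisotropic norms
of `u 2 0`. -/
theorem exists_sqInt₂_rectExt_le (hab : a < b) (hcd : c < d) (hχ : IsCutoff a b χ)
    (hψ : IsCutoff c d ψ) : ∃ C : ℝ≥0, ∀ u : ℕ → ℕ → ℝ → ℝ → ℂ, IsJet ⊤ u →
      (∀ j, ∃ B : ℝ, ∀ x y, ‖u 0 j x y‖ ≤ B) →
      sqInt₂ Set.univ Set.univ (rectExt a b c d χ ψ u 2 0) ≤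
        C * sqInt₂ (Set.Ioo a b) (Set.Ioo c d) (u 2 0) ∧
      ∀ p ∈ ({(3, 0), (1, 2), (0, 2)} : Set (ℕ × ℕ)),
        sqInt₂ Set.univ Set.univ (rectExt a b c d χ ψ u p.1 p.2) ≤
          C * (sqInt₂ (Set.Ioo a b) (Set.Ioo c d) (u 2 0) +
            sqInt₂ (Set.Ioo a b) (Set.Ioo c d) (u p.1 p.2)) := by
  obtain ⟨C₁, h₁⟩ := exists_sqInt₂_rectExt_le_rem hcd hχ hψ 2 0
  obtain ⟨C₂, h₂⟩ := exists_sqInt₂_rectExt_le_rem hcd hχ hψ 3 0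
  obtain ⟨C₃, h₃⟩ := exists_sqInt₂_rectExt_le_rem hcd hχ hψ 1 2
  obtain ⟨C₄, h₄⟩ := exists_sqInt₂_rectExt_le_rem hcd hχ hψ 0 2
  obtain ⟨K, hK⟩ := exists_sqInt₂_remJet_le hab (Set.Ioo c d)
  obtain ⟨M, hM⟩ := exists_sqInt₂_deriv_snd_le hcd (A := Set.Ioo a b)
  have key {c₁ c₂ : ℝ≥0} {S X Y : ℝ≥0∞} (h : S ≤ c₁ * X) (hX : X ≤ c₂ * Y) {D : ℝ≥0}
      (hD : c₁ * c₂ ≤ D) : S ≤ D * Y := by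
    calc S ≤ c₁ * (c₂ * Y) := h.trans (by gcongr)
      _ = (c₁ * c₂ : ℝ≥0) * Y := by rw [ENNReal.coe_mul, mul_assoc]
      _ ≤ _ := by gcongr
  set D₁ : ℝ≥0 := 3 * K
  set D₂ : ℝ≥0 := 2 * (1 + M) * K
  refine ⟨C₁ * D₁ + C₂ * D₁ + C₃ * D₂ + C₄ * D₂, fun u hu hB => ?_⟩
  set A := Set.Ioo a b
  set B := Set.Ioo c d
  have hw := isJet_remJet a b hu hB
  set w : ℕ → ℕ → ℝ → ℝ → ℂ := fun l m x y => remJet a b (fun l x => u l m x y) l x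
  have hw0 := (hK u hu 0).2.2 0 (by simp)
  have hw1 := (hK u hu 0).2.2 1 (by simp)
  have hw2 := (hK u hu 0).1 2
  have hw3 := (hK u hu 0).1 3
  have hy0 : sqInt₂ A B (w 0 1) ≤ M * (sqInt₂ A B (w 0 0) + sqInt₂ A B (w 0 2)) := hM w hw 0
  have hy1 : sqInt₂ A B (w 1 1) ≤ M * (sqInt₂ A B (w 1 0) + sqInt₂ A B (w 1 2)) := hM w hw 1
  have hE {e E : ℝ≥0} (F : ℝ≥0) (h : e + F = E) : e ≤ E := h ▸ le_self_add
  refine ⟨key (h₁ u hu hB) (c₂ := D₁) ?_ (hE (C₂ * D₁ + C₃ * D₂ + C₄ * D₂) (by ring)), ?_⟩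
  · simp only [Finset.sum_range_succ, Finset.sum_range_zero, zero_add]
    refine (add_le_add (add_le_add hw0 hw1) hw2).trans_eq ?_
    simp only [D₁]
    push_cast
    ring
  rintro p (rfl | rfl | rfl)
  · refine key (h₂ u hu hB) (c₂ := D₁) ?_ (hE (C₁ * D₁ + C₃ * D₂ + C₄ * D₂) (by ring))
    simp only [Finset.sum_range_succ, Finset.sum_range_zero, zero_add]
    refine (add_le_add (add_le_add (add_le_add hw0 hw1) hw2) hw3).trans ?_
    simp only [D₁]
    push_cast
    calc _ ≤ _ := le_self_add (b := 2 * K * sqInt₂ A B (u 3 0))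
      _ = _ := by ring
  · have h02 := (hK u hu 2).2.1 0 (by simp)
    have h12 := (hK u hu 2).2.1 1 (by simp)
    refine key (h₃ u hu hB) (c₂ := D₂) ?_ (hE (C₁ * D₁ + C₂ * D₁ + C₄ * D₂) (by ring))
    simp only [Finset.sum_range_succ, Finset.sum_range_zero, zero_add]
    refine (add_le_add (add_le_add (add_le_add hw0 hy0) h02)
      (add_le_add (add_le_add hw1 hy1) h12)).trans ?_
    calc _ ≤ (K : ℝ≥0∞) * sqInt₂ A B (u 2 0) +
          M * (K * sqInt₂ A B (u 2 0) + K * sqInt₂ A B (u 1 2)) + K * sqInt₂ A B (u 1 2) +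
          (K * sqInt₂ A B (u 2 0) +
          M * (K * sqInt₂ A B (u 2 0) + K * sqInt₂ A B (u 1 2)) + K * sqInt₂ A B (u 1 2)) := by
          gcongr
      _ = _ := by
          simp only [D₂]
          push_cast
          ring
  · have h02 := (hK u hu 2).1 0
    refine key (h₄ u hu hB) (c₂ := D₂) ?_ (hE (C₁ * D₁ + C₂ * D₁ + C₃ * D₂) (by ring))
    simp only [Finset.sum_range_succ, Finset.sum_range_zero, zero_add]
    refine (add_le_add (add_le_add hw0 hy0) h02).trans ?_
    calc _ ≤ (K : ℝ≥0∞) * sqInt₂ A B (u 2 0) +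
          M * (K * sqInt₂ A B (u 2 0) + K * sqInt₂ A B (u 0 2)) + K * sqInt₂ A B (u 0 2) := by
          gcongr
      _ ≤ _ := le_self_add (b := (K : ℝ≥0∞) * sqInt₂ A B (u 2 0) +
          M * (K * sqInt₂ A B (u 2 0) + K * sqInt₂ A B (u 0 2)) + K * sqInt₂ A B (u 0 2))
      _ = _ := by
          simp only [D₂]
          push_cast
          ring

end

/-! ### Functions on the plane in coordinates -/

theorem lintegral_plane {F : Plane → ℝ≥0∞} (hF : Measurable F) :
    ∫⁻ p, F p = ∫⁻ y, ∫⁻ x, F !₂[x, y] := by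
  have h1 := (PiLp.volume_preserving_toLp (Fin 2)).lintegral_comp hF
  have h2 := ((volume_preserving_finTwoArrow ℝ).symm _).lintegral_comp
    (hF.comp (PiLp.volume_preserving_toLp (Fin 2)).measurable)
  rw [← h1]
  refine h2.symm.trans ?_
  have hm : Measurable fun q : ℝ × ℝ => F !₂[q.1, q.2] :=
    (hF.comp (PiLp.volume_preserving_toLp (Fin 2)).measurable).comp
      (MeasurableEquiv.finTwoArrow (α := ℝ)).symm.measurable
  exact lintegral_prod_symm _ hm.aemeasurable

theorem measurable_planeMk : Measurable fun q : ℝ × ℝ => (!₂[q.1, q.2] : Plane) :=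
  (PiLp.volume_preserving_toLp (Fin 2)).measurable.comp
    (MeasurableEquiv.finTwoArrow (α := ℝ)).symm.measurable

theorem measurable_coord (i : Fin 2) : Measurable fun p : Plane => p i := by fun_prop

theorem measurableSet_openRect (a b c d : ℝ) : MeasurableSet (openRect a b c d) :=
  (measurableSet_Ioo.preimage (measurable_coord 0)).inter
    (measurableSet_Ioo.preimage (measurable_coord 1))

theorem setLIntegral_openRect {a b c d : ℝ} {F : Plane → ℝ≥0∞} (hF : Measurable F) :
    ∫⁻ p in openRect a b c d, F p = ∫⁻ y in Set.Ioo c d, ∫⁻ x in Set.Ioo a b, F !₂[x, y] := by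
  rw [← lintegral_indicator (measurableSet_openRect a b c d),
    lintegral_plane (hF.indicator (measurableSet_openRect a b c d)),
    ← lintegral_indicator measurableSet_Ioo]
  refine lintegral_congr fun y => ?_
  by_cases hy : y ∈ Set.Ioo c d
  · rw [Set.indicator_of_mem hy, ← lintegral_indicator measurableSet_Ioo]
    refine lintegral_congr fun x => ?_
    by_cases hx : x ∈ Set.Ioo a b
    · rw [Set.indicator_of_mem hx, Set.indicator_of_mem]
      exact ⟨hx, hy⟩
    · rw [Set.indicator_of_notMem hx, Set.indicator_of_notMem]
      exact fun h => hx h.1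
  · rw [Set.indicator_of_notMem hy]
    refine (lintegral_congr fun x => ?_).trans lintegral_zero
    exact Set.indicator_of_notMem (fun h => hy h.2) _

/-- A function of two real variables as a function on the plane. -/
def onPlane (u : ℝ → ℝ → ℂ) (p : Plane) : ℂ := u (p 0) (p 1)

theorem measurable_onPlane {u : ℝ → ℝ → ℂ} (hu : Measurable fun q : ℝ × ℝ => u q.1 q.2) :
    Measurable (onPlane u) :=
  hu.comp ((measurable_coord 0).prodMk (measurable_coord 1))

theorem lintegral_onPlane {u : ℝ → ℝ → ℂ} (hu : Measurable fun q : ℝ × ℝ => u q.1 q.2) :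
    ∫⁻ p, ‖onPlane u p‖ₑ ^ 2 = sqInt₂ Set.univ Set.univ u := by
  have := measurable_onPlane hu
  rw [lintegral_plane (by fun_prop)]
  simp [sqInt₂, sqInt, onPlane]

theorem setLIntegral_onPlane {a b c d : ℝ} {u : ℝ → ℝ → ℂ}
    (hu : Measurable fun q : ℝ × ℝ => u q.1 q.2) :
    ∫⁻ p in openRect a b c d, ‖onPlane u p‖ₑ ^ 2 = sqInt₂ (Set.Ioo a b) (Set.Ioo c d) u := by
  have := measurable_onPlane hu
  rw [setLIntegral_openRect (by fun_prop)]
  simp [sqInt₂, sqInt, onPlane]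

theorem hasLineDerivAt_onPlane_fst {u u' : ℝ → ℝ → ℂ}
    (h : ∀ x y, HasDerivAt (fun x => u x y) (u' x y) x) (p : Plane) :
    HasLineDerivAt ℝ (onPlane u) (onPlane u' p) p (Plane.axis 0) := by
  have h1 : HasDerivAt (fun t : ℝ => p 0 + t) 1 0 := by
    simpa using (hasDerivAt_id (0 : ℝ)).const_add (p 0)
  have h2 : HasDerivAt (fun x => u x (p 1)) (u' (p 0) (p 1)) (p 0 + 0) := by
    rw [add_zero]
    exact h _ _
  have h3 := h2.scomp (0 : ℝ) h1
  rw [one_smul] at h3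
  refine h3.congr_of_eventuallyEq (.of_forall fun t => ?_)
  simp [onPlane]

theorem hasLineDerivAt_onPlane_snd {u u' : ℝ → ℝ → ℂ}
    (h : ∀ x y, HasDerivAt (fun y => u x y) (u' x y) y) (p : Plane) :
    HasLineDerivAt ℝ (onPlane u) (onPlane u' p) p (Plane.axis 1) := by
  have h1 : HasDerivAt (fun t : ℝ => p 1 + t) 1 0 := by
    simpa using (hasDerivAt_id (0 : ℝ)).const_add (p 1)
  have h2 : HasDerivAt (fun y => u (p 0) y) (u' (p 0) (p 1)) (p 1 + 0) := by
    rw [add_zero]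
    exact h _ _
  have h3 := h2.scomp (0 : ℝ) h1
  rw [one_smul] at h3
  refine h3.congr_of_eventuallyEq (.of_forall fun t => ?_)
  simp [onPlane]

/-! ### Square integrals and `L²` -/

theorem eLpNorm_two_sq {α : Type*} [MeasurableSpace α] (f : α → ℂ) (ν : Measure α) :
    eLpNorm f 2 ν ^ 2 = ∫⁻ x, ‖f x‖ₑ ^ 2 ∂ν := by
  have h := eLpNorm_nnreal_pow_eq_lintegral (f := f) (μ := ν) (p := 2) (by norm_num)
  simpa using h

theorem enorm_sq_eq_lintegral {α : Type*} [MeasurableSpace α] {ν : Measure α}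
    (f : Lp ℂ 2 ν) : ‖f‖ₑ ^ 2 = ∫⁻ x, ‖f x‖ₑ ^ 2 ∂ν := by
  rw [Lp.enorm_def, eLpNorm_two_sq]

theorem memLp_two_iff {α : Type*} [MeasurableSpace α] {ν : Measure α} {f : α → ℂ}
    (hf : AEStronglyMeasurable f ν) : MemLp f 2 ν ↔ ∫⁻ x, ‖f x‖ₑ ^ 2 ∂ν < ∞ := by
  rw [← eLpNorm_two_sq]
  simp [MemLp, hf]

theorem enorm_restrictL2_sq (Ω : Set Plane) (f : PlaneL2) :
    ‖restrictL2 Ω f‖ₑ ^ 2 = ∫⁻ p in Ω, ‖f p‖ₑ ^ 2 := by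
  rw [enorm_sq_eq_lintegral]
  refine lintegral_congr_ae ?_
  filter_upwards [LpToLpRestrictCLM_coeFn ℂ Ω f] with p hp
  simp only [restrictL2]
  rw [hp]

theorem restrictL2_surjective {Ω : Set Plane} (hΩ : MeasurableSet Ω) :
    Function.Surjective (restrictL2 Ω) := by
  intro f
  have h : MemLp (Ω.indicator f) 2 (volume : Measure Plane) :=
    (memLp_indicator_iff_restrict hΩ).2 (Lp.memLp f)
  refine ⟨h.toLp, Lp.ext ?_⟩
  filter_upwards [LpToLpRestrictCLM_coeFn ℂ Ω h.toLp, ae_restrict_of_ae h.coeFn_toLp,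
    ae_restrict_mem hΩ] with p h1 h2 h3
  simp only [restrictL2]
  rw [h1, h2, Set.indicator_of_mem h3]

/-! ### Jets of Schwartz functions -/

theorem fourier_lineDerivOp_axis (i : Fin 2) (f : 𝓢(Plane, ℂ)) (p : Plane) :
    (𝓕 (∂_{Plane.axis i} f) : 𝓢(Plane, ℂ)) p =
      2 * Real.pi * I * (p i : ℂ) * (𝓕 f : 𝓢(Plane, ℂ)) p := by
  have htemp : Function.HasTemperateGrowth (fun x : Plane => inner ℝ x (Plane.axis i)) := by
    fun_prop
  rw [SchwartzMap.fourier_lineDerivOp_eq, smul_apply, SchwartzMap.smulLeftCLM_apply_apply htemp,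
    EuclideanSpace.inner_single_right, smul_eq_mul, real_smul]
  simp
  ring

/-- On the Fourier side the two derivatives are multiplications, which commute. -/
theorem lineDerivOp_axis_comm (i j : Fin 2) (f : 𝓢(Plane, ℂ)) :
    ∂_{Plane.axis i} (∂_{Plane.axis j} f) = ∂_{Plane.axis j} (∂_{Plane.axis i} f) := by
  have h : (𝓕 (∂_{Plane.axis i} (∂_{Plane.axis j} f)) : 𝓢(Plane, ℂ)) =
      𝓕 (∂_{Plane.axis j} (∂_{Plane.axis i} f)) := by
    ext p
    simp only [fourier_lineDerivOp_axis]
    ring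
  have h2 := congrArg (fun g : 𝓢(Plane, ℂ) => (𝓕⁻ g : 𝓢(Plane, ℂ))) h
  simpa using h2

/-- The partial derivative of order `i` in the first and of order `j` in the second variable. -/
noncomputable def partialS (i j : ℕ) (f : 𝓢(Plane, ℂ)) : 𝓢(Plane, ℂ) :=
  (fun g : 𝓢(Plane, ℂ) => ∂_{Plane.axis 0} g)^[i]
    ((fun g : 𝓢(Plane, ℂ) => ∂_{Plane.axis 1} g)^[j] f)

theorem partialS_succ_fst (i j : ℕ) (f : 𝓢(Plane, ℂ)) :
    partialS (i + 1) j f = ∂_{Plane.axis 0} (partialS i j f) := by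
  simp only [partialS, Function.iterate_succ_apply']

theorem partialS_succ_snd (i j : ℕ) (f : 𝓢(Plane, ℂ)) :
    partialS i (j + 1) f = ∂_{Plane.axis 1} (partialS i j f) := by
  have hc : Function.Commute (fun g : 𝓢(Plane, ℂ) => (∂_{Plane.axis 0} g : 𝓢(Plane, ℂ)))
      (fun g : 𝓢(Plane, ℂ) => ∂_{Plane.axis 1} g) := fun g => lineDerivOp_axis_comm 0 1 g
  simp only [partialS, Function.iterate_succ_apply']
  exact (hc.iterate_left i).eq _

theorem partialS_add (i j : ℕ) (f g : 𝓢(Plane, ℂ)) :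
    partialS i j (f + g) = partialS i j f + partialS i j g := by
  induction i with
  | zero =>
    induction j with
    | zero => rfl
    | succ j ih => simp only [partialS_succ_snd, ih, LineDeriv.lineDerivOp_add]
  | succ i ih => simp only [partialS_succ_fst, ih, LineDeriv.lineDerivOp_add]

theorem partialS_smul (i j : ℕ) (r : ℂ) (f : 𝓢(Plane, ℂ)) :
    partialS i j (r • f) = r • partialS i j f := by
  induction i with
  | zero =>
    induction j with
    | zero => rfl
    | succ j ih => simp only [partialS_succ_snd, ih, LineDeriv.lineDerivOp_smul]
  | succ i ih => simp only [partialS_succ_fst, ih, LineDeriv.lineDerivOp_smul]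

/-- The jet of a Schwartz function, in coordinates. -/
noncomputable def jetS (f : 𝓢(Plane, ℂ)) (i j : ℕ) (x y : ℝ) : ℂ := partialS i j f !₂[x, y]

theorem onPlane_jetS (f : 𝓢(Plane, ℂ)) (i j : ℕ) : onPlane (jetS f i j) = partialS i j f := by
  funext p
  simp only [onPlane, jetS]
  congr 1
  ext k
  fin_cases k <;> rfl

theorem planeMk_eq (x y : ℝ) : (!₂[x, y] : Plane) = x • Plane.axis 0 + y • Plane.axis 1 := by
  ext k
  fin_cases k <;> simp

theorem isJet_jetS (f : 𝓢(Plane, ℂ)) : IsJet ⊤ (jetS f) where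
  dx i j x y := by
    have h1 : HasDerivAt (fun x : ℝ => (!₂[x, y] : Plane)) (Plane.axis 0) x := by
      simpa [planeMk_eq] using ((hasDerivAt_id x).smul_const (Plane.axis 0)).add_const
        (y • Plane.axis 1)
    have h2 := ((partialS i j f).hasFDerivAt !₂[x, y]).comp_hasDerivAt x h1
    rw [← SchwartzMap.lineDerivOp_apply_eq_fderiv, ← partialS_succ_fst] at h2
    exact h2
  dy i j _ x y := by
    have h1 : HasDerivAt (fun y : ℝ => (!₂[x, y] : Plane)) (Plane.axis 1) y := by
      simpa [planeMk_eq] using ((hasDerivAt_id y).smul_const (Plane.axis 1)).const_add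
        (x • Plane.axis 0)
    have h2 := ((partialS i j f).hasFDerivAt !₂[x, y]).comp_hasDerivAt y h1
    rw [← SchwartzMap.lineDerivOp_apply_eq_fderiv, ← partialS_succ_snd] at h2
    exact h2
  meas i j := (partialS i j f).continuous.measurable.comp measurable_planeMk

theorem exists_bound_jetS (f : 𝓢(Plane, ℂ)) (i j : ℕ) : ∃ B : ℝ, ∀ x y, ‖jetS f i j x y‖ ≤ B := by
  obtain ⟨B, hB⟩ := (partialS i j f).decay 0 0
  exact ⟨B, fun x y => by simpa [jetS] using hB.2 !₂[x, y]⟩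

theorem memLp_onPlane_jetS (f : 𝓢(Plane, ℂ)) (i j : ℕ) :
    MemLp (onPlane (jetS f i j)) 2 volume := by
  rw [onPlane_jetS]
  exact (partialS i j f).memLp 2 volume

theorem sqInt₂_jetS_lt_top (f : 𝓢(Plane, ℂ)) (i j : ℕ) (A B : Set ℝ) :
    sqInt₂ A B (jetS f i j) < ∞ := by
  have h := (memLp_two_iff (memLp_onPlane_jetS f i j).1).1 (memLp_onPlane_jetS f i j)
  rw [lintegral_onPlane ((isJet_jetS f).meas i j)] at h
  refine lt_of_le_of_lt ?_ h
  refine (lintegral_mono fun y => ?_).trans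
    (lintegral_mono_set (μ := volume) (Set.subset_univ B))
  exact lintegral_mono_set (Set.subset_univ A)

/-! ### Weighted norms on the Fourier side -/

/-- The weight `1 + ∑ k, |m k|²` of the norm of `MultSpace m`. -/
noncomputable def symbolWeight (m : Fin 3 → Plane → ℂ) (p : Plane) : ℝ≥0∞ :=
  1 + ∑ k, ‖m k p‖ₑ ^ 2

/-- The weighted square integral of the Fourier transform. -/
noncomputable def fourierEnergy (W : Plane → ℝ≥0∞) (f : PlaneL2) : ℝ≥0∞ :=
  ∫⁻ p, W p * ‖(𝓕 f : PlaneL2) p‖ₑ ^ 2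

/-- The symbol `2πi p_i` of the derivative along the `i`-th axis. -/
noncomputable def axisSymbol (i : Fin 2) (p : Plane) : ℂ := 2 * Real.pi * I * (p i : ℂ)

theorem continuous_axisSymbol (i : Fin 2) : Continuous (axisSymbol i) := by
  unfold axisSymbol
  fun_prop

theorem axisSymbol_ne_zero {i : Fin 2} {p : Plane} (h : p i ≠ 0) : axisSymbol i p ≠ 0 := by
  simp [axisSymbol, h, Real.pi_ne_zero]

theorem ae_coord_ne_zero : ∀ᵐ p : Plane, p 0 ≠ 0 := by
  have hm : MeasurableSet {p : Plane | p 0 = 0} := measurable_coord 0 (measurableSet_singleton 0)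
  rw [ae_iff]
  simp only [not_not]
  rw [← lintegral_indicator_one hm, lintegral_plane (measurable_one.indicator hm)]
  refine (lintegral_congr fun y => ?_).trans lintegral_zero
  have : (fun x : ℝ => ({p : Plane | p 0 = 0}.indicator 1 !₂[x, y] : ℝ≥0∞)) =
      ({0} : Set ℝ).indicator 1 := by
    funext x
    by_cases hx : x = 0
    · rw [Set.indicator_of_mem (by simpa using hx), Set.indicator_of_mem (by simpa using hx)]
      simp
    · rw [Set.indicator_of_notMem (by simpa using hx), Set.indicator_of_notMem (by simpa using hx)]
  rw [this, lintegral_indicator_one (measurableSet_singleton _)]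
  simp

theorem fourier_sub_coeFn (f g : PlaneL2) :
    (𝓕 (f - g) : PlaneL2) =ᵐ[volume] fun p => (𝓕 f : PlaneL2) p - (𝓕 g : PlaneL2) p := by
  have h : (𝓕 (f - g) : PlaneL2) = 𝓕 f - 𝓕 g := (Lp.fourierTransformₗᵢ Plane ℂ).map_sub f g
  rw [h]
  exact Lp.coeFn_sub _ _

theorem enorm_fourier (f : PlaneL2) : ‖(𝓕 f : PlaneL2)‖ₑ = ‖f‖ₑ := by
  rw [← ofReal_norm, Lp.norm_fourier_eq, ofReal_norm]

theorem fourierEnergy_one (f : PlaneL2) : fourierEnergy (fun _ => 1) f = ‖f‖ₑ ^ 2 := by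
  rw [← enorm_fourier, enorm_sq_eq_lintegral]
  simp [fourierEnergy]

theorem fourier_partialS (f : 𝓢(Plane, ℂ)) (i j : ℕ) :
    (𝓕 ((partialS i j f).toLp 2 volume) : PlaneL2) =ᵐ[volume]
      fun p => axisSymbol 0 p ^ i * axisSymbol 1 p ^ j * (𝓕 f : 𝓢(Plane, ℂ)) p := by
  rw [SchwartzMap.toLp_fourier_eq]
  have h : ∀ p, (𝓕 (partialS i j f) : 𝓢(Plane, ℂ)) p =
      axisSymbol 0 p ^ i * axisSymbol 1 p ^ j * (𝓕 f : 𝓢(Plane, ℂ)) p := by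
    intro p
    induction i with
    | zero =>
      induction j with
      | zero => simp [partialS]
      | succ j ih =>
        rw [partialS_succ_snd, fourier_lineDerivOp_axis, ih, axisSymbol, axisSymbol]
        ring
    | succ i ih =>
      rw [partialS_succ_fst, fourier_lineDerivOp_axis, ih, axisSymbol, axisSymbol]
      ring
  filter_upwards [(𝓕 (partialS i j f) : 𝓢(Plane, ℂ)).coeFn_toLp 2 volume] with p hp
  rw [hp, h]

/-- Second derivatives in `x` of Schwartz functions are dense in the weighted spaces, as soon as the
weight becomes continuous after multiplication by `|2πξ|⁴`: on the Fourier side this is the density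
of smooth compactly supported functions in the `L²` space of a locally finite measure. -/
theorem exists_schwartz_fourierEnergy_sub_le {W : Plane → ℝ≥0∞} {ρ : Plane → ℝ≥0}
    (hρ : Continuous ρ) (h : ∀ p : Plane, p 0 ≠ 0 → (ρ p : ℝ≥0∞) = W p * ‖axisSymbol 0 p‖ₑ ^ 4)
    {g : PlaneL2} (hg : fourierEnergy W g < ∞) {δ : ℝ} (hδ : 0 < δ) :
    ∃ f : 𝓢(Plane, ℂ),
      fourierEnergy W ((partialS 2 0 f).toLp 2 volume - g) ≤ ENNReal.ofReal δ := by
  set ν : Measure Plane := volume.withDensity fun p => (ρ p : ℝ≥0∞) with hν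
  have : IsLocallyFiniteMeasure ν := IsLocallyFiniteMeasure.withDensity_coe hρ
  have hρm : Measurable fun p => (ρ p : ℝ≥0∞) := by fun_prop
  set φ : Plane → ℂ := fun p => (𝓕 g : PlaneL2) p / axisSymbol 0 p ^ 2 with hφ
  have hφm : Measurable φ := (Lp.stronglyMeasurable _).measurable.div
    ((continuous_axisSymbol 0).measurable.pow_const 2)
  have hA : ∀ p : Plane, p 0 ≠ 0 → ∀ z : ℂ,
      (ρ p : ℝ≥0∞) * ‖z / axisSymbol 0 p ^ 2‖ₑ ^ 2 = W p * ‖z‖ₑ ^ 2 := by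
    intro p hp z
    have h1 : ‖z‖ₑ ^ 2 = ‖axisSymbol 0 p‖ₑ ^ 4 * ‖z / axisSymbol 0 p ^ 2‖ₑ ^ 2 := by
      have h2 : z = axisSymbol 0 p ^ 2 * (z / axisSymbol 0 p ^ 2) := by
        field_simp [axisSymbol_ne_zero hp]
      conv_lhs => rw [h2]
      rw [enorm_mul, enorm_pow]
      ring
    rw [h p hp, h1, mul_assoc]
  have hφL : MemLp φ 2 ν := by
    rw [memLp_two_iff hφm.aestronglyMeasurable, hν,
      lintegral_withDensity_eq_lintegral_mul _ hρm (by fun_prop)]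
    refine lt_of_le_of_lt (lintegral_mono_ae ?_) hg
    filter_upwards [ae_coord_ne_zero] with p hp
    exact (hA p hp _).le
  obtain ⟨θ, hθc, hθ, hle⟩ := hφL.exist_eLpNorm_sub_le (by norm_num) (by norm_num)
    (Real.sqrt_pos.2 hδ)
  obtain ⟨T, hT⟩ : ∃ T : 𝓢(Plane, ℂ), ∀ p, T p = θ p := ⟨hθc.toSchwartzMap hθ, fun p => rfl⟩
  refine ⟨𝓕⁻ T, ?_⟩
  have h3 := fourier_partialS (𝓕⁻ T) 2 0
  rw [FourierTransform.fourier_fourierInv_eq] at h3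
  calc fourierEnergy W ((partialS 2 0 (𝓕⁻ T)).toLp 2 volume - g)
      = ∫⁻ p, (ρ p : ℝ≥0∞) * ‖(φ - θ) p‖ₑ ^ 2 := by
        refine lintegral_congr_ae ?_
        filter_upwards [fourier_sub_coeFn ((partialS 2 0 (𝓕⁻ T)).toLp 2 volume) g, h3,
          ae_coord_ne_zero] with p h4 h5 hp
        rw [h4, h5, ← hA p hp, pow_zero, mul_one, sub_div,
          mul_div_cancel_left₀ _ (pow_ne_zero 2 (axisSymbol_ne_zero hp)), hT, Pi.sub_apply,
          ← enorm_neg, neg_sub]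
    _ = eLpNorm (φ - θ) 2 ν ^ 2 := by
        have := hθ.continuous.measurable
        rw [eLpNorm_two_sq, hν, lintegral_withDensity_eq_lintegral_mul _ hρm (by fun_prop)]
        rfl
    _ ≤ ENNReal.ofReal (Real.sqrt δ) ^ 2 := by gcongr
    _ = ENNReal.ofReal δ := by
        rw [← ENNReal.ofReal_pow (Real.sqrt_nonneg _), Real.sq_sqrt hδ.le]

theorem fourierEnergy_add_le (W : Plane → ℝ≥0∞) (hW : Measurable W) (f g : PlaneL2) :
    fourierEnergy W (f + g) ≤ 2 * (fourierEnergy W f + fourierEnergy W g) := by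
  have h : (𝓕 (f + g) : PlaneL2) = 𝓕 f + 𝓕 g := (Lp.fourierTransformₗᵢ Plane ℂ).map_add f g
  have hm (f : PlaneL2) : Measurable fun p => ‖(𝓕 f : PlaneL2) p‖ₑ ^ 2 :=
    (Lp.stronglyMeasurable _).measurable.enorm.pow_const 2
  have hWm : Measurable fun p => W p * ‖(𝓕 f : PlaneL2) p‖ₑ ^ 2 := hW.mul (hm f)
  unfold fourierEnergy
  rw [← lintegral_add_left hWm, ← lintegral_const_mul' _ _ (by norm_num), h]
  refine lintegral_mono_ae ?_
  filter_upwards [Lp.coeFn_add (𝓕 f : PlaneL2) (𝓕 g)] with p hp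
  rw [hp, Pi.add_apply, ← mul_add, mul_left_comm]
  gcongr
  refine le_trans ?_ (ENNReal.add_sq_le_two_mul _ _)
  gcongr
  exact enorm_add_le _ _

/-- Weighted Fourier norms are lower semicontinuous for convergence in `L²`. -/
theorem fourierEnergy_le_of_tendsto {W : Plane → ℝ≥0∞} (hW : Measurable W)
    (hWfin : ∀ p, W p ≠ ∞) {F : ℕ → PlaneL2}
    {f : PlaneL2} (hF : Filter.Tendsto F Filter.atTop (𝓝 f)) {K : ℝ≥0∞}
    (hK : ∀ n, fourierEnergy W (F n) ≤ K) : fourierEnergy W f ≤ K := by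
  have h1 : Filter.Tendsto (fun n => (𝓕 (F n) : PlaneL2)) Filter.atTop (𝓝 (𝓕 f)) :=
    ((Lp.fourierTransformₗᵢ Plane ℂ).continuous.tendsto f).comp hF
  obtain ⟨ns, -, hns⟩ := (tendstoInMeasure_of_tendsto_Lp h1).exists_seq_tendsto_ae
  have hm (f : PlaneL2) : Measurable fun p => ‖(𝓕 f : PlaneL2) p‖ₑ ^ 2 :=
    (Lp.stronglyMeasurable _).measurable.enorm.pow_const 2
  calc fourierEnergy W f ≤ ∫⁻ p, Filter.liminf
        (fun n => W p * ‖(𝓕 (F (ns n)) : PlaneL2) p‖ₑ ^ 2) Filter.atTop := by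
        refine lintegral_mono_ae ?_
        filter_upwards [hns] with p hp
        exact (ENNReal.Tendsto.const_mul
          (ENNReal.Tendsto.pow (continuous_enorm.continuousAt.tendsto.comp hp))
          (Or.inr (hWfin p))).liminf_eq.ge
    _ ≤ Filter.liminf (fun n => fourierEnergy W (F (ns n))) Filter.atTop :=
        lintegral_liminf_le fun n => hW.mul (hm _)
    _ ≤ K := Filter.liminf_le_of_le (by isBoundedDefault) fun b hb => by
        obtain ⟨n, hn⟩ := hb.exists
        exact hn.trans (hK _)

/-! ### The extension operator -/

theorem measurable_zeroSymbol (lam mu : ℝ) (k : Fin 3) : Measurable (zeroSymbol lam mu k) := by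
  fin_cases k <;> simp [zeroSymbol] <;> fun_prop

theorem measurable_symbolWeight {m : Fin 3 → Plane → ℂ} (hm : ∀ k, Measurable (m k)) :
    Measurable (symbolWeight m) := by
  unfold symbolWeight
  fun_prop

theorem symbolWeight_ne_top (m : Fin 3 → Plane → ℂ) (p : Plane) : symbolWeight m p ≠ ∞ := by
  simp [symbolWeight, Fin.sum_univ_three]

theorem zeroSymbol_eq (lam mu : ℝ) (p : Plane) :
    zeroSymbol lam mu 0 p = axisSymbol 0 p ∧
    zeroSymbol lam mu 1 p = Real.sqrt lam * (axisSymbol 0 p)⁻¹ * axisSymbol 1 p ^ 2 ∧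
    zeroSymbol lam mu 2 p = Real.sqrt mu * (axisSymbol 0 p ^ 2)⁻¹ * axisSymbol 1 p ^ 2 :=
  ⟨rfl, rfl, rfl⟩

theorem enorm_sqrt_sq {r : ℝ} (hr : 0 ≤ r) : ‖(Real.sqrt r : ℂ)‖ₑ ^ 2 = ENNReal.ofReal r := by
  rw [← ofReal_norm, norm_real, Real.norm_of_nonneg (Real.sqrt_nonneg _),
    ← ENNReal.ofReal_pow (Real.sqrt_nonneg _), Real.sq_sqrt hr]

/-- `zeroSymbol` becomes polynomial after multiplication by the symbol of `∂_x²`. -/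
theorem exists_continuous_density {lam mu : ℝ} (hlam : 0 ≤ lam) (hmu : 0 ≤ mu) :
    ∃ ρ : Plane → ℝ≥0, Continuous ρ ∧ ∀ p : Plane, p 0 ≠ 0 → (ρ p : ℝ≥0∞) =
      symbolWeight (zeroSymbol lam mu) p * ‖axisSymbol 0 p‖ₑ ^ 4 := by
  have h0 := continuous_axisSymbol 0
  have h1 := continuous_axisSymbol 1
  refine ⟨fun p => ‖axisSymbol 0 p‖₊ ^ 4 + ‖axisSymbol 0 p‖₊ ^ 6 +
    lam.toNNReal * (‖axisSymbol 0 p‖₊ ^ 2 * ‖axisSymbol 1 p‖₊ ^ 4) +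
    mu.toNNReal * ‖axisSymbol 1 p‖₊ ^ 4, by fun_prop, fun p hp => ?_⟩
  obtain ⟨e0, e1, e2⟩ := zeroSymbol_eq lam mu p
  have hA := axisSymbol_ne_zero hp
  have f1 : ‖zeroSymbol lam mu 1 p‖ₑ ^ 2 * ‖axisSymbol 0 p‖ₑ ^ 4 =
      ENNReal.ofReal lam * (‖axisSymbol 0 p‖ₑ ^ 2 * ‖axisSymbol 1 p‖ₑ ^ 4) := by
    rw [e1, ← enorm_sqrt_sq hlam]
    simp only [← enorm_pow, ← enorm_mul]
    congr 1
    field_simp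
  have f2 : ‖zeroSymbol lam mu 2 p‖ₑ ^ 2 * ‖axisSymbol 0 p‖ₑ ^ 4 =
      ENNReal.ofReal mu * ‖axisSymbol 1 p‖ₑ ^ 4 := by
    rw [e2, ← enorm_sqrt_sq hmu]
    simp only [← enorm_pow, ← enorm_mul]
    congr 1
    field_simp
  rw [symbolWeight, Fin.sum_univ_three, add_mul, add_mul, add_mul, f1, f2, e0]
  push_cast
  simp only [← enorm_eq_nnnorm, ENNReal.ofReal]
  ring

section

variable {a b c d : ℝ} {χ ψ : ℕ → ℝ → ℂ}

theorem memLp_onPlane_rectExt (hab : a < b) (hcd : c < d) (hχ : IsCutoff a b χ)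
    (hψ : IsCutoff c d ψ) (f : 𝓢(Plane, ℂ)) (i j : ℕ) :
    MemLp (onPlane (rectExt a b c d χ ψ (jetS f) i j)) 2 volume := by
  have hm := measurable_rectExt hcd hχ hψ (isJet_jetS f) (exists_bound_jetS f 0) i j
  obtain ⟨C, hC⟩ := exists_sqInt₂_rectExt_le_self hab hcd hχ hψ i j
  rw [memLp_two_iff (measurable_onPlane hm).aestronglyMeasurable, lintegral_onPlane hm]
  refine (hC _ (isJet_jetS f) (exists_bound_jetS f 0)).trans_lt ?_
  refine ENNReal.mul_lt_top (by simp) ?_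
  simp only [ENNReal.sum_lt_top]
  exact fun l _ m _ => sqInt₂_jetS_lt_top f l m _ _

theorem remJet_add (a b : ℝ) {u v : ℕ → ℝ → ℂ} (hu : Continuous (u 0)) (hv : Continuous (v 0)) :
    remJet a b (u + v) = remJet a b u + remJet a b v := by
  have h (κ : ℝ → ℂ) (hκ : Continuous κ) : ∫ s in a..b, κ s * (u 0 + v 0) s =
      (∫ s in a..b, κ s * u 0 s) + ∫ s in a..b, κ s * v 0 s := by
    have e1 : IntervalIntegrable (fun s => κ s * u 0 s) volume a b :=
      (hκ.mul hu).intervalIntegrable _ _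
    have e2 : IntervalIntegrable (fun s => κ s * v 0 s) volume a b :=
      (hκ.mul hv).intervalIntegrable _ _
    simp only [Pi.add_apply, mul_add]
    exact intervalIntegral.integral_add e1 e2
  have h1 : meanPart a b (u 0 + v 0) = meanPart a b (u 0) + meanPart a b (v 0) :=
    h _ continuous_const
  have h2 : slopePart a b (u 0 + v 0) = slopePart a b (u 0) + slopePart a b (v 0) :=
    h _ (by fun_prop)
  funext l x
  match l with
  | 0 =>
    simp only [remJet, Pi.add_apply, h1, h2]
    ring
  | 1 =>
    simp only [remJet, Pi.add_apply, h2]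
    ring
  | l + 2 => rfl

theorem remJet_smul (a b : ℝ) (r : ℂ) (u : ℕ → ℝ → ℂ) :
    remJet a b (r • u) = r • remJet a b u := by
  have h (κ : ℝ → ℂ) : ∫ s in a..b, κ s * (r • u 0) s = r * ∫ s in a..b, κ s * u 0 s := by
    rw [← intervalIntegral.integral_const_mul]
    simp only [Pi.smul_apply, smul_eq_mul, mul_left_comm]
  have h1 : meanPart a b (r • u 0) = r * meanPart a b (u 0) := h _
  have h2 : slopePart a b (r • u 0) = r * slopePart a b (u 0) := h _
  funext l x
  match l with
  | 0 =>
    simp only [remJet, Pi.smul_apply, h1, h2, smul_eq_mul]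
    ring
  | 1 =>
    simp only [remJet, Pi.smul_apply, h2, smul_eq_mul]
    ring
  | l + 2 => rfl

theorem rectExt_jetS_add (f g : 𝓢(Plane, ℂ)) (i j : ℕ) (x y : ℝ) :
    rectExt a b c d χ ψ (jetS (f + g)) i j x y =
      rectExt a b c d χ ψ (jetS f) i j x y + rectExt a b c d χ ψ (jetS g) i j x y := by
  have hc (f : 𝓢(Plane, ℂ)) (m : ℕ) (y : ℝ) : Continuous fun x => jetS f 0 m x y :=
    continuous_iff_continuousAt.2 fun x => ((isJet_jetS f).dx 0 m x y).continuousAt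
  have h1 (m : ℕ) (y : ℝ) : (fun l x => jetS (f + g) l m x y) =
      (fun l x => jetS f l m x y) + fun l x => jetS g l m x y := by
    funext l x
    simp [jetS, partialS_add]
  have h2 (m : ℕ) (y : ℝ) := remJet_add a b (u := fun l x => jetS f l m x y)
    (v := fun l x => jetS g l m x y) (hc f m y) (hc g m y)
  have h3 (l : ℕ) (x : ℝ) := extJet_add c d ψ j 0 0
    (fun m y => remJet a b (fun l x => jetS f l m x y) l x)
    (fun m y => remJet a b (fun l x => jetS g l m x y) l x)
  unfold rectExt
  simp only [h1, h2]
  rw [← Pi.add_apply (extJet a b χ i 0 0 _), ← extJet_add]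
  congr 1
  funext l x
  exact congrFun (h3 l x) y

theorem rectExt_jetS_smul (r : ℂ) (f : 𝓢(Plane, ℂ)) (i j : ℕ) (x y : ℝ) :
    rectExt a b c d χ ψ (jetS (r • f)) i j x y = r * rectExt a b c d χ ψ (jetS f) i j x y := by
  have h1 (m : ℕ) (y : ℝ) : (fun l x => jetS (r • f) l m x y) =
      r • fun l x => jetS f l m x y := by
    funext l x
    simp [jetS, partialS_smul]
  have h3 (l : ℕ) (x : ℝ) := extJet_smul c d ψ j 0 0 r
    (fun m y => remJet a b (fun l x => jetS f l m x y) l x)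
  unfold rectExt
  simp only [h1, remJet_smul]
  rw [← smul_eq_mul, ← Pi.smul_apply r (extJet a b χ i 0 0 _), ← extJet_smul]
  congr 1
  funext l x
  exact congrFun (h3 l x) y

/-- The extension of `∂_x² f`, for Schwartz functions `f`: the second derivative in `x` of the
extension of `f` minus its affine part in `x`. -/
noncomputable def extS (hab : a < b) (hcd : c < d) (hχ : IsCutoff a b χ) (hψ : IsCutoff c d ψ) :
    𝓢(Plane, ℂ) →ₗ[ℂ] PlaneL2 where
  toFun f := (memLp_onPlane_rectExt hab hcd hχ hψ f 2 0).toLp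
  map_add' f g := by
    rw [← MemLp.toLp_add]
    exact MemLp.toLp_congr _ _ (.of_forall fun p => rectExt_jetS_add f g 2 0 _ _)
  map_smul' r f := by
    rw [RingHom.id_apply, ← MemLp.toLp_const_smul]
    exact MemLp.toLp_congr _ _ (.of_forall fun p => rectExt_jetS_smul r f 2 0 _ _)

/-- The restriction of `∂_x² f` to `Ω`, for Schwartz functions `f`. -/
noncomputable def restrictS (Ω : Set Plane) : 𝓢(Plane, ℂ) →ₗ[ℂ] RegionL2 Ω where
  toFun f := restrictL2 Ω ((partialS 2 0 f).toLp 2 volume)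
  map_add' f g := by
    rw [partialS_add, ← map_add]
    congr 1
  map_smul' r f := by
    rw [partialS_smul, RingHom.id_apply, ← map_smul]
    congr 1

/-- Restrictions of second derivatives `∂_x² f` are dense, so that the extension operator is
determined by its values on them. -/
theorem denseRange_restrictS {Ω : Set Plane} (hΩ : MeasurableSet Ω) :
    DenseRange (restrictS Ω) := by
  have h1 : DenseRange fun f : 𝓢(Plane, ℂ) => ((partialS 2 0 f).toLp 2 volume : PlaneL2) := by
    refine Metric.denseRange_iff.2 fun g ε hε => ?_
    obtain ⟨f, hf⟩ := exists_schwartz_fourierEnergy_sub_le (W := fun _ => 1)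
      (ρ := fun p => ‖axisSymbol 0 p‖₊ ^ 4) ((continuous_axisSymbol 0).nnnorm.pow 4)
      (fun p _ => by simp [enorm_eq_nnnorm]) (g := g)
      (by rw [fourierEnergy_one]; simp) (δ := (ε / 2) ^ 2) (by positivity)
    refine ⟨f, ?_⟩
    rw [fourierEnergy_one, ← ofReal_norm, ← ENNReal.ofReal_pow (norm_nonneg _),
      ENNReal.ofReal_le_ofReal_iff (by positivity)] at hf
    rw [dist_comm, dist_eq_norm]
    linarith [le_of_sq_le_sq hf (by positivity)]
  exact (restrictL2_surjective hΩ).denseRange.comp h1 (restrictL2 Ω).continuous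

theorem enorm_rectExt_jetS_sq (hab : a < b) (hcd : c < d) (hχ : IsCutoff a b χ) (hψ : IsCutoff c d ψ)
    (f : 𝓢(Plane, ℂ)) (i j : ℕ) : ‖(memLp_onPlane_rectExt hab hcd hχ hψ f i j).toLp‖ₑ ^ 2 =
      sqInt₂ Set.univ Set.univ (rectExt a b c d χ ψ (jetS f) i j) := by
  rw [Lp.enorm_toLp, eLpNorm_two_sq, lintegral_onPlane
    (measurable_rectExt hcd hχ hψ (isJet_jetS f) (exists_bound_jetS f 0) i j)]

theorem setLIntegral_partialS (f : 𝓢(Plane, ℂ)) (i j : ℕ) :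
    ∫⁻ p in openRect a b c d, ‖((partialS i j f).toLp 2 volume : PlaneL2) p‖ₑ ^ 2 =
      sqInt₂ (Set.Ioo a b) (Set.Ioo c d) (jetS f i j) := by
  rw [← setLIntegral_onPlane ((isJet_jetS f).meas i j), onPlane_jetS]
  refine lintegral_congr_ae ?_
  filter_upwards [ae_restrict_of_ae ((partialS i j f).coeFn_toLp 2 volume)] with p hp
  rw [hp]

theorem sqInt₂_jetS_le (f : 𝓢(Plane, ℂ)) (i j : ℕ) :
    sqInt₂ (Set.Ioo a b) (Set.Ioo c d) (jetS f i j) ≤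
      ‖((partialS i j f).toLp 2 volume : PlaneL2)‖ₑ ^ 2 := by
  rw [← setLIntegral_partialS, enorm_sq_eq_lintegral]
  exact setLIntegral_le_lintegral _ _

/-- The extension depends on the values of `∂_x² f` in the rectangle only, and is bounded in `L²`.
-/
theorem exists_norm_extS_le (hab : a < b) (hcd : c < d) (hχ : IsCutoff a b χ)
    (hψ : IsCutoff c d ψ) :
    ∃ C : ℝ, ∀ f, ‖extS hab hcd hχ hψ f‖ ≤ C * ‖restrictS (openRect a b c d) f‖ := by
  obtain ⟨C, hC⟩ := exists_sqInt₂_rectExt_le hab hcd hχ hψ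
  refine ⟨Real.sqrt C, fun f => ?_⟩
  have h := (hC _ (isJet_jetS f) (exists_bound_jetS f 0)).1
  rw [← enorm_rectExt_jetS_sq hab hcd hχ hψ, ← setLIntegral_partialS, ← enorm_restrictL2_sq] at h
  have h2 : ‖extS hab hcd hχ hψ f‖ ^ 2 ≤ C * ‖restrictS (openRect a b c d) f‖ ^ 2 := by
    have h3 : ‖extS hab hcd hχ hψ f‖ₑ ^ 2 ≤ C * ‖restrictS (openRect a b c d) f‖ₑ ^ 2 := h
    have h4 := ENNReal.toReal_mono (by finiteness) h3
    rwa [ENNReal.toReal_mul, ENNReal.toReal_pow, ENNReal.toReal_pow, toReal_enorm, toReal_enorm,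
      ENNReal.coe_toReal] at h4
  refine le_of_sq_le_sq ?_ (by positivity)
  rwa [mul_pow, Real.sq_sqrt C.coe_nonneg]

theorem restrictL2_extS (hab : a < b) (hcd : c < d) (hχ : IsCutoff a b χ)
    (hψ : IsCutoff c d ψ) (f : 𝓢(Plane, ℂ)) :
    restrictL2 (openRect a b c d) (extS hab hcd hχ hψ f) = restrictS (openRect a b c d) f := by
  refine Lp.ext ?_
  filter_upwards [LpToLpRestrictCLM_coeFn ℂ (openRect a b c d) (extS hab hcd hχ hψ f),
    LpToLpRestrictCLM_coeFn ℂ (openRect a b c d) ((partialS 2 0 f).toLp 2 volume),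
    ae_restrict_of_ae ((partialS 2 0 f).coeFn_toLp 2 volume),
    ae_restrict_of_ae (memLp_onPlane_rectExt hab hcd hχ hψ f 2 0).coeFn_toLp,
    ae_restrict_mem (measurableSet_openRect a b c d)] with p h1 h2 h3 h4 h5
  refine h1.trans ((h4.trans ?_).trans (h3.symm.trans h2.symm))
  rw [← onPlane_jetS]
  exact rectExt_eq_of_mem hχ hψ h5.1 h5.2 0 0

end

/-- The norm of `X⁰` of a second derivative in `x`, in terms of the jet `z i j = ∂_x^i ∂_y^j z`. -/
theorem fourierEnergy_zeroSymbol_eq {lam mu : ℝ} (hlam : 0 ≤ lam) (hmu : 0 ≤ mu)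
    {z : ℕ → ℕ → PlaneL2} {φ : Plane → ℂ}
    (h : ∀ i ≤ 3, ∀ j ≤ 2,
      (𝓕 (z i j) : PlaneL2) =ᵐ[volume] fun p => axisSymbol 0 p ^ i * axisSymbol 1 p ^ j * φ p) :
    fourierEnergy (symbolWeight (zeroSymbol lam mu)) (z 2 0) = ‖z 2 0‖ₑ ^ 2 + ‖z 3 0‖ₑ ^ 2 +
      ENNReal.ofReal lam * ‖z 1 2‖ₑ ^ 2 + ENNReal.ofReal mu * ‖z 0 2‖ₑ ^ 2 := by
  have hm (f : PlaneL2) : Measurable fun p => ‖(𝓕 f : PlaneL2) p‖ₑ ^ 2 :=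
    (Lp.stronglyMeasurable _).measurable.enorm.pow_const 2
  simp only [← enorm_fourier (z _ _), enorm_sq_eq_lintegral]
  rw [← lintegral_const_mul _ (hm _), ← lintegral_const_mul _ (hm _),
    ← lintegral_add_right _ (hm (z 3 0)), ← lintegral_add_right _ ((hm (z 1 2)).const_mul _),
    ← lintegral_add_right _ ((hm (z 0 2)).const_mul _)]
  refine lintegral_congr_ae ?_
  filter_upwards [h 2 (by norm_num) 0 (by norm_num), h 3 (by norm_num) 0 (by norm_num),
    h 1 (by norm_num) 2 (by norm_num), h 0 (by norm_num) 2 (by norm_num), ae_coord_ne_zero]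
    with p h20 h30 h12 h02 hp
  obtain ⟨e0, e1, e2⟩ := zeroSymbol_eq lam mu p
  have hA := axisSymbol_ne_zero hp
  simp only [symbolWeight, Fin.sum_univ_three, add_mul, one_mul,
    ← enorm_sqrt_sq hlam, ← enorm_sqrt_sq hmu, ← enorm_pow, ← enorm_mul, ← add_assoc]
  congr 1
  · congr 1
    · congr 2
      rw [e0, h20, h30]
      ring
    · congr 1
      rw [e1, h20, h12]
      field_simp
  · congr 1
    rw [e2, h20, h02]
    field_simp

section

variable {a b c d : ℝ} {χ ψ : ℕ → ℝ → ℂ}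

theorem fourier_rectExt (hab : a < b) (hcd : c < d) (hχ : IsCutoff a b χ)
    (hψ : IsCutoff c d ψ) (f : 𝓢(Plane, ℂ)) (i : ℕ) (hi : i ≤ 3) (j : ℕ) (hj : j ≤ 2) :
    (𝓕 (memLp_onPlane_rectExt hab hcd hχ hψ f i j).toLp : PlaneL2) =ᵐ[volume]
      fun p => axisSymbol 0 p ^ i * axisSymbol 1 p ^ j *
        (𝓕 (memLp_onPlane_rectExt hab hcd hχ hψ f 0 0).toLp : PlaneL2) p := by
  induction i with
  | zero =>
    induction j with
    | zero => simp
    | succ j ih =>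
      have h := fourier_toLp_of_hasLineDerivAt (memLp_onPlane_rectExt hab hcd hχ hψ f 0 j)
        (memLp_onPlane_rectExt hab hcd hχ hψ f 0 (j + 1)) 1 (hasLineDerivAt_onPlane_snd
          fun x y => hasDerivAt_rectExt_snd hcd hψ (isJet_jetS f) (exists_bound_jetS f 0) 0
            (by omega) x y)
      filter_upwards [h, ih (by omega)] with p h1 h2
      rw [h1, h2, axisSymbol, axisSymbol]
      ring
  | succ i ih =>
    have h := fourier_toLp_of_hasLineDerivAt (memLp_onPlane_rectExt hab hcd hχ hψ f i j)
      (memLp_onPlane_rectExt hab hcd hχ hψ f (i + 1) j) 0 (hasLineDerivAt_onPlane_fst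
        fun x y => hasDerivAt_rectExt_fst hab hcd hχ hψ (isJet_jetS f) (exists_bound_jetS f 0)
          (by omega) j x y)
    filter_upwards [h, ih (by omega)] with p h1 h2
    rw [h1, h2, axisSymbol, axisSymbol]
    ring

/-- The extension is bounded for the norm of `X⁰`, which on `∂_x² f` consists of the `L²` norms of
`∂_x² f`, `∂_x³ f`, `∂_x ∂_y² f` and `∂_y² f`. -/
theorem exists_fourierEnergy_extS_le (hab : a < b) (hcd : c < d) (hχ : IsCutoff a b χ)
    (hψ : IsCutoff c d ψ) {lam mu : ℝ} (hlam : 0 ≤ lam) (hmu : 0 ≤ mu) :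
    ∃ C : ℝ≥0, ∀ f, fourierEnergy (symbolWeight (zeroSymbol lam mu)) (extS hab hcd hχ hψ f) ≤
      C * fourierEnergy (symbolWeight (zeroSymbol lam mu)) ((partialS 2 0 f).toLp 2 volume) := by
  obtain ⟨C, hC⟩ := exists_sqInt₂_rectExt_le hab hcd hχ hψ
  refine ⟨C * (2 + lam.toNNReal + mu.toNNReal), fun f => ?_⟩
  obtain ⟨h20, h⟩ := hC _ (isJet_jetS f) (exists_bound_jetS f 0)
  have h30 := h (3, 0) (by simp)
  have h12 := h (1, 2) (by simp)
  have h02 := h (0, 2) (by simp)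
  simp only [← enorm_rectExt_jetS_sq hab hcd hχ hψ] at h20 h30 h12 h02
  have e1 := fourierEnergy_zeroSymbol_eq hlam hmu (fourier_rectExt hab hcd hχ hψ f)
  have e2 := fourierEnergy_zeroSymbol_eq hlam hmu
    (z := fun i j => (partialS i j f).toLp 2 volume) fun i _ j _ => fourier_partialS f i j
  have k (i j : ℕ) := sqInt₂_jetS_le (a := a) (b := b) (c := c) (d := d) f i j
  refine e1.trans_le ?_
  refine le_trans ?_ (mul_le_mul_right e2.ge _)
  set L := ENNReal.ofReal lam
  set M := ENNReal.ofReal mu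
  set U := fun i j => ‖((partialS i j f).toLp 2 volume : PlaneL2)‖ₑ ^ 2
  have hC' : ((C * (2 + lam.toNNReal + mu.toNNReal) : ℝ≥0) : ℝ≥0∞) = C * (2 + L + M) := by
    push_cast
    rfl
  rw [hC']
  calc _ ≤ C * U 2 0 + C * (U 2 0 + U 3 0) + L * (C * (U 2 0 + U 1 2)) +
        M * (C * (U 2 0 + U 0 2)) := by
        gcongr
        · exact h20.trans (by gcongr; exact k 2 0)
        · exact h30.trans (by gcongr <;> exact k _ _)
        · exact h12.trans (by gcongr <;> exact k _ _)
        · exact h02.trans (by gcongr <;> exact k _ _)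
    _ ≤ C * U 2 0 + C * (U 2 0 + U 3 0) + L * (C * (U 2 0 + U 1 2)) +
        M * (C * (U 2 0 + U 0 2)) + C * (1 + L + M) * (U 3 0 + L * U 1 2 + M * U 0 2) :=
        le_self_add
    _ = C * (2 + L + M) * (U 2 0 + U 3 0 + L * U 1 2 + M * U 0 2) := by ring

end

/-- A bounded extension operator for `L²` of a rectangle which is bounded for the norm of `X⁰`,
too. -/
theorem exists_extension {lam mu : ℝ} (hlam : 0 ≤ lam) (hmu : 0 ≤ mu) {a b c d : ℝ}
    (hab : a < b) (hcd : c < d) :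
    ∃ (E : RegionL2 (openRect a b c d) →L[ℂ] PlaneL2) (C : ℝ≥0),
      (∀ f, restrictL2 (openRect a b c d) (E f) = f) ∧
      ∀ g, fourierEnergy (symbolWeight (zeroSymbol lam mu)) g < ∞ →
        fourierEnergy (symbolWeight (zeroSymbol lam mu)) (E (restrictL2 (openRect a b c d) g)) ≤
          C * fourierEnergy (symbolWeight (zeroSymbol lam mu)) g := by
  obtain ⟨χ, hχ⟩ := exists_isCutoff hab
  obtain ⟨ψ, hψ⟩ := exists_isCutoff hcd
  set Ω := openRect a b c d
  set w := symbolWeight (zeroSymbol lam mu)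
  have hw : Measurable w := measurable_symbolWeight (measurable_zeroSymbol lam mu)
  have hdense := denseRange_restrictS (measurableSet_openRect a b c d)
  set E := (extS hab hcd hχ hψ).extendOfNorm (restrictS Ω)
  have hE (f) : E (restrictS Ω f) = extS hab hcd hχ hψ f :=
    LinearMap.extendOfNorm_eq hdense (exists_norm_extS_le hab hcd hχ hψ) f
  obtain ⟨C, hC⟩ := exists_fourierEnergy_extS_le hab hcd hχ hψ hlam hmu
  refine ⟨E, C * 2, fun f => ?_, fun g hg => ?_⟩
  · refine hdense.induction_on (p := fun f => restrictL2 Ω (E f) = f) f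
      (isClosed_eq (by fun_prop) continuous_id) fun f => ?_
    rw [hE]
    exact restrictL2_extS hab hcd hχ hψ f
  · obtain ⟨ρ, hρ, hρw⟩ := exists_continuous_density hlam hmu
    -- `g` is approximated by `∂_x²` of Schwartz functions with error `δ` in the energy
    have key (δ : ℝ≥0) (hδ : 0 < δ) : fourierEnergy w (E (restrictL2 Ω g)) ≤
        C * (2 * (δ + fourierEnergy w g)) := by
      have hδn (n : ℕ) : 0 < (δ : ℝ) / (n + 1) := by positivity
      choose f hf using fun n : ℕ => exists_schwartz_fourierEnergy_sub_le hρ hρw hg (hδn n)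
      have hle (h : PlaneL2) : ‖h‖ₑ ^ 2 ≤ fourierEnergy w h := by
        rw [← fourierEnergy_one]
        exact lintegral_mono fun p => mul_le_mul_left (by simp [w, symbolWeight]) _
      have hlim : Filter.Tendsto (fun n => ((partialS 2 0 (f n)).toLp 2 volume : PlaneL2))
          Filter.atTop (𝓝 g) := by
        rw [tendsto_iff_norm_sub_tendsto_zero]
        have h1 : Filter.Tendsto (fun n : ℕ => Real.sqrt ((δ : ℝ) / (n + 1))) Filter.atTop
            (𝓝 0) := by
          rw [← Real.sqrt_zero]
          exact (Real.continuous_sqrt.tendsto 0).comp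
            ((tendsto_one_div_add_atTop_nhds_zero_nat.const_mul (δ : ℝ)).congr'
              (.of_forall fun n => by ring) |>.trans (by simp))
        refine squeeze_zero (fun _ => norm_nonneg _) (fun n => ?_) h1
        refine Real.le_sqrt_of_sq_le ?_
        have h2 := (hle _).trans (hf n)
        rwa [← ofReal_norm, ← ENNReal.ofReal_pow (norm_nonneg _),
          ENNReal.ofReal_le_ofReal_iff (hδn n).le] at h2
      refine fourierEnergy_le_of_tendsto hw (symbolWeight_ne_top _)
        (((E.continuous.comp (restrictL2 Ω).continuous).tendsto g).comp hlim) fun n => ?_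
      have h3 : E (restrictL2 Ω ((partialS 2 0 (f n)).toLp 2 volume)) =
          extS hab hcd hχ hψ (f n) := hE (f n)
      simp only [Function.comp_apply]
      rw [h3]
      refine (hC (f n)).trans ?_
      gcongr
      have h4 := fourierEnergy_add_le w hw ((partialS 2 0 (f n)).toLp 2 volume - g) g
      rw [sub_add_cancel] at h4
      refine h4.trans ?_
      gcongr
      refine (hf n).trans ?_
      rw [← ENNReal.ofReal_coe_nnreal]
      refine ENNReal.ofReal_le_ofReal (div_le_self δ.coe_nonneg ?_)
      linarith [n.cast_nonneg (α := ℝ)]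
    refine ENNReal.le_of_forall_pos_le_add fun ε hε _ => ?_
    have h5 := key (ε / (2 * (C + 1))) (by positivity)
    refine h5.trans ?_
    rw [mul_add, mul_add, add_comm]
    push_cast
    rw [mul_assoc]
    gcongr
    norm_cast
    have : (C : ℝ≥0) * (2 * (ε / (2 * (C + 1)))) = C / (C + 1) * ε := by
      field_simp
    rw [this]
    calc C / (C + 1) * ε ≤ 1 * ε := by
          gcongr
          exact div_le_one_of_le₀ (by simp) (by positivity)
      _ = ε := one_mul ε

/-! ### Analytic families of multipliers -/

theorem norm_exp_sub_one_sub_le (z : ℂ) : ‖exp z - 1 - z‖ ≤ ‖z‖ ^ 2 * Real.exp ‖z‖ := by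
  have h := norm_exp_sub_sum_le_norm_mul_exp z 2
  simpa [Finset.sum_range_succ, sub_sub] using h

section

variable {α : Type*} [MeasurableSpace α] {ν : Measure α}

theorem norm_Lp_top_le {f : Lp ℂ ∞ ν} {C : ℝ} (hC : 0 ≤ C) (h : ∀ᵐ x ∂ν, ‖f x‖ ≤ C) :
    ‖f‖ ≤ C := by
  rw [Lp.norm_def, eLpNorm_exponent_top]
  exact ENNReal.toReal_le_of_le_ofReal hC (eLpNormEssSup_le_of_ae_bound h)

theorem norm_exp_mul_ofReal (z : ℂ) (r : ℝ) : ‖exp (z * r)‖ = Real.exp (z.re * r) := by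
  rw [norm_exp]
  simp

/-- For bounded `ℓ`, multiplication by `exp (z ℓ)` is an entire function of `z` with values in the
bounded operators on `L²`. -/
theorem exists_differentiable_mul_exp {ℓ : α → ℝ} (hℓ : Measurable ℓ) {N : ℝ}
    (hN : ∀ x, |ℓ x| ≤ N) :
    ∃ T : ℂ → Lp ℂ 2 ν →L[ℂ] Lp ℂ 2 ν, Differentiable ℂ T ∧
      ∀ z f, T z f =ᵐ[ν] fun x => exp (z * ℓ x) * f x := by
  have hexp (z : ℂ) (x : α) : ‖exp (z * ℓ x)‖ ≤ Real.exp (‖z‖ * N) := by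
    rw [norm_exp_mul_ofReal]
    refine Real.exp_le_exp.2 ((le_abs_self _).trans ?_)
    rw [abs_mul]
    exact mul_le_mul (abs_re_le_norm z) (hN x) (abs_nonneg _) (norm_nonneg z)
  have hL (z : ℂ) : MemLp (fun x => exp (z * ℓ x)) ∞ ν :=
    memLp_top_of_bound (by fun_prop) _ (.of_forall (hexp z))
  have hL' (z : ℂ) : MemLp (fun x => ℓ x * exp (z * ℓ x)) ∞ ν :=
    memLp_top_of_bound (by fun_prop) (N * Real.exp (‖z‖ * N)) (.of_forall fun x => by
      rw [norm_mul, norm_real]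
      exact mul_le_mul (hN x) (hexp z x) (norm_nonneg _) ((abs_nonneg _).trans (hN x)))
  have hderiv (z : ℂ) : HasDerivAt (fun z => (hL z).toLp) (hL' z).toLp z := by
    rw [hasDerivAt_iff_isLittleO_nhds_zero]
    refine Asymptotics.IsBigO.trans_isLittleO (g := fun h : ℂ => h ^ 2) ?_
      (Asymptotics.isLittleO_pow_id one_lt_two)
    refine Asymptotics.IsBigO.of_bound (N ^ 2 * Real.exp N * Real.exp (‖z‖ * N)) ?_
    filter_upwards [Metric.closedBall_mem_nhds (0 : ℂ) one_pos] with h hh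
    rw [mem_closedBall_zero_iff] at hh
    rw [← MemLp.toLp_const_smul, ← MemLp.toLp_sub, ← MemLp.toLp_sub]
    refine norm_Lp_top_le (by positivity) ?_
    filter_upwards [(((hL (z + h)).sub (hL z)).sub ((hL' z).const_smul h)).coeFn_toLp] with x hx
    have hN0 : 0 ≤ N := (abs_nonneg _).trans (hN x)
    have h1 : exp ((z + h) * ℓ x) - exp (z * ℓ x) - h * (ℓ x * exp (z * ℓ x)) =
        (exp (h * ℓ x) - 1 - h * ℓ x) * exp (z * ℓ x) := by
      rw [add_mul, exp_add]
      ring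
    have h2 : ‖h * ℓ x‖ ≤ ‖h‖ * N := by
      rw [norm_mul, norm_real]
      gcongr
      exact hN x
    have h3 : ‖h * ℓ x‖ ≤ N := h2.trans (mul_le_of_le_one_left hN0 hh)
    rw [hx]
    simp only [Pi.sub_apply, Pi.smul_apply, smul_eq_mul]
    rw [h1, norm_mul, norm_pow]
    calc ‖exp (h * ℓ x) - 1 - h * ℓ x‖ * ‖exp (z * ℓ x)‖
        ≤ ((‖h‖ * N) ^ 2 * Real.exp N) * Real.exp (‖z‖ * N) := by
          gcongr
          · exact (norm_exp_sub_one_sub_le _).trans (by gcongr)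
          · exact hexp z x
      _ = _ := by ring
  set B := (ContinuousLinearMap.mul ℂ ℂ).holderL ν ∞ 2 2
  refine ⟨fun z => B (hL z).toLp, fun z => ?_, fun z f => ?_⟩
  · exact (B.hasFDerivAt.comp_hasDerivAt z (hderiv z)).differentiableAt
  · filter_upwards [(ContinuousLinearMap.mul ℂ ℂ).coeFn_holder (r := 2) (hL z).toLp f,
      (hL z).coeFn_toLp] with x h1 h2
    refine h1.trans ?_
    rw [h2]
    rfl

theorem exists_tendsto_indicator {L : α → ℝ} (hL : Measurable L) (ψ : Lp ℂ 2 ν) :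
    ∃ ψn : ℕ → Lp ℂ 2 ν, (∀ n : ℕ, ψn n =ᵐ[ν] {x | L x ≤ n}.indicator ψ) ∧
      Filter.Tendsto ψn Filter.atTop (𝓝 ψ) := by
  have hm (n : ℕ) : MeasurableSet {x | L x ≤ n} := measurableSet_le hL measurable_const
  have h (n : ℕ) := (Lp.memLp ψ).indicator (hm n)
  refine ⟨fun n => (h n).toLp, fun n => (h n).coeFn_toLp, ?_⟩
  have h1 : Filter.Tendsto (fun n => ‖(h n).toLp - ψ‖ₑ ^ 2) Filter.atTop (𝓝 0) := by
    have hψ : Measurable ψ := (Lp.stronglyMeasurable ψ).measurable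
    have he (n : ℕ) : ‖(h n).toLp - ψ‖ₑ ^ 2 =
        ∫⁻ x, ‖{x | L x ≤ n}.indicator ψ x - ψ x‖ₑ ^ 2 ∂ν := by
      rw [enorm_sq_eq_lintegral]
      refine lintegral_congr_ae ?_
      filter_upwards [Lp.coeFn_sub (h n).toLp ψ, (h n).coeFn_toLp] with x h2 h3
      rw [h2, Pi.sub_apply, h3]
    simp only [he]
    rw [← lintegral_zero (μ := ν)]
    refine tendsto_lintegral_of_dominated_convergence (fun x => ‖ψ x‖ₑ ^ 2)
      (fun n => ((hψ.indicator (hm n)).sub hψ).enorm.pow_const 2)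
      (fun n => .of_forall fun x => ?_) ?_ (.of_forall fun x => ?_)
    · dsimp only
      by_cases hx : L x ≤ n
      · rw [Set.indicator_of_mem (by exact hx)]
        simp
      · rw [Set.indicator_of_notMem (by exact hx), zero_sub, enorm_neg]
    · rw [← enorm_sq_eq_lintegral]
      finiteness
    · refine tendsto_const_nhds.congr' ?_
      obtain ⟨n, hn⟩ := exists_nat_ge (L x)
      filter_upwards [Filter.eventually_ge_atTop n] with k hk
      rw [Set.indicator_of_mem (by exact hn.trans (by exact_mod_cast hk))]
      simp
  rw [tendsto_iff_norm_sub_tendsto_zero]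
  have h2 := (Real.continuous_sqrt.tendsto 0).comp
    ((ENNReal.continuousAt_toReal ENNReal.zero_ne_top).tendsto.comp h1)
  rw [Real.sqrt_zero] at h2
  refine h2.congr fun n => ?_
  simp only [Function.comp_apply]
  rw [ENNReal.toReal_pow, toReal_enorm, Real.sqrt_sq (norm_nonneg _)]

/-- For `L ≥ 0`, the family `z ↦ exp (-z L) ψ` is continuous for `Re z ≥ 0` and analytic for
`Re z > 0`: it is the uniform limit of the entire families obtained by cutting `ψ` off where `L` is
large. -/
theorem exists_analytic_exp_neg_mul {L : α → ℝ} (hL : Measurable L) (h0 : ∀ x, 0 ≤ L x)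
    (ψ : Lp ℂ 2 ν) :
    ∃ Φ : ℂ → Lp ℂ 2 ν, (∀ z : ℂ, 0 ≤ z.re → Φ z =ᵐ[ν] fun x => exp (-z * L x) * ψ x) ∧
      ContinuousOn Φ {z | 0 ≤ z.re} ∧ DifferentiableOn ℂ Φ {z | 0 < z.re} := by
  have hle (z : ℂ) (hz : 0 ≤ z.re) (x : α) : ‖exp (-z * L x)‖ ≤ 1 := by
    rw [norm_exp_mul_ofReal, Real.exp_le_one_iff, neg_re, neg_mul, neg_nonpos]
    exact mul_nonneg hz (h0 x)
  have hmem (z : ℂ) (hz : 0 ≤ z.re) : MemLp (fun x => exp (-z * L x) * ψ x) 2 ν :=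
    have hm : AEStronglyMeasurable (fun x => exp (-z * L x)) ν := by fun_prop
    (Lp.memLp ψ).of_le (hm.mul (Lp.aestronglyMeasurable ψ)) (.of_forall fun x => by
      rw [norm_mul]
      exact mul_le_of_le_one_left (norm_nonneg _) (hle z hz x))
  classical
  obtain ⟨Φ, hΦ⟩ : ∃ Φ : ℂ → Lp ℂ 2 ν,
      ∀ z : ℂ, 0 ≤ z.re → Φ z =ᵐ[ν] fun x => exp (-z * L x) * ψ x :=
    ⟨fun z => if hz : 0 ≤ z.re then (hmem z hz).toLp else 0, fun z hz => by
      simp only [dif_pos hz]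
      exact (hmem z hz).coeFn_toLp⟩
  obtain ⟨ψn, hψn, hlim⟩ := exists_tendsto_indicator hL ψ
  have hN (n : ℕ) (x : α) : |min (L x) n| ≤ n := by
    rw [abs_of_nonneg (le_min (h0 x) n.cast_nonneg)]
    exact min_le_right _ _
  choose T hTd hT using fun n : ℕ => exists_differentiable_mul_exp (ν := ν)
    (ℓ := fun x => min (L x) n) (by fun_prop) (hN n)
  have hdiff (n : ℕ) : Differentiable ℂ fun z => T n (-z) (ψn n) := by
    have := hTd n
    fun_prop
  have hunif : TendstoUniformlyOn (fun n z => T n (-z) (ψn n)) Φ Filter.atTop {z | 0 ≤ z.re} := by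
    rw [Metric.tendstoUniformlyOn_iff]
    intro ε hε
    filter_upwards [Metric.tendsto_nhds.1 hlim ε hε] with n hn z hz
    refine lt_of_le_of_lt ?_ hn
    rw [dist_comm (ψn n), dist_eq_norm, dist_eq_norm]
    refine Lp.norm_le_norm_of_ae_le ?_
    filter_upwards [Lp.coeFn_sub (Φ z) (T n (-z) (ψn n)), Lp.coeFn_sub ψ (ψn n), hΦ z hz,
      hT n (-z) (ψn n), hψn n] with x h1 h2 h3 h4 h5
    rw [h1, h2, Pi.sub_apply, Pi.sub_apply, h3, h4, h5]
    by_cases hx : L x ≤ n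
    · rw [Set.indicator_of_mem (by exact hx), min_eq_left hx]
      simp
    · rw [Set.indicator_of_notMem (by exact hx), mul_zero, sub_zero, sub_zero, norm_mul]
      exact mul_le_of_le_one_left (norm_nonneg _) (hle z hz x)
  refine ⟨Φ, hΦ, hunif.continuousOn (.of_forall fun n => (hdiff n).continuous.continuousOn), ?_⟩
  exact (hunif.mono fun z (hz : 0 < z.re) => hz.le).tendstoLocallyUniformlyOn.differentiableOn
    (.of_forall fun n => (hdiff n).differentiableOn) (isOpen_lt continuous_const continuous_re)

/-- Interpolation of weighted `L²` norms: the three lines theorem for `exp (z ℓ) G z`, with bounded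
`ℓ` increasing to `L`. -/
theorem lintegral_exp_mul_le_of_strip {L : α → ℝ} (hL : Measurable L) (h0 : ∀ x, 0 ≤ L x)
    {G : ℂ → Lp ℂ 2 ν} (hG : DiffContOnCl ℂ G (HadamardThreeLines.verticalStrip 0 1))
    {K M : ℝ} (hM : 0 ≤ M) (hK : ∀ z : ℂ, z.re ∈ Set.Icc (0 : ℝ) 1 → ‖G z‖ ≤ K)
    (hl : ∀ z : ℂ, z.re = 0 → ‖G z‖ ≤ M)
    (hr : ∀ z : ℂ, z.re = 1 →
      ∫⁻ x, ENNReal.ofReal (Real.exp (2 * L x)) * ‖G z x‖ₑ ^ 2 ∂ν ≤ ENNReal.ofReal M ^ 2) :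
    ∫⁻ x, ENNReal.ofReal (Real.exp (L x)) * ‖G (1 / 2) x‖ₑ ^ 2 ∂ν ≤ ENNReal.ofReal M ^ 2 := by
  have hN (n : ℕ) (x : α) : |min (L x) n| ≤ n := by
    rw [abs_of_nonneg (le_min (h0 x) n.cast_nonneg)]
    exact min_le_right _ _
  have key (n : ℕ) : ∫⁻ x, ENNReal.ofReal (Real.exp (min (L x) n)) * ‖G (1 / 2) x‖ₑ ^ 2 ∂ν ≤
      ENNReal.ofReal M ^ 2 := by
    obtain ⟨T, hTd, hT⟩ := exists_differentiable_mul_exp (ν := ν)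
      (ℓ := fun x => min (L x) n) (by fun_prop) (hN n)
    have hsq (z : ℂ) : ‖T z (G z)‖ₑ ^ 2 =
        ∫⁻ x, ENNReal.ofReal (Real.exp (2 * z.re * min (L x) n)) * ‖G z x‖ₑ ^ 2 ∂ν := by
      rw [enorm_sq_eq_lintegral]
      refine lintegral_congr_ae ?_
      filter_upwards [hT z (G z)] with x hx
      rw [hx, enorm_mul, mul_pow, ← ofReal_norm, norm_exp_mul_ofReal,
        ← ENNReal.ofReal_pow (Real.exp_pos _).le, ← Real.exp_nat_mul]
      norm_num [mul_assoc]
    have hbd (z : ℂ) (hz : z.re ∈ Set.Icc (0 : ℝ) 1) : ‖T z (G z)‖ ≤ Real.exp n * K := by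
      refine (Lp.norm_le_mul_norm_of_ae_le_mul (c := Real.exp n) (g := G z) ?_).trans ?_
      · filter_upwards [hT z (G z)] with x hx
        rw [hx, norm_mul, norm_exp_mul_ofReal]
        gcongr
        calc z.re * min (L x) n ≤ 1 * n :=
              mul_le_mul hz.2 (min_le_right _ _) (le_min (h0 x) n.cast_nonneg) zero_le_one
          _ = n := one_mul _
      · gcongr
        exact hK z hz
    have hM' {z : ℂ} : ‖T z (G z)‖ ≤ M ↔ ‖T z (G z)‖ₑ ^ 2 ≤ ENNReal.ofReal M ^ 2 := by
      rw [← ofReal_norm, ← ENNReal.ofReal_pow (norm_nonneg _), ← ENNReal.ofReal_pow hM,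
        ENNReal.ofReal_le_ofReal_iff (by positivity), sq_le_sq₀ (norm_nonneg _) hM]
    have h := HadamardThreeLines.norm_le_interp_of_mem_verticalClosedStrip₀₁'
      (fun z => T z (G z)) (z := 1 / 2) (a := M) (b := M)
      (by norm_num [HadamardThreeLines.verticalClosedStrip]) ?_ ?_ ?_ ?_
    · have h2 : ‖T (1 / 2) (G (1 / 2))‖ ≤ M := by
        refine h.trans_eq ?_
        rw [← Real.rpow_add_of_nonneg hM (by norm_num) (by norm_num)]
        simp
      rw [hM', hsq] at h2
      simpa using h2
    · exact ⟨fun z hz => (hTd z).differentiableWithinAt.clm_apply (hG.1 z hz),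
        hTd.continuous.continuousOn.clm_apply hG.2⟩
    · refine ⟨Real.exp n * K, ?_⟩
      rintro _ ⟨z, hz, rfl⟩
      exact hbd z hz
    · intro z hz
      have hz : z.re = 0 := hz
      refine le_trans ?_ (hl z hz)
      refine Lp.norm_le_norm_of_ae_le ?_
      filter_upwards [hT z (G z)] with x hx
      rw [hx, norm_mul, norm_exp_mul_ofReal, hz]
      simp
    · intro z hz
      have hz : z.re = 1 := hz
      rw [hM', hsq]
      refine le_trans (lintegral_mono fun x => ?_) (hr z hz)
      rw [hz, mul_one]
      gcongr
      exact min_le_left _ _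
  have hmono : ∀ᵐ x ∂ν, Monotone fun n : ℕ =>
      ENNReal.ofReal (Real.exp (min (L x) n)) * ‖G (1 / 2) x‖ₑ ^ 2 :=
    .of_forall fun x m n hmn => by
      dsimp only
      gcongr
  refine le_of_tendsto' (lintegral_tendsto_of_tendsto_of_monotone (fun n => ?_) hmono
    (.of_forall fun x => ?_)) key
  · have := (Lp.stronglyMeasurable (G (1 / 2))).measurable
    fun_prop
  · refine tendsto_const_nhds.congr' ?_
    obtain ⟨n, hn⟩ := exists_nat_ge (L x)
    filter_upwards [Filter.eventually_ge_atTop n] with m hm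
    rw [min_eq_left (hn.trans (by exact_mod_cast hm))]

end

/-! ### The norms of `X^{1/2}` and `X⁰` as weighted norms -/

theorem symbolWeight_eq_ofReal (m : Fin 3 → Plane → ℂ) (p : Plane) :
    symbolWeight m p = ENNReal.ofReal (1 + ∑ k, ‖m k p‖ ^ 2) := by
  rw [ENNReal.ofReal_add zero_le_one (by positivity), ENNReal.ofReal_one,
    ENNReal.ofReal_sum_of_nonneg fun k _ => by positivity]
  simp only [ENNReal.ofReal_pow (norm_nonneg _), ofReal_norm]
  rfl

/-- Half the logarithm of the weight of `X⁰`, so that the norm of `X⁰` is the `L²` norm of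
`exp (growth) · 𝓕 f` and that of `X^{1/2}` is equivalent to the `L²` norm of
`exp (growth / 2) · 𝓕 f`. -/
noncomputable def growth (lam mu : ℝ) (p : Plane) : ℝ :=
  1 / 2 * Real.log (1 + ∑ k, ‖zeroSymbol lam mu k p‖ ^ 2)

theorem measurable_growth (lam mu : ℝ) : Measurable (growth lam mu) := by
  have := measurable_zeroSymbol lam mu
  unfold growth
  fun_prop

theorem growth_nonneg (lam mu : ℝ) (p : Plane) : 0 ≤ growth lam mu p :=
  mul_nonneg (by norm_num) (Real.log_nonneg (le_add_of_nonneg_right (by positivity)))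

theorem exp_growth (lam mu : ℝ) (p : Plane) :
    Real.exp (growth lam mu p) = Real.sqrt (1 + ∑ k, ‖zeroSymbol lam mu k p‖ ^ 2) := by
  have h : 0 < 1 + ∑ k, ‖zeroSymbol lam mu k p‖ ^ 2 := by positivity
  rw [growth, mul_comm, ← div_eq_mul_one_div, ← Real.log_sqrt h.le,
    Real.exp_log (Real.sqrt_pos.2 h)]

theorem ofReal_exp_two_mul_growth (lam mu : ℝ) (p : Plane) :
    ENNReal.ofReal (Real.exp (2 * growth lam mu p)) = symbolWeight (zeroSymbol lam mu) p := by
  rw [two_mul, Real.exp_add, exp_growth, Real.mul_self_sqrt (by positivity),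
    symbolWeight_eq_ofReal]

theorem norm_sqrt (r : ℝ) : ‖(Real.sqrt r : ℂ)‖ = Real.sqrt r := by
  rw [norm_real, Real.norm_of_nonneg (Real.sqrt_nonneg r)]

/-- Up to constants, the symbols of `X⁰` are the squares of those of `X^{1/2}`. -/
theorem norm_halfSymbol_sq (lam mu : ℝ) (p : Plane) :
    ‖halfSymbol lam mu 0 p‖ ^ 2 = ‖zeroSymbol lam mu 0 p‖ ∧
    ‖halfSymbol lam mu 1 p‖ ^ 2 = Real.sqrt lam * ‖zeroSymbol lam mu 1 p‖ ∧
    ‖halfSymbol lam mu 2 p‖ ^ 2 = Real.sqrt mu * ‖zeroSymbol lam mu 2 p‖ := by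
  have hpow (s : ℝ) : ‖((‖axisSymbol 0 p‖ ^ s : ℝ) : ℂ)‖ ^ 2 = ‖axisSymbol 0 p‖ ^ (2 * s) := by
    rw [norm_real, Real.norm_of_nonneg (by positivity), ← Real.rpow_natCast,
      ← Real.rpow_mul (norm_nonneg _), mul_comm]
    rfl
  have hx : ‖axisSymbol 0 p‖ = |2 * Real.pi * p 0| := by
    simp [axisSymbol, abs_mul]
  obtain ⟨e0, e1, e2⟩ := zeroSymbol_eq lam mu p
  have f0 : halfSymbol lam mu 0 p = ((‖axisSymbol 0 p‖ ^ (1 / 2 : ℝ) : ℝ) : ℂ) := by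
    rw [hx]
    rfl
  have f1 : halfSymbol lam mu 1 p = Real.sqrt lam *
      ((‖axisSymbol 0 p‖ ^ (-(1 / 2) : ℝ) : ℝ) : ℂ) * axisSymbol 1 p := by
    rw [hx]
    rfl
  have f2 : halfSymbol lam mu 2 p = Real.sqrt mu * (axisSymbol 0 p)⁻¹ * axisSymbol 1 p := rfl
  rw [e0, e1, e2, f0, f1, f2]
  simp only [norm_mul, norm_pow, norm_inv, norm_sqrt, mul_pow, hpow]
  refine ⟨by norm_num, ?_, by ring⟩
  rw [show (2 : ℝ) * -(1 / 2) = -1 by norm_num, Real.rpow_neg_one]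
  ring

/-- The weight of `X^{1/2}` is equivalent to the square root of that of `X⁰`; if `λ` or `μ`
vanishes, so do the symbols that carry the factor, which makes the junk value `0⁻¹ = 0` in the
constant harmless. -/
theorem exists_symbolWeight_half_equiv (lam mu : ℝ) :
    ∃ K : ℝ, 0 < K ∧ ∀ p,
      symbolWeight (halfSymbol lam mu) p ≤
        ENNReal.ofReal K * ENNReal.ofReal (Real.exp (growth lam mu p)) ∧
      ENNReal.ofReal (Real.exp (growth lam mu p)) ≤
        ENNReal.ofReal K * symbolWeight (halfSymbol lam mu) p := by
  set s := Real.sqrt lam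
  set t := Real.sqrt mu
  have hs : 0 ≤ s := Real.sqrt_nonneg _
  have ht : 0 ≤ t := Real.sqrt_nonneg _
  refine ⟨2 + s + t + s⁻¹ + t⁻¹, by positivity, fun p => ?_⟩
  obtain ⟨h0, h1, h2⟩ := norm_halfSymbol_sq lam mu p
  rw [symbolWeight_eq_ofReal, ← ENNReal.ofReal_mul (by positivity),
    ← ENNReal.ofReal_mul (by positivity)]
  rw [exp_growth, Fin.sum_univ_three, Fin.sum_univ_three, h0, h1, h2]
  have hB : ‖zeroSymbol lam mu 1 p‖ ≤ s⁻¹ * (s * ‖zeroSymbol lam mu 1 p‖) := by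
    rcases eq_or_ne s 0 with h | h
    · have : zeroSymbol lam mu 1 p = 0 := by
        rw [(zeroSymbol_eq lam mu p).2.1, show Real.sqrt lam = 0 from h]
        simp
      simp [this]
    · rw [inv_mul_cancel_left₀ h]
  have hD : ‖zeroSymbol lam mu 2 p‖ ≤ t⁻¹ * (t * ‖zeroSymbol lam mu 2 p‖) := by
    rcases eq_or_ne t 0 with h | h
    · have : zeroSymbol lam mu 2 p = 0 := by
        rw [(zeroSymbol_eq lam mu p).2.2, show Real.sqrt mu = 0 from h]
        simp
      simp [this]
    · rw [inv_mul_cancel_left₀ h]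
  set A := ‖zeroSymbol lam mu 0 p‖
  set B := ‖zeroSymbol lam mu 1 p‖
  set D := ‖zeroSymbol lam mu 2 p‖
  have hA0 : 0 ≤ A := norm_nonneg _
  have hB0 : 0 ≤ B := norm_nonneg _
  have hD0 : 0 ≤ D := norm_nonneg _
  set S := Real.sqrt (1 + (A ^ 2 + B ^ 2 + D ^ 2))
  have hsi : 0 ≤ s⁻¹ := inv_nonneg.2 hs
  have hti : 0 ≤ t⁻¹ := inv_nonneg.2 ht
  constructor
  · refine ENNReal.ofReal_le_ofReal ?_
    have k0 : 1 ≤ S := Real.le_sqrt_of_sq_le (by nlinarith)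
    have k1 : A ≤ S := Real.le_sqrt_of_sq_le (by nlinarith)
    have k2 : B ≤ S := Real.le_sqrt_of_sq_le (by nlinarith)
    have k3 : D ≤ S := Real.le_sqrt_of_sq_le (by nlinarith)
    calc 1 + (A + s * B + t * D) ≤ S + (S + s * S + t * S) := by gcongr
      _ ≤ S + (S + s * S + t * S) + (s⁻¹ + t⁻¹) * S := le_add_of_nonneg_right (by positivity)
      _ = _ := by ring
  · refine ENNReal.ofReal_le_ofReal ?_
    have k : S ≤ 1 + A + B + D := by
      refine Real.sqrt_le_iff.2 ⟨by positivity, ?_⟩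
      nlinarith [mul_nonneg hA0 hB0, mul_nonneg hA0 hD0, mul_nonneg hB0 hD0]
    set P := s * B
    set Q := t * D
    have hP : 0 ≤ P := mul_nonneg hs hB0
    have hQ : 0 ≤ Q := mul_nonneg ht hD0
    calc S ≤ 1 + A + s⁻¹ * P + t⁻¹ * Q := by linarith
      _ ≤ 1 * (1 + (A + P + Q)) + s⁻¹ * (1 + (A + P + Q)) + t⁻¹ * (1 + (A + P + Q)) := by
        have q1 : s⁻¹ * P ≤ s⁻¹ * (1 + (A + P + Q)) :=
          mul_le_mul_of_nonneg_left (by linarith) hsi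
        have q2 : t⁻¹ * Q ≤ t⁻¹ * (1 + (A + P + Q)) :=
          mul_le_mul_of_nonneg_left (by linarith) hti
        linarith
      _ ≤ 1 * (1 + (A + P + Q)) + s⁻¹ * (1 + (A + P + Q)) + t⁻¹ * (1 + (A + P + Q)) +
          (1 + s + t) * (1 + (A + P + Q)) := le_add_of_nonneg_right (by positivity)
      _ = _ := by ring

theorem measurable_halfSymbol (lam mu : ℝ) (k : Fin 3) : Measurable (halfSymbol lam mu k) := by
  fin_cases k <;> simp [halfSymbol] <;> fun_prop

namespace MultSpace

variable {m : Fin 3 → Plane → ℂ}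

theorem fourierEnergy_incl (hm : ∀ k, Measurable (m k)) (f : MultSpace m) :
    fourierEnergy (symbolWeight m) (incl m f) = ‖f‖ₑ ^ 2 := by
  have hF : Measurable (𝓕 f.1 : PlaneL2) := (Lp.stronglyMeasurable _).measurable
  have h1 : ‖f‖ₑ ^ 2 = ‖toL2 m f‖ₑ ^ 2 + ∑ k, ‖part m k f‖ₑ ^ 2 := by
    simp only [← ofReal_norm, ← ENNReal.ofReal_pow (norm_nonneg _)]
    rw [norm_sq_eq, ENNReal.ofReal_add (by positivity) (by positivity),
      ENNReal.ofReal_sum_of_nonneg fun k _ => by positivity]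
  have h2 : ‖toL2 m f‖ₑ ^ 2 = ∫⁻ p, ‖(𝓕 f.1 : PlaneL2) p‖ₑ ^ 2 := by
    rw [← enorm_fourier, enorm_sq_eq_lintegral]
    rfl
  have h3 (k : Fin 3) : ‖part m k f‖ₑ ^ 2 = ∫⁻ p, ‖m k p * (𝓕 f.1 : PlaneL2) p‖ₑ ^ 2 := by
    rw [← eLpNorm_two_sq, ← Lp.enorm_toLp (hf := f.2 k)]
    rfl
  have hk (k : Fin 3) : Measurable fun p => ‖m k p * (𝓕 f.1 : PlaneL2) p‖ₑ ^ 2 := by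
    have := hm k
    fun_prop
  rw [h1, h2, Finset.sum_congr rfl fun k _ => h3 k,
    ← lintegral_finsetSum _ fun k _ => hk k, ← lintegral_add_left (by fun_prop)]
  refine lintegral_congr fun p => ?_
  rw [symbolWeight, add_mul, one_mul, Finset.sum_mul]
  simp only [enorm_mul, mul_pow]
  rfl

theorem exists_of_fourierEnergy_lt_top (hm : ∀ k, Measurable (m k)) {g : PlaneL2}
    (hg : fourierEnergy (symbolWeight m) g < ∞) : ∃ f : MultSpace m, incl m f = g := by
  have hF : Measurable (𝓕 g : PlaneL2) := (Lp.stronglyMeasurable _).measurable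
  refine ⟨⟨g, fun k => ?_⟩, rfl⟩
  have := hm k
  rw [memLp_two_iff (by fun_prop)]
  refine lt_of_le_of_lt (lintegral_mono fun p => ?_) hg
  rw [enorm_mul, mul_pow, symbolWeight]
  gcongr
  exact (Finset.single_le_sum (f := fun k => ‖m k p‖ₑ ^ 2) (fun _ _ => zero_le)
    (Finset.mem_univ k)).trans le_add_self

end MultSpace

/-! ### The interpolation space is contained in `X^{1/2}(Ω)` -/

section

variable {A₀ A₁ V : Type*} [NormedAddCommGroup A₀] [NormedSpace ℂ A₀]
  [NormedAddCommGroup A₁] [NormedSpace ℂ A₁] [NormedAddCommGroup V] [NormedSpace ℂ V]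

theorem SumSpace.continuous_toAmbient (i₀ : A₀ →L[ℂ] V) (i₁ : A₁ →L[ℂ] V) :
    Continuous (SumSpace.toAmbient i₀ i₁) :=
  (Submodule.isQuotientMap_mkQ _).continuous_iff.2 (i₀.coprod i₁).continuous

/-- The couple being embedded in a Hausdorff space, the norm of the sum is separated. -/
instance SumSpace.isClosed_ker (i₀ : A₀ →L[ℂ] V) (i₁ : A₁ →L[ℂ] V) :
    IsClosed (LinearMap.ker (i₀.coprod i₁ : A₀ × A₁ →ₗ[ℂ] V) : Set (A₀ × A₁)) :=
  (i₀.coprod i₁).isClosed_ker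

theorem InterpFun.norm_left_le {i₀ : A₀ →L[ℂ] V} {i₁ : A₁ →L[ℂ] V} (F : InterpFun i₀ i₁) (t : ℝ) :
    ‖F.left t‖ ≤ F.size := by
  refine le_trans ?_ (le_max_left _ _)
  exact (BoundedContinuousFunction.norm_coe_le_norm F.left.toBCF t)

theorem InterpFun.norm_right_le {i₀ : A₀ →L[ℂ] V} {i₁ : A₁ →L[ℂ] V} (F : InterpFun i₀ i₁) (t : ℝ) :
    ‖F.right t‖ ≤ F.size := by
  refine le_trans ?_ (le_max_right _ _)
  exact (BoundedContinuousFunction.norm_coe_le_norm F.right.toBCF t)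

end

theorem XZero.exists_restrictL2_eq_incl {lam mu : ℝ} {Ω : Set Plane} {f : XZero lam mu Ω} {S : ℝ}
    (h : ‖f‖ < S) : ∃ g, fourierEnergy (symbolWeight (zeroSymbol lam mu)) g ≤
      ENNReal.ofReal S ^ 2 ∧ restrictL2 Ω g = XZero.incl lam mu Ω f := by
  obtain ⟨g, hg, hlt⟩ := RangeSpace.exists_lt h
  refine ⟨MultSpace.incl _ g, ?_, hg⟩
  rw [MultSpace.fourierEnergy_incl (measurable_zeroSymbol lam mu), ← ofReal_norm]
  gcongr

/-- If `Ω` has an extension operator that is bounded on `L²` and on `X⁰`, then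
`[L²(Ω), X⁰(Ω)]_{[1/2]}` is contained in `X^{1/2}(Ω)`: extend, and apply the three lines theorem on
the Fourier side. -/
theorem exists_xHalf_eq_interpFun {lam mu : ℝ} {Ω : Set Plane} {E : RegionL2 Ω →L[ℂ] PlaneL2}
    (hE : ∀ f, restrictL2 Ω (E f) = f) {C : ℝ≥0}
    (hC : ∀ g, fourierEnergy (symbolWeight (zeroSymbol lam mu)) g < ∞ →
      fourierEnergy (symbolWeight (zeroSymbol lam mu)) (E (restrictL2 Ω g)) ≤
        C * fourierEnergy (symbolWeight (zeroSymbol lam mu)) g) :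
    ∃ B : ℝ, 0 < B ∧ ∀ F : InterpFun (ContinuousLinearMap.id ℂ (RegionL2 Ω))
        (XZero.incl lam mu Ω), ∀ S : ℝ, F.size < S →
      ∃ f : XHalf lam mu Ω, XHalf.incl lam mu Ω f =
        SumSpace.toAmbient (ContinuousLinearMap.id ℂ (RegionL2 Ω))
          (XZero.incl lam mu Ω) (F.toFun (1 / 2)) ∧ ‖f‖ ≤ B * S := by
  obtain ⟨K, hK, hKw⟩ := exists_symbolWeight_half_equiv lam mu
  set i₀ := ContinuousLinearMap.id ℂ (RegionL2 Ω)
  set i₁ := XZero.incl lam mu Ω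
  -- the bounds of the extension on `L²` and on `X⁰`
  set D := ‖E‖ + Real.sqrt C
  have hD : 0 ≤ D := by positivity
  refine ⟨Real.sqrt K * D + 1, by positivity, fun F S hS => ?_⟩
  have hS0 : 0 ≤ S := ((norm_nonneg _).trans (F.norm_left_le 0)).trans hS.le
  set A : SumSpace i₀ i₁ →L[ℂ] RegionL2 Ω :=
    ⟨SumSpace.toAmbient i₀ i₁, SumSpace.continuous_toAmbient i₀ i₁⟩
  set P : SumSpace i₀ i₁ →L[ℂ] PlaneL2 :=
    ((Lp.fourierTransformₗᵢ Plane ℂ).toContinuousLinearEquiv : PlaneL2 →L[ℂ] PlaneL2) ∘L E ∘L A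
  have hP (v) : P v = 𝓕 (E (A v)) := rfl
  have hleft (t : ℝ) : A (F.toFun (t * I)) = F.left t := by
    rw [F.left_eq]
    change i₀ (F.left t) + i₁ 0 = F.left t
    rw [map_zero, add_zero]
    rfl
  have hright (t : ℝ) : A (F.toFun (1 + t * I)) = i₁ (F.right t) := by
    rw [F.right_eq]
    change i₀ 0 + i₁ (F.right t) = i₁ (F.right t)
    rw [map_zero, zero_add]
  obtain ⟨M, hM⟩ := F.bounded
  have hstrip := lintegral_exp_mul_le_of_strip (measurable_growth lam mu) (growth_nonneg lam mu)
    (G := fun z => P (F.toFun z)) (K := ‖P‖ * M) (M := D * S) ?_ (by positivity) ?_ ?_ ?_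
  · set v := A (F.toFun (1 / 2))
    have henergy : fourierEnergy (symbolWeight (halfSymbol lam mu)) (E v) ≤
        ENNReal.ofReal (Real.sqrt K * (D * S)) ^ 2 := by
      calc fourierEnergy (symbolWeight (halfSymbol lam mu)) (E v)
          ≤ ∫⁻ p, ENNReal.ofReal K *
              (ENNReal.ofReal (Real.exp (growth lam mu p)) * ‖(𝓕 (E v) : PlaneL2) p‖ₑ ^ 2) := by
            refine lintegral_mono fun p => ?_
            rw [← mul_assoc]
            exact mul_le_mul_left (hKw p).1 _
        _ ≤ ENNReal.ofReal K * ENNReal.ofReal (D * S) ^ 2 := by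
            rw [lintegral_const_mul' _ _ ENNReal.ofReal_ne_top]
            gcongr
            exact hstrip
        _ = ENNReal.ofReal (Real.sqrt K * (D * S)) ^ 2 := by
            rw [ENNReal.ofReal_mul (Real.sqrt_nonneg K), mul_pow,
              ← ENNReal.ofReal_pow (Real.sqrt_nonneg K), Real.sq_sqrt hK.le]
    obtain ⟨h, hh⟩ := MultSpace.exists_of_fourierEnergy_lt_top (measurable_halfSymbol lam mu)
      (henergy.trans_lt (by finiteness))
    refine ⟨⟨v, h, ?_⟩, rfl, ?_⟩
    · change restrictL2 Ω (MultSpace.incl _ h) = v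
      rw [hh, hE]
    · refine (RangeSpace.norm_le_of_eq (g := h) ?_).trans ?_
      · change restrictL2 Ω (MultSpace.incl _ h) = v
        rw [hh, hE]
      · rw [← hh, MultSpace.fourierEnergy_incl (measurable_halfSymbol lam mu), ← ofReal_norm,
          ← ENNReal.ofReal_pow (norm_nonneg _), ← ENNReal.ofReal_pow (by positivity),
          ENNReal.ofReal_le_ofReal_iff (by positivity), sq_le_sq₀ (norm_nonneg _) (by positivity)]
          at henergy
        rw [add_mul, one_mul, mul_assoc]
        exact henergy.trans (le_add_of_nonneg_right hS0)
  · refine ⟨fun z hz => P.differentiableAt.comp_differentiableWithinAt z (F.analytic z hz), ?_⟩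
    rw [HadamardThreeLines.verticalStrip, closure_preimage_re, closure_Ioo zero_ne_one]
    exact P.continuous.comp_continuousOn F.continuousOn
  · intro z hz
    exact (P.le_opNorm _).trans (by gcongr; exact hM z hz)
  · intro z hz
    have hz' : z = z.im * I := by
      apply Complex.ext <;> simp [hz]
    rw [hP, Lp.norm_fourier_eq, hz', hleft]
    calc ‖E (F.left z.im)‖ ≤ ‖E‖ * ‖F.left z.im‖ := E.le_opNorm _
      _ ≤ D * S := by
        gcongr
        · exact le_add_of_nonneg_right (Real.sqrt_nonneg _)
        · exact (F.norm_left_le _).trans hS.le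
  · intro z hz
    have hz' : z = 1 + z.im * I := by
      apply Complex.ext <;> simp [hz]
    obtain ⟨g, hg, hgR⟩ := XZero.exists_restrictL2_eq_incl ((F.norm_right_le z.im).trans_lt hS)
    simp only [ofReal_exp_two_mul_growth]
    rw [hP, hz', hright, ← hgR]
    calc fourierEnergy (symbolWeight (zeroSymbol lam mu)) (E (restrictL2 Ω g))
        ≤ C * fourierEnergy (symbolWeight (zeroSymbol lam mu)) g :=
          hC g (hg.trans_lt (by finiteness))
      _ ≤ ENNReal.ofReal (Real.sqrt C) ^ 2 * ENNReal.ofReal S ^ 2 := by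
          rw [← ENNReal.ofReal_pow (Real.sqrt_nonneg _), Real.sq_sqrt C.coe_nonneg,
            ENNReal.ofReal_coe_nnreal]
          gcongr
      _ = ENNReal.ofReal (Real.sqrt C * S) ^ 2 := by
          rw [← mul_pow, ← ENNReal.ofReal_mul (Real.sqrt_nonneg _)]
      _ ≤ ENNReal.ofReal (D * S) ^ 2 := by
          gcongr
          exact le_add_of_nonneg_left (norm_nonneg E)

/-! ### `X^{1/2}(Ω)` is contained in the interpolation space -/

theorem norm_exp_add_mul_I_sq (s t : ℝ) :
    ‖exp ((s + t * I) ^ 2)‖ = Real.exp (s ^ 2) * Real.exp (-t ^ 2) := by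
  rw [norm_exp, ← Real.exp_add]
  congr 1
  simp [sq]
  ring

/-- Multiplication by the Gaussian `exp ((s + i t)²)` makes bounded continuous functions of `t`
vanish at infinity. -/
theorem exists_zeroAtInfty_gaussian_smul {A : Type*} [NormedAddCommGroup A] [NormedSpace ℂ A]
    {u : ℝ → A} (hu : Continuous u) {B : ℝ} (hB : ∀ t, ‖u t‖ ≤ B) (s : ℝ) :
    ∃ k : C₀(ℝ, A), (∀ t : ℝ, k t = exp ((s + t * I) ^ 2) • u t) ∧
      ‖k‖ ≤ Real.exp (s ^ 2) * B := by
  have hB0 : 0 ≤ B := (norm_nonneg _).trans (hB 0)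
  have hle (t : ℝ) : ‖exp ((s + t * I) ^ 2) • u t‖ ≤ Real.exp (s ^ 2) * B * Real.exp (-t ^ 2) := by
    rw [norm_smul, norm_exp_add_mul_I_sq]
    calc Real.exp (s ^ 2) * Real.exp (-t ^ 2) * ‖u t‖
        ≤ Real.exp (s ^ 2) * Real.exp (-t ^ 2) * B := by
          gcongr
          exact hB t
      _ = _ := by ring
  refine ⟨⟨⟨fun t => exp ((s + t * I) ^ 2) • u t, by fun_prop⟩, ?_⟩, fun t => rfl, ?_⟩
  · refine squeeze_zero_norm hle ?_
    have h1 : Filter.Tendsto (fun t : ℝ => Real.exp (-t ^ 2)) (Filter.cocompact ℝ) (𝓝 0) := by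
      refine Real.tendsto_exp_atBot.comp (Filter.tendsto_neg_atTop_atBot.comp ?_)
      refine ((Filter.tendsto_pow_atTop two_ne_zero).comp
        (tendsto_norm_cocompact_atTop (E := ℝ))).congr fun t => ?_
      simp
    simpa using h1.const_mul (Real.exp (s ^ 2) * B)
  · rw [← ZeroAtInftyContinuousMap.norm_toBCF_eq_norm,
      BoundedContinuousFunction.norm_le (by positivity)]
    exact fun t => (hle t).trans (mul_le_of_le_one_right (by positivity)
      (Real.exp_le_one_iff.2 (neg_nonpos.2 (sq_nonneg t))))

/-- The quotient map from `X` onto the range of `r`. -/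
noncomputable def RangeSpace.mk {X W : Type*} [NormedAddCommGroup X] [NormedSpace ℂ X]
    [NormedAddCommGroup W] [NormedSpace ℂ W] (r : X →L[ℂ] W) : X →L[ℂ] RangeSpace r :=
  LinearMap.mkContinuous (F := RangeSpace r)
    { toFun := fun g => ⟨r g, g, rfl⟩
      map_add' := fun g h => Subtype.ext (map_add r g h)
      map_smul' := fun t g => Subtype.ext (map_smul r t g) } 1 fun g => by
    rw [one_mul]
    exact RangeSpace.norm_le_of_eq (g := g) rfl

/-- Multiplication by `exp (-growth)` on the Fourier side maps `L²` isometrically into `X⁰`, so it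
maps a bounded continuous family `u` in `L²` to one in `X⁰`. -/
theorem exists_continuous_multSpace_lift {lam mu : ℝ} {u v : ℝ → PlaneL2} (hu : Continuous u)
    {B : ℝ} (hB : ∀ t, ‖u t‖ ≤ B)
    (h : ∀ t, (𝓕 (v t) : PlaneL2) =ᵐ[volume]
      fun p => exp (-growth lam mu p) * (u t) p) :
    ∃ w : ℝ → MultSpace (zeroSymbol lam mu), Continuous w ∧ (∀ t, ‖w t‖ ≤ B) ∧
      ∀ t, MultSpace.incl _ (w t) = v t := by
  have key {f g : PlaneL2} (hfg : (𝓕 f : PlaneL2) =ᵐ[volume]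
      fun p => exp (-growth lam mu p) * g p) :
      fourierEnergy (symbolWeight (zeroSymbol lam mu)) f = ‖g‖ₑ ^ 2 := by
    rw [enorm_sq_eq_lintegral]
    refine lintegral_congr_ae ?_
    filter_upwards [hfg] with p hp
    have h1 : ‖exp (-growth lam mu p)‖ₑ = ENNReal.ofReal (Real.exp (-growth lam mu p)) := by
      rw [← ofReal_norm, norm_exp]
      simp
    rw [hp, enorm_mul, mul_pow, ← ofReal_exp_two_mul_growth, ← mul_assoc, h1,
      ← ENNReal.ofReal_pow (Real.exp_pos _).le, ← ENNReal.ofReal_mul (Real.exp_pos _).le,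
      ← Real.exp_nat_mul, ← Real.exp_add]
    simp
  have hz := measurable_zeroSymbol lam mu
  choose w hw using fun t => MultSpace.exists_of_fourierEnergy_lt_top hz (g := v t)
    (by rw [key (h t)]; finiteness)
  have hnorm {f : MultSpace (zeroSymbol lam mu)} {g : PlaneL2}
      (hfg : (𝓕 (MultSpace.incl _ f) : PlaneL2) =ᵐ[volume]
        fun p => exp (-growth lam mu p) * g p) : ‖f‖ = ‖g‖ := by
    have h1 := key hfg
    rw [MultSpace.fourierEnergy_incl hz] at h1
    have h2 := congrArg ENNReal.toReal h1
    rw [ENNReal.toReal_pow, ENNReal.toReal_pow, toReal_enorm, toReal_enorm] at h2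
    exact (sq_eq_sq₀ (norm_nonneg _) (norm_nonneg _)).1 h2
  refine ⟨w, ?_, fun t => ?_, hw⟩
  · have hdist (s t : ℝ) : dist (w s) (w t) = dist (u s) (u t) := by
      rw [dist_eq_norm, dist_eq_norm]
      refine hnorm ?_
      rw [map_sub, hw, hw]
      filter_upwards [fourier_sub_coeFn (v s) (v t), h s, h t, Lp.coeFn_sub (u s) (u t)]
        with p h1 h2 h3 h4
      rw [h1, h2, h3, h4, Pi.sub_apply, mul_sub]
    refine continuous_iff_continuousAt.2 fun t => ?_
    have := hu.continuousAt (x := t)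
    rw [ContinuousAt, tendsto_iff_dist_tendsto_zero] at this ⊢
    simpa only [hdist] using this
  · rw [hnorm (g := u t) (by rw [hw]; exact h t)]
    exact hB t

/-- Every element of `X^{1/2}(ℝ²)`, restricted to `Ω`, is the value at `1 / 2` of the restriction to
`Ω` of the analytic family `exp ((z - 1 / 2)²) 𝓕⁻¹ (exp ((1 / 2 - z) growth) 𝓕 g)`. -/
theorem exists_interpFun {lam mu : ℝ} (Ω : Set Plane) :
    ∃ C : ℝ, 0 < C ∧ ∀ g : MultSpace (halfSymbol lam mu),
      ∃ F : InterpFun (ContinuousLinearMap.id ℂ (RegionL2 Ω)) (XZero.incl lam mu Ω),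
        SumSpace.toAmbient (ContinuousLinearMap.id ℂ (RegionL2 Ω)) (XZero.incl lam mu Ω)
          (F.toFun (1 / 2)) = restrictL2 Ω (MultSpace.incl _ g) ∧ F.size ≤ C * ‖g‖ := by
  obtain ⟨K, hK, hKw⟩ := exists_symbolWeight_half_equiv lam mu
  refine ⟨Real.exp (1 / 4) * ((‖restrictL2 Ω‖ + 1) * Real.sqrt K), by positivity, fun g => ?_⟩
  set i₀ := ContinuousLinearMap.id ℂ (RegionL2 Ω)
  set i₁ := XZero.incl lam mu Ω
  have hgm := measurable_growth lam mu
  set φ : PlaneL2 := 𝓕 (MultSpace.incl _ g) with hφ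
  have hφm : Measurable φ := (Lp.stronglyMeasurable _).measurable
  -- `ψ = exp (growth / 2) · 𝓕 g`
  have hψint : ∫⁻ p, ‖exp (growth lam mu p / 2) * φ p‖ₑ ^ 2 ≤
      ENNReal.ofReal (Real.sqrt K * ‖g‖) ^ 2 := by
    calc ∫⁻ p, ‖exp (growth lam mu p / 2) * φ p‖ₑ ^ 2
        ≤ ∫⁻ p, ENNReal.ofReal K *
            (symbolWeight (halfSymbol lam mu) p * ‖φ p‖ₑ ^ 2) := by
          refine lintegral_mono fun p => ?_
          dsimp only
          rw [enorm_mul, mul_pow, ← mul_assoc]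
          refine mul_le_mul_left (le_of_eq_of_le ?_ (hKw p).2) _
          rw [← ofReal_norm, norm_exp, ← ENNReal.ofReal_pow (Real.exp_pos _).le,
            ← Real.exp_nat_mul]
          congr 2
          simp
          ring
      _ = ENNReal.ofReal K * ‖g‖ₑ ^ 2 := by
          rw [lintegral_const_mul' _ _ ENNReal.ofReal_ne_top,
            ← MultSpace.fourierEnergy_incl (measurable_halfSymbol lam mu)]
          rfl
      _ = ENNReal.ofReal (Real.sqrt K * ‖g‖) ^ 2 := by
          rw [ENNReal.ofReal_mul (Real.sqrt_nonneg K), mul_pow,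
            ← ENNReal.ofReal_pow (Real.sqrt_nonneg K), Real.sq_sqrt hK.le, ofReal_norm]
  have hψmem : MemLp (fun p => exp (growth lam mu p / 2) * φ p) 2 volume := by
    rw [memLp_two_iff (by fun_prop)]
    exact hψint.trans_lt (by finiteness)
  set ψ : PlaneL2 := hψmem.toLp
  have hψnorm : ‖ψ‖ ≤ Real.sqrt K * ‖g‖ := by
    rw [← eLpNorm_two_sq, ← Lp.enorm_toLp (hf := hψmem), ← ofReal_norm,
      ← ENNReal.ofReal_pow (norm_nonneg _), ← ENNReal.ofReal_pow (by positivity),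
      ENNReal.ofReal_le_ofReal_iff (by positivity), sq_le_sq₀ (norm_nonneg _) (by positivity)]
      at hψint
    exact hψint
  obtain ⟨Φ, hΦ, hΦc, hΦd⟩ := exists_analytic_exp_neg_mul hgm (growth_nonneg lam mu) ψ
  have hΦnorm (z : ℂ) (hz : 0 ≤ z.re) : ‖Φ z‖ ≤ ‖ψ‖ := by
    refine Lp.norm_le_norm_of_ae_le ?_
    filter_upwards [hΦ z hz] with p hp
    rw [hp, norm_mul, norm_exp_mul_ofReal]
    refine mul_le_of_le_one_left (norm_nonneg _) (Real.exp_le_one_iff.2 ?_)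
    rw [neg_re, neg_mul, neg_nonpos]
    exact mul_nonneg hz (growth_nonneg lam mu p)
  set P : PlaneL2 →L[ℂ] PlaneL2 :=
    ((Lp.fourierTransformₗᵢ Plane ℂ).symm.toContinuousLinearEquiv : PlaneL2 →L[ℂ] PlaneL2)
  have hP (f : PlaneL2) : (𝓕 (P f) : PlaneL2) = f :=
    (Lp.fourierTransformₗᵢ Plane ℂ).apply_symm_apply f
  have hPnorm (f : PlaneL2) : ‖P f‖ = ‖f‖ := by
    rw [← Lp.norm_fourier_eq, hP]
  set R := restrictL2 Ω
  set H : ℂ → RegionL2 Ω := fun z => R (P (Φ z))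
  have hHc : ContinuousOn H {z | 0 ≤ z.re} :=
    (R.continuous.comp P.continuous).comp_continuousOn hΦc
  have hHd : DifferentiableOn ℂ H {z | 0 < z.re} := fun z hz =>
    (R.comp P).differentiableAt.comp_differentiableWithinAt z (hΦd z hz)
  set D := (‖R‖ + 1) * (Real.sqrt K * ‖g‖)
  have hHnorm (z : ℂ) (hz : 0 ≤ z.re) : ‖H z‖ ≤ D := by
    refine (R.le_opNorm _).trans ?_
    rw [hPnorm]
    exact mul_le_mul (le_add_of_nonneg_right zero_le_one) ((hΦnorm z hz).trans hψnorm)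
      (norm_nonneg _) (by positivity)
  have hline (s : ℝ) (hs : 0 ≤ s) : Continuous fun t : ℝ => Φ (s + t * I) :=
    hΦc.comp_continuous (by fun_prop) fun t => by simpa using hs
  -- the boundary values on `Re z = 1` lift to `X⁰(ℝ²)`
  obtain ⟨w, hwc, hwB, hw⟩ := exists_continuous_multSpace_lift (lam := lam) (mu := mu)
    (u := fun t => Φ ((0 : ℝ) + t * I)) (v := fun t => P (Φ ((1 : ℝ) + t * I)))
    (hline 0 le_rfl) (B := D) (fun t => by
      refine ((hΦnorm _ (by simp)).trans hψnorm).trans ?_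
      exact le_mul_of_one_le_left (by positivity) (le_add_of_nonneg_left (norm_nonneg R)))
    (fun t => by
      rw [hP]
      filter_upwards [hΦ ((0 : ℝ) + t * I) (by simp), hΦ ((1 : ℝ) + t * I) (by simp)]
        with p h1 h2
      rw [h1, h2, ← mul_assoc, ← exp_add]
      congr 2
      push_cast
      ring)
  obtain ⟨kl, hkl, hkln⟩ := exists_zeroAtInfty_gaussian_smul (u := fun t : ℝ => H ((0 : ℝ) + t * I))
    ((R.continuous.comp P.continuous).comp (hline 0 le_rfl)) (B := D)
    (fun t => hHnorm _ (by simp)) (-(1 / 2))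
  set r := (restrictL2 Ω).comp (MultSpace.incl (zeroSymbol lam mu))
  obtain ⟨kr, hkr, hkrn⟩ := exists_zeroAtInfty_gaussian_smul
    (u := fun t : ℝ => RangeSpace.mk r (w t)) ((RangeSpace.mk r).continuous.comp hwc) (B := D)
    (fun t => (RangeSpace.norm_le_of_eq (g := w t) rfl).trans (hwB t)) (1 / 2)
  set f : ℂ → RegionL2 Ω := fun z => exp ((z - 1 / 2) ^ 2) • H z
  have hgauss : Differentiable ℂ fun z : ℂ => exp ((z - 1 / 2) ^ 2) := by fun_prop
  have hfc : ContinuousOn f {z | z.re ∈ Set.Icc (0 : ℝ) 1} :=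
    hgauss.continuous.continuousOn.smul (hHc.mono fun z hz => hz.1)
  have hfd : DifferentiableOn ℂ f {z | z.re ∈ Set.Ioo (0 : ℝ) 1} :=
    hgauss.differentiableOn.smul (hHd.mono fun z hz => hz.1)
  set J : RegionL2 Ω →L[ℂ] SumSpace i₀ i₁ :=
    (Submodule.mkQL _).comp (ContinuousLinearMap.inl ℂ (RegionL2 Ω) (XZero lam mu Ω))
  have hJ (v) : J v = Submodule.Quotient.mk (v, 0) := rfl
  refine ⟨⟨fun z => J (f z), ⟨‖J‖ * (Real.exp (1 / 4) * D), fun z hz => ?_⟩, ?_, ?_, kl, kr,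
    fun t => ?_, fun t => ?_⟩, ?_, ?_⟩
  · refine (J.le_opNorm _).trans ?_
    gcongr
    rw [norm_smul]
    have hz2 : z - 1 / 2 = (z.re - 1 / 2 : ℝ) + z.im * I := by
      apply Complex.ext <;> simp
    rw [hz2, norm_exp_add_mul_I_sq]
    refine mul_le_mul ?_ (hHnorm z hz.1) (norm_nonneg _) (Real.exp_pos _).le
    rw [← Real.exp_add]
    refine Real.exp_le_exp.2 ?_
    nlinarith [hz.1, hz.2, sq_nonneg z.im]
  · exact J.continuous.comp_continuousOn hfc
  · exact fun z hz => J.differentiableAt.comp_differentiableWithinAt z (hfd z hz)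
  · have h1 : (t * I - 1 / 2 : ℂ) = ((-(1 / 2) : ℝ) : ℂ) + t * I := by
      push_cast
      ring
    rw [hkl, hJ, ofReal_zero, zero_add, ← h1]
  · rw [hJ, Submodule.Quotient.eq]
    change i₀ (f (1 + t * I) - 0) + i₁ (0 - kr t) = 0
    have h1 : i₁ (kr t) = exp (((1 / 2 : ℝ) + t * I) ^ 2) • R (MultSpace.incl _ (w t)) := by
      rw [hkr, map_smul]
      rfl
    rw [zero_sub, map_neg, h1, hw, sub_zero, ← sub_eq_add_neg, sub_eq_zero]
    change exp ((1 + t * I - 1 / 2) ^ 2) • R (P (Φ (1 + t * I))) = _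
    congr 3
    push_cast
    ring
  · change i₀ (f (1 / 2)) + i₁ 0 = _
    rw [map_zero, add_zero]
    change exp ((1 / 2 - 1 / 2) ^ 2) • R (P (Φ (1 / 2))) = _
    have h1 : Φ (1 / 2) = φ := by
      refine Lp.ext ?_
      filter_upwards [hΦ (1 / 2) (by norm_num), hψmem.coeFn_toLp] with p h1 h2
      rw [h1, h2, ← mul_assoc, ← exp_add]
      ring_nf
      simp
    have h2 : P φ = MultSpace.incl _ g :=
      (Lp.fourierTransformₗᵢ Plane ℂ).symm_apply_apply _
    rw [h1, h2, sub_self, zero_pow two_ne_zero, exp_zero, one_smul]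
  · have hD : Real.exp (1 / 4) * D = Real.exp (1 / 4) * ((‖R‖ + 1) * Real.sqrt K) * ‖g‖ := by
      simp only [D]
      ring
    refine max_le (hkln.trans_eq ?_) (hkrn.trans_eq ?_)
    · rw [← hD, show (-(1 / 2) : ℝ) ^ 2 = 1 / 4 by norm_num]
    · rw [← hD, show (1 / 2 : ℝ) ^ 2 = 1 / 4 by norm_num]

/-! ### Comparison of the two norms -/

theorem XHalf.incl_injective (lam mu : ℝ) (Ω : Set Plane) :
    Function.Injective (XHalf.incl lam mu Ω) := fun _ _ h => Subtype.ext h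

theorem mainTheorem8 (lam mu : ℝ) (hlam : 0 ≤ lam) (hmu : 0 ≤ mu) (hne : ¬ (lam = 0 ∧ mu = 0))
    (a b c d : ℝ) (hab : a < b) (hcd : c < d) :
    Set.range (XHalf.incl lam mu (openRect a b c d)) =
        interpSpace (ContinuousLinearMap.id ℂ (RegionL2 (openRect a b c d)))
          (XZero.incl lam mu (openRect a b c d)) (1 / 2) ∧
      ∃ C₁ C₂ : ℝ, 0 < C₁ ∧ 0 < C₂ ∧ ∀ f : XHalf lam mu (openRect a b c d),
        C₁ * ‖f‖ ≤ interpNorm (ContinuousLinearMap.id ℂ (RegionL2 (openRect a b c d)))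
            (XZero.incl lam mu (openRect a b c d)) (1 / 2)
            (XHalf.incl lam mu (openRect a b c d) f) ∧
        interpNorm (ContinuousLinearMap.id ℂ (RegionL2 (openRect a b c d)))
            (XZero.incl lam mu (openRect a b c d)) (1 / 2)
            (XHalf.incl lam mu (openRect a b c d) f) ≤ C₂ * ‖f‖ := by
  obtain ⟨E, C, hE, hC⟩ := exists_extension hlam hmu hab hcd
  generalize openRect a b c d = Ω at *
  obtain ⟨B₁, hB₁, h₁⟩ := exists_xHalf_eq_interpFun hE hC
  obtain ⟨B₂, hB₂, h₂⟩ := exists_interpFun (lam := lam) (mu := mu) Ω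
  set i₀ := ContinuousLinearMap.id ℂ (RegionL2 Ω)
  set i₁ := XZero.incl lam mu Ω
  -- the parameter of the interpolation space is the cast of a real number
  have hcast : (((1 / 2 : ℝ) : ℝ) : ℂ) = 1 / 2 := by norm_num
  have h₂' (f : XHalf lam mu Ω) {S : ℝ} (hS : ‖f‖ < S) : ∃ F : InterpFun i₀ i₁,
      SumSpace.toAmbient i₀ i₁ (F.toFun (1 / 2 : ℝ)) = XHalf.incl lam mu Ω f ∧
        F.size ≤ B₂ * S := by
    obtain ⟨g, hg, hlt⟩ := RangeSpace.exists_lt hS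
    obtain ⟨F, hF, hsize⟩ := h₂ g
    refine ⟨F, ?_, hsize.trans (by gcongr)⟩
    rw [hcast, hF]
    exact hg
  refine ⟨Set.ext fun v => ⟨?_, ?_⟩, B₁⁻¹, B₂, inv_pos.2 hB₁, hB₂, fun f => ⟨?_, ?_⟩⟩
  · rintro ⟨f, rfl⟩
    obtain ⟨F, hF, -⟩ := h₂' f (lt_add_one _)
    exact ⟨F, hF⟩
  · rintro ⟨F, rfl⟩
    obtain ⟨f, hf, -⟩ := h₁ F _ (lt_add_one _)
    exact ⟨f, by rw [hf, hcast]⟩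
  · obtain ⟨F₀, hF₀, -⟩ := h₂' f (lt_add_one _)
    refine le_csInf ⟨_, F₀, hF₀, rfl⟩ ?_
    rintro _ ⟨F, hF, rfl⟩
    refine le_of_forall_gt_imp_ge_of_dense fun S hS => ?_
    obtain ⟨f', hf', hle⟩ := h₁ F S hS
    rw [← hcast, hF] at hf'
    rw [XHalf.incl_injective lam mu Ω hf'] at hle
    rwa [inv_mul_le_iff₀ hB₁]
  · have hle {S : ℝ} (hS : ‖f‖ < S) :
        interpNorm i₀ i₁ (1 / 2) (XHalf.incl lam mu Ω f) ≤ B₂ * S := by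
      obtain ⟨F, hF, hsize⟩ := h₂' f hS
      unfold interpNorm
      refine le_trans (csInf_le ⟨0, ?_⟩ ⟨F, hF, rfl⟩) hsize
      rintro _ ⟨F, -, rfl⟩
      exact (norm_nonneg _).trans (le_max_left _ _)
    rw [mul_comm, ← div_le_iff₀ hB₂]
    refine le_of_forall_gt_imp_ge_of_dense fun S hS => ?_
    rw [div_le_iff₀ hB₂, mul_comm]
    exact hle hS
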